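/- Let $1\le k\le n$, let $R=\mathcal O_{\mathbb C^n,0}$ be the ring of germs at the origin of holomorphic functions on $\mathbb C^n$, let $\Omega^1$ be the $R$-module of germs at the origin of holomorphic $1$-forms and $\Omega^p=\bigwedge^p_R\Omega^1$. Put $s=n-k+1$, let $\omega_i=\sum_{t=1}^n m_{it}\,dx_t\in\Omega^1$ ($1\le i\le s$), and let $M=(m_{it})$ be the $s\times n$ matrix of coefficients. Let $W$ have basis $u_1,\dots,u_s$ and let $S^jW$ be the space of homogeneous polynomials of degree $j$ in $u_1,\dots,u_s$. Let $\mathcal C(\omega_1,\dots,\omega_s)$ be the chain complex of $R$-modules with $\mathcal C_0=\Omega^n$, $\mathcal C_t=\Omega^{k-t}\otimes S^{t-1}W$ for $1\le t\le k$, $\mathcal C_t=0$ otherwise, and differentials $d_1(\beta)=\beta\wedge\omega_1\wedge\dots\wedge\omega_s$ and $d_t(\beta\otimes\varphi)=\sum_{l=1}^{s}(\beta\wedge\omega_l)\otimes\frac{\partial\varphi}{\partial u_l}$ for $2\le t\le k$. Let $\mathcal E(M)$ be the Eagon–Northcott complex of $M$: $\mathcal E_0=R$, $\mathcal E_j=\bigwedge^{s+j-1}R^n\otimes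 S^{j-1}W$ for $1\le j\le n-s+1$, $\mathcal E_j=0$ otherwise, where $d_1(e_{i_1}\wedge\dots\wedge e_{i_s})=\Delta_{i_1,\dots,i_s}(M)$ is the $s\times s$ minor of $M$ on the columns $i_1,\dots,i_s$, and, for $j\ge 2$, $$d_j(e_{i_1}\wedge\dots\wedge e_{i_{s+j-1}}\otimes\varphi)=\sum_{l=1}^{s+j-1}\sum_{t=1}^{s}(-1)^{l-1}m_{t,i_l}\,e_{i_1}\wedge\dots\widehat{e_{i_l}}\dots\wedge e_{i_{s+j-1}}\otimes\frac{\partial\varphi}{\partial u_t}.$$ Let $Z$ be the germ at the origin of the locus where $\omega_1,\dots,\omega_s$ are linearly dependent, with its determinantal structure, i.e. with local ring $\mathcal O_{Z,0}=R/I$, where $I$ is the ideal generated by the $s\times s$ minors of $M$. (1) The complexes of $R$-modules $\mathcal C(\omega_1,\dots,\omega_s)$ and $\mathcal E(M)$ are isomorphic. (2) If $\mathcal O_{Z,0}$ is Cohen–Macaulay of Krull dimension $n-k$ (that is, $Z$ is Cohen–Macaulay of codimension $k$), then $\mathcal C(\omega_1,\dots,\omega_s)$ is a free resolution of the $R$-module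 $\mathcal O_{Z,0}$: all its terms are free, and there is a quasi-isomorphism from it to $\mathcal O_{Z,0}$ placed in degree $0$. -/

import Mathlib

open CategoryTheory TensorProduct
open scoped Topology

noncomputable section

namespace CollectionIndex

universe u

/-! ### Polynomials `φ(u)` and the differentials `∑ₗ (fₗ β) ⊗ ∂φ/∂uₗ` -/

/-- `S^j W` over `R`: homogeneous polynomials of degree `j` in the variables `u₁, …, u_s`
(a basis of `W`). -/
abbrev Sym (R : Type u) [CommRing R] (s j : ℕ) : Submodule R (MvPolynomial (Fin s) R) :=
  MvPolynomial.homogeneousSubmodule (Fin s) R j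

/-- `∂/∂u_l : S^{j+1} W → S^j W`. -/
def partialSym (R : Type u) [CommRing R] (s j : ℕ) (l : Fin s) :
    Sym R s (j + 1) →ₗ[R] Sym R s j :=
  (MvPolynomial.pderiv l : Derivation R (MvPolynomial (Fin s) R)
      (MvPolynomial (Fin s) R)).toLinearMap.restrict
    (fun _ hp => MvPolynomial.IsHomogeneous.pderiv hp)

/-- The identification of `S^0 W` with `R` (the constant coefficient). -/
def constSym (R : Type u) [CommRing R] (s : ℕ) : Sym R s 0 →ₗ[R] R :=
  (MvPolynomial.lcoeff R (0 : Fin s →₀ ℕ)) ∘ₗ (Sym R s 0).subtype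

/-- `β ⊗ φ ↦ ∑ₗ fₗ(β) ⊗ ∂φ/∂uₗ`. -/
def polyDiff {R : Type u} [CommRing R] {s : ℕ} {A B : Type u} [AddCommGroup A] [Module R A]
    [AddCommGroup B] [Module R B] (f : Fin s → A →ₗ[R] B) (j : ℕ) :
    A ⊗[R] Sym R s (j + 1) →ₗ[R] B ⊗[R] Sym R s j :=
  ∑ l, TensorProduct.map (f l) (partialSym R s j l)

/-- `β ⊗ c ↦ c • g(β)` for `c ∈ S^0 W = R`. -/
def augDiff {R : Type u} [CommRing R] (s : ℕ) {A B : Type u} [AddCommGroup A] [Module R A]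
    [AddCommGroup B] [Module R B] (g : A →ₗ[R] B) : A ⊗[R] Sym R s 0 →ₗ[R] B :=
  (TensorProduct.rid R B).toLinearMap ∘ₗ TensorProduct.map g (constSym R s)

theorem partialSym_comm (R : Type u) [CommRing R] (s j : ℕ) (l l' : Fin s) :
    partialSym R s j l ∘ₗ partialSym R s (j + 1) l' =
      partialSym R s j l' ∘ₗ partialSym R s (j + 1) l := by
  refine LinearMap.ext fun p => Subtype.ext ?_
  change MvPolynomial.pderiv l (MvPolynomial.pderiv l' (p : MvPolynomial (Fin s) R)) =
    MvPolynomial.pderiv l' (MvPolynomial.pderiv l (p : MvPolynomial (Fin s) R))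
  have h : ⁅(MvPolynomial.pderiv l : Derivation R (MvPolynomial (Fin s) R)
      (MvPolynomial (Fin s) R)), (MvPolynomial.pderiv l' : Derivation R (MvPolynomial (Fin s) R)
      (MvPolynomial (Fin s) R))⁆ = 0 := by
    apply MvPolynomial.derivation_ext
    intro i
    simp [Derivation.commutator_apply, MvPolynomial.pderiv_X, Pi.single_apply, apply_ite]
  have := congrArg (fun D => D (p : MvPolynomial (Fin s) R)) h
  simpa [Derivation.commutator_apply, sub_eq_zero] using this

theorem polyDiff_comp {R : Type u} [CommRing R] {s : ℕ} {A B C : Type u}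
    [AddCommGroup A] [Module R A] [AddCommGroup B] [Module R B] [AddCommGroup C] [Module R C]
    (f : Fin s → A →ₗ[R] B) (g : Fin s → B →ₗ[R] C)
    (h0 : ∀ l, g l ∘ₗ f l = 0) (h1 : ∀ l l', g l ∘ₗ f l' = -(g l' ∘ₗ f l)) (j : ℕ) :
    polyDiff g j ∘ₗ polyDiff f (j + 1) = 0 := by
  have e : polyDiff g j ∘ₗ polyDiff f (j + 1) = ∑ l, ∑ l', TensorProduct.map
      (g l ∘ₗ f l') (partialSym R s j l ∘ₗ partialSym R s (j + 1) l') := by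
    refine LinearMap.ext fun x => ?_
    simp [polyDiff, TensorProduct.map_comp, map_sum]
  rw [e, ← Finset.sum_product']
  refine Finset.sum_involution (fun p _ => (p.2, p.1)) ?_ ?_ ?_ ?_
  · rintro ⟨l, l'⟩ -
    rw [h1 l l', partialSym_comm R s j l l']
    refine TensorProduct.ext' fun a p => ?_
    simp [TensorProduct.neg_tmul]
  · rintro ⟨l, l'⟩ - hne heq
    simp only [Prod.mk.injEq] at heq
    obtain ⟨rfl, -⟩ := heq
    exact hne (by simp [h0])
  · simp
  · simp

theorem augDiff_comp {R : Type u} [CommRing R] {s : ℕ} {A B C : Type u}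
    [AddCommGroup A] [Module R A] [AddCommGroup B] [Module R B] [AddCommGroup C] [Module R C]
    (f : Fin s → A →ₗ[R] B) (g : B →ₗ[R] C) (h : ∀ l, g ∘ₗ f l = 0) :
    augDiff s g ∘ₗ polyDiff f 0 = 0 := by
  have e : augDiff s g ∘ₗ polyDiff f 0 = ∑ l, (TensorProduct.rid R C).toLinearMap ∘ₗ
      TensorProduct.map (g ∘ₗ f l) (constSym R s ∘ₗ partialSym R s 0 l) := by
    refine LinearMap.ext fun x => ?_
    simp [polyDiff, augDiff, TensorProduct.map_comp, map_sum]
  rw [e]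
  simp [h]

/-! ### The complex of a collection of 1-forms -/

/-- The module `Ω^{k-t} = ⋀^{k-t} Ω` of `(k-t)`-forms if `t ≤ k`, and the zero module otherwise,
inside the exterior algebra of the module `Ω` of 1-forms. -/
def forms (R : Type u) [CommRing R] (Ω : Type u) [AddCommGroup Ω] [Module R Ω] (k t : ℕ) :
    Submodule R (ExteriorAlgebra R Ω) :=
  if t ≤ k then ⋀[R]^(k - t) Ω else ⊥

theorem forms_mul_mem {R : Type u} [CommRing R] {Ω : Type u} [AddCommGroup Ω] [Module R Ω]
    (k t : ℕ) (ω : Ω) {β : ExteriorAlgebra R Ω} (hβ : β ∈ forms R Ω k (t + 1)) :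
    β * ExteriorAlgebra.ι R ω ∈ forms R Ω k t := by
  unfold forms at *
  split_ifs at hβ with h
  · rw [if_pos (by omega), show k - t = (k - (t + 1)) + 1 by omega]
    change _ ∈ LinearMap.range (ExteriorAlgebra.ι R) ^ (k - (t + 1) + 1)
    rw [pow_succ]
    exact Submodule.mul_mem_mul hβ (LinearMap.mem_range_self _ _)
  · rw [(Submodule.mem_bot R).1 hβ, zero_mul]
    exact zero_mem _

/-- `β ↦ β ∧ ω` from `(k-t-1)`-forms to `(k-t)`-forms. -/
def wedge {R : Type u} [CommRing R] {Ω : Type u} [AddCommGroup Ω] [Module R Ω]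
    (k t : ℕ) (ω : Ω) : forms R Ω k (t + 1) →ₗ[R] forms R Ω k t :=
  (LinearMap.mulRight R (ExteriorAlgebra.ι R ω)).restrict (fun _ hβ => forms_mul_mem k t ω hβ)

theorem forms_mul_all_mem {R : Type u} [CommRing R] {Ω : Type u} [AddCommGroup Ω] [Module R Ω]
    {n k : ℕ} (hk : 1 ≤ k) (hkn : k ≤ n) (ω : Fin (n - k + 1) → Ω)
    {β : ExteriorAlgebra R Ω} (hβ : β ∈ forms R Ω k 1) :
    β * ExteriorAlgebra.ιMulti R (n - k + 1) ω ∈ ⋀[R]^n Ω := by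
  rw [forms, if_pos hk] at hβ
  have h := Submodule.mul_mem_mul hβ (ExteriorAlgebra.ιMulti_range R (n - k + 1) ⟨ω, rfl⟩)
  change _ ∈ LinearMap.range (ExteriorAlgebra.ι R) ^ (k - 1) *
    LinearMap.range (ExteriorAlgebra.ι R) ^ (n - k + 1) at h
  rwa [← pow_add, show (k - 1) + (n - k + 1) = n by omega] at h

/-- `β ↦ β ∧ ω₁ ∧ … ∧ ω_{n-k+1}` from `(k-1)`-forms to `n`-forms. -/
def wedgeAll {R : Type u} [CommRing R] {Ω : Type u} [AddCommGroup Ω] [Module R Ω]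
    {n k : ℕ} (hk : 1 ≤ k) (hkn : k ≤ n) (ω : Fin (n - k + 1) → Ω) :
    forms R Ω k 1 →ₗ[R] ⋀[R]^n Ω :=
  (LinearMap.mulRight R (ExteriorAlgebra.ιMulti R (n - k + 1) ω)).restrict
    (fun _ hβ => forms_mul_all_mem hk hkn ω hβ)

theorem wedge_wedge_self {R : Type u} [CommRing R] {Ω : Type u} [AddCommGroup Ω] [Module R Ω]
    (k t : ℕ) (ω : Ω) : wedge (R := R) k t ω ∘ₗ wedge k (t + 1) ω = 0 := by
  refine LinearMap.ext fun β => Subtype.ext ?_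
  change (β : ExteriorAlgebra R Ω) * _ * _ = 0
  rw [mul_assoc, ExteriorAlgebra.ι_sq_zero, mul_zero]

theorem wedge_wedge_comm {R : Type u} [CommRing R] {Ω : Type u} [AddCommGroup Ω] [Module R Ω]
    (k t : ℕ) (ω ω' : Ω) :
    wedge (R := R) k t ω ∘ₗ wedge k (t + 1) ω' = -(wedge k t ω' ∘ₗ wedge k (t + 1) ω) := by
  refine LinearMap.ext fun β => Subtype.ext ?_
  have h := ExteriorAlgebra.ι_add_mul_swap (R := R) ω' ω
  change (β : ExteriorAlgebra R Ω) * ExteriorAlgebra.ι R ω' * ExteriorAlgebra.ι R ω =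
    -((β : ExteriorAlgebra R Ω) * ExteriorAlgebra.ι R ω * ExteriorAlgebra.ι R ω')
  rw [mul_assoc, mul_assoc, eq_neg_of_add_eq_zero_left h, mul_neg]

theorem wedgeAll_wedge {R : Type u} [CommRing R] {Ω : Type u} [AddCommGroup Ω] [Module R Ω]
    {n k : ℕ} (hk : 1 ≤ k) (hkn : k ≤ n) (ω : Fin (n - k + 1) → Ω) (l : Fin (n - k + 1)) :
    wedgeAll (R := R) hk hkn ω ∘ₗ wedge k 1 (ω l) = 0 := by
  refine LinearMap.ext fun β => Subtype.ext ?_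
  have h : ExteriorAlgebra.ι R (ω l) * ExteriorAlgebra.ιMulti R (n - k + 1) ω = 0 := by
    have h2 := ExteriorAlgebra.ιMulti_succ_apply (R := R) (Fin.cons (ω l) ω : Fin _ → Ω)
    rw [Fin.cons_zero] at h2
    have h3 : Matrix.vecTail (Fin.cons (ω l) ω : Fin (n - k + 1 + 1) → Ω) = ω := by
      ext i; simp [Matrix.vecTail]
    rw [h3] at h2
    rw [← h2]
    refine ExteriorAlgebra.ιMulti_eq_zero_of_not_inj fun hinj => ?_
    exact (Fin.succ_ne_zero l) (hinj (by simp))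
  change (β : ExteriorAlgebra R Ω) * ExteriorAlgebra.ι R (ω l) *
    ExteriorAlgebra.ιMulti R (n - k + 1) ω = 0
  rw [mul_assoc, h, mul_zero]

/-- The terms of the complex of a collection of 1-forms: `Ω^n` in degree `0` and
`Ω^{k-t} ⊗ S^{t-1} W` in degree `t ≥ 1` (so zero for `t > k`). -/
def formsComplexX (R : Type u) [CommRing R] (Ω : Type u) [AddCommGroup Ω] [Module R Ω]
    (n k : ℕ) : ℕ → ModuleCat.{u} R
  | 0 => ModuleCat.of R (⋀[R]^n Ω)
  | t + 1 => ModuleCat.of R (forms R Ω k (t + 1) ⊗[R] Sym R (n - k + 1) t)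

/-- The differentials: `d₁ β = β ∧ ω₁ ∧ … ∧ ω_{n-k+1}` and
`d_t (β ⊗ φ) = ∑ₗ (β ∧ ωₗ) ⊗ ∂φ/∂uₗ` for `t ≥ 2`. -/
def formsComplexD {R : Type u} [CommRing R] {Ω : Type u} [AddCommGroup Ω] [Module R Ω]
    {n k : ℕ} (hk : 1 ≤ k) (hkn : k ≤ n) (ω : Fin (n - k + 1) → Ω) :
    ∀ t, formsComplexX R Ω n k (t + 1) ⟶ formsComplexX R Ω n k t
  | 0 => ModuleCat.ofHom (augDiff (n - k + 1) (wedgeAll (R := R) hk hkn ω))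
  | t + 1 => ModuleCat.ofHom (polyDiff (fun l => wedge (R := R) k (t + 1) (ω l)) t)

theorem formsComplexD_comp {R : Type u} [CommRing R] {Ω : Type u} [AddCommGroup Ω] [Module R Ω]
    {n k : ℕ} (hk : 1 ≤ k) (hkn : k ≤ n) (ω : Fin (n - k + 1) → Ω) (t : ℕ) :
    formsComplexD (R := R) hk hkn ω (t + 1) ≫ formsComplexD hk hkn ω t = 0 := by
  cases t with
  | zero =>
    have := augDiff_comp (fun l => wedge (R := R) k 1 (ω l)) (wedgeAll (R := R) hk hkn ω)
      (wedgeAll_wedge hk hkn ω)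
    exact ModuleCat.hom_ext this
  | succ t =>
    have := polyDiff_comp (fun l => wedge (R := R) k (t + 2) (ω l))
      (fun l => wedge (R := R) k (t + 1) (ω l)) (fun l => wedge_wedge_self k (t + 1) (ω l))
      (fun l l' => wedge_wedge_comm k (t + 1) (ω l) (ω l')) t
    exact ModuleCat.hom_ext this

/-- The chain complex `C(ω₁, …, ω_{n-k+1})` of a collection of elements of the module `Ω` of
1-forms over `R`. -/
def formsComplex {R : Type u} [CommRing R] {Ω : Type u} [AddCommGroup Ω] [Module R Ω]
    {n k : ℕ} (hk : 1 ≤ k) (hkn : k ≤ n) (ω : Fin (n - k + 1) → Ω) :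
    ChainComplex (ModuleCat.{u} R) ℕ :=
  ChainComplex.of (formsComplexX R Ω n k) (formsComplexD hk hkn ω)
    (formsComplexD_comp hk hkn ω)

/-! ### The Eagon–Northcott complex of an `s × r` matrix -/

/-- The contraction of a wedge product by a linear form `d`:
`v₀ ∧ … ∧ v_m ↦ ∑ₗ (-1)^l d(vₗ) v₀ ∧ … v̂ₗ … ∧ v_m`. -/
theorem contractLeft_ιMulti {R : Type u} [CommRing R] {V : Type u} [AddCommGroup V] [Module R V]
    (d : Module.Dual R V) (m : ℕ) (v : Fin (m + 1) → V) :
    CliffordAlgebra.contractLeft (Q := (0 : QuadraticForm R V)) d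
        (ExteriorAlgebra.ιMulti R (m + 1) v) =
      ∑ l : Fin (m + 1), ((-1) ^ (l : ℕ) * d (v l)) •
        ExteriorAlgebra.ιMulti R m (v ∘ l.succAbove) := by
  induction m with
  | zero =>
    simp only [ExteriorAlgebra.ιMulti_succ_apply, ExteriorAlgebra.ιMulti_zero_apply, mul_one]
    erw [CliffordAlgebra.contractLeft_ι]
    simp [Algebra.algebraMap_eq_smul_one]
  | succ m ih =>
    rw [ExteriorAlgebra.ιMulti_succ_apply]
    erw [CliffordAlgebra.contractLeft_ι_mul]
    erw [ih (Matrix.vecTail v)]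
    rw [Fin.sum_univ_succ (n := m + 1), Finset.mul_sum, sub_eq_add_neg, ← Finset.sum_neg_distrib]
    congr 1
    · simp only [Fin.val_zero, pow_zero, one_mul]
      rfl
    · refine Finset.sum_congr rfl fun l _ => ?_
      rw [ExteriorAlgebra.ιMulti_succ_apply (v ∘ l.succ.succAbove)]
      have e1 : (v ∘ l.succ.succAbove) 0 = v 0 := by simp
      have e2 : Matrix.vecTail (v ∘ l.succ.succAbove) = Matrix.vecTail v ∘ l.succAbove := by
        ext i; simp [Matrix.vecTail]
      rw [e1, e2, Algebra.mul_smul_comm, Fin.val_succ, pow_succ, ← neg_smul]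
      congr 1
      simp [Matrix.vecTail]

theorem contractLeft_anticomm {R : Type u} [CommRing R] {V : Type u} [AddCommGroup V]
    [Module R V] (d d' : Module.Dual R V) (x : ExteriorAlgebra R V) :
    (CliffordAlgebra.contractLeft (Q := (0 : QuadraticForm R V)) d
      (CliffordAlgebra.contractLeft (Q := (0 : QuadraticForm R V)) d' x) : ExteriorAlgebra R V) =
      -(CliffordAlgebra.contractLeft (Q := (0 : QuadraticForm R V)) d'
        (CliffordAlgebra.contractLeft (Q := (0 : QuadraticForm R V)) d x) :
          ExteriorAlgebra R V) :=
  CliffordAlgebra.contractLeft_comm d d' x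

theorem contractLeft_mem {R : Type u} [CommRing R] {V : Type u} [AddCommGroup V] [Module R V]
    (d : Module.Dual R V) (m : ℕ) {x : ExteriorAlgebra R V} (hx : x ∈ ⋀[R]^(m + 1) V) :
    CliffordAlgebra.contractLeft (Q := (0 : QuadraticForm R V)) d x ∈ ⋀[R]^m V := by
  rw [← ExteriorAlgebra.ιMulti_span_fixedDegree] at hx
  induction hx using Submodule.span_induction with
  | mem x h =>
    obtain ⟨v, rfl⟩ := h
    rw [contractLeft_ιMulti]
    exact Submodule.sum_mem _ fun l _ =>
      Submodule.smul_mem _ _ (ExteriorAlgebra.ιMulti_range R m ⟨_, rfl⟩)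
  | zero => rw [map_zero]; exact zero_mem _
  | add x y _ _ hx hy => rw [map_add]; exact add_mem hx hy
  | smul a x _ hx => rw [map_smul]; exact Submodule.smul_mem _ _ hx

/-- Contraction `⋀^{m+1} R^r → ⋀^m R^r` by the `t`-th row of the matrix `M`, which sends
`e_{i₁} ∧ … ∧ e_{i_{m+1}}` to `∑ₗ (-1)^{l-1} m_{t,iₗ} e_{i₁} ∧ … ê_{iₗ} … ∧ e_{i_{m+1}}`. -/
def contractRow {R : Type u} [CommRing R] {s r : ℕ} (M : Matrix (Fin s) (Fin r) R) (t : Fin s)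
    (m : ℕ) : ⋀[R]^(m + 1) (Fin r → R) →ₗ[R] ⋀[R]^m (Fin r → R) :=
  (CliffordAlgebra.contractLeft (Q := (0 : QuadraticForm R (Fin r → R)))
      (LinearMap.proj t ∘ₗ M.mulVecLin)).restrict (fun _ hx => contractLeft_mem _ m hx)

/-- The linear form on `⋀^s R^r` that sends `e_{i₁} ∧ … ∧ e_{i_s}` to the minor of `M` on the
columns `i₁, …, i_s`. -/
def minorForm {R : Type u} [CommRing R] {s r : ℕ} (M : Matrix (Fin s) (Fin r) R) :
    ⋀[R]^s (Fin r → R) →ₗ[R] R :=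
  exteriorPower.alternatingMapLinearEquiv
    ((Matrix.detRowAlternating (n := Fin s) (R := R)).compLinearMap M.mulVecLin)

theorem contractRow_coe {R : Type u} [CommRing R] {s r : ℕ} (M : Matrix (Fin s) (Fin r) R)
    (t : Fin s) (m : ℕ) (x : ⋀[R]^(m + 1) (Fin r → R)) :
    (contractRow M t m x : ExteriorAlgebra R (Fin r → R)) =
      CliffordAlgebra.contractLeft (Q := (0 : QuadraticForm R (Fin r → R)))
        (LinearMap.proj t ∘ₗ M.mulVecLin) (x : ExteriorAlgebra R (Fin r → R)) := rfl

theorem contractRow_ιMulti {R : Type u} [CommRing R] {s r : ℕ} (M : Matrix (Fin s) (Fin r) R)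
    (t : Fin s) (m : ℕ) (v : Fin (m + 1) → Fin r → R) :
    contractRow M t m (exteriorPower.ιMulti R (m + 1) v) =
      ∑ l : Fin (m + 1), ((-1) ^ (l : ℕ) * M.mulVec (v l) t) •
        exteriorPower.ιMulti R m (v ∘ l.succAbove) := by
  ext
  refine (contractLeft_ιMulti _ m v).trans ?_
  simp

theorem contractRow_basis {R : Type u} [CommRing R] {s r : ℕ} (M : Matrix (Fin s) (Fin r) R)
    (t : Fin s) (m : ℕ) (i : Fin (m + 1) → Fin r) :
    contractRow M t m (exteriorPower.ιMulti R (m + 1) fun a => Pi.single (i a) 1) =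
      ∑ l : Fin (m + 1), ((-1) ^ (l : ℕ) * M t (i l)) •
        exteriorPower.ιMulti R m (fun a => Pi.single (i (l.succAbove a)) 1) := by
  rw [contractRow_ιMulti]
  simp [Function.comp_def]

theorem minorForm_ιMulti {R : Type u} [CommRing R] {s r : ℕ} (M : Matrix (Fin s) (Fin r) R)
    (v : Fin s → Fin r → R) :
    minorForm M (exteriorPower.ιMulti R s v) = Matrix.det (fun a => M.mulVec (v a)) := by
  simp only [minorForm, exteriorPower.alternatingMapLinearEquiv_apply_ιMulti]
  rfl

theorem minorForm_basis {R : Type u} [CommRing R] {s r : ℕ} (M : Matrix (Fin s) (Fin r) R)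
    (i : Fin s → Fin r) :
    minorForm M (exteriorPower.ιMulti R s fun a => Pi.single (i a) 1) =
      (M.submatrix id i).det := by
  rw [minorForm_ιMulti, ← Matrix.det_transpose]
  congr 1
  ext a b
  simp

theorem contractRow_self {R : Type u} [CommRing R] {s r : ℕ} (M : Matrix (Fin s) (Fin r) R)
    (t : Fin s) (m : ℕ) : contractRow M t m ∘ₗ contractRow M t (m + 1) = 0 := by
  refine LinearMap.ext fun x => Subtype.ext ?_
  exact CliffordAlgebra.contractLeft_contractLeft _ _

theorem contractRow_comm {R : Type u} [CommRing R] {s r : ℕ} (M : Matrix (Fin s) (Fin r) R)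
    (t t' : Fin s) (m : ℕ) :
    contractRow M t m ∘ₗ contractRow M t' (m + 1) =
      -(contractRow M t' m ∘ₗ contractRow M t (m + 1)) := by
  refine LinearMap.ext fun x => Subtype.ext ?_
  rw [LinearMap.neg_apply, Submodule.coe_neg]
  simp only [LinearMap.comp_apply, contractRow_coe]
  exact contractLeft_anticomm _ _ _

theorem minorForm_contractRow {R : Type u} [CommRing R] {s r : ℕ}
    (M : Matrix (Fin s) (Fin r) R) (t : Fin s) : minorForm M ∘ₗ contractRow M t s = 0 := by
  have key : ∀ v : Fin (s + 1) → Fin r → R,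
      minorForm M (contractRow M t s (exteriorPower.ιMulti R (s + 1) v)) = 0 := by
    intro v
    rw [contractRow_ιMulti, map_sum]
    simp only [LinearMap.map_smul, minorForm_ιMulti, smul_eq_mul]
    let N : Matrix (Fin (s + 1)) (Fin (s + 1)) R :=
      fun a b => M.mulVec (v b) ((Fin.cons t id : Fin (s + 1) → Fin s) a)
    have hN : N.det = 0 := by
      refine Matrix.det_zero_of_row_eq (i := 0) (j := t.succ) (Fin.succ_ne_zero t).symm ?_
      funext b
      simp [N]
    rw [Matrix.det_succ_row_zero] at hN
    rw [← hN]
    refine Finset.sum_congr rfl fun l _ => ?_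
    rw [← Matrix.det_transpose]
    rfl
  exact exteriorPower.linearMap_ext (AlternatingMap.ext key)

/-- The terms `R` in degree `0` and `⋀^{s+j-1} R^r ⊗ S^{j-1} W` in degree `j ≥ 1`
(zero for `j > r - s + 1`, the exterior power being zero there). -/
def eagonNorthcottX (R : Type u) [CommRing R] (s r : ℕ) : ℕ → ModuleCat.{u} R
  | 0 => ModuleCat.of R R
  | j + 1 => ModuleCat.of R (⋀[R]^(s + j) (Fin r → R) ⊗[R] Sym R s j)

/-- The differentials of the Eagon–Northcott complex. -/
def eagonNorthcottD {R : Type u} [CommRing R] {s r : ℕ} (M : Matrix (Fin s) (Fin r) R) :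
    ∀ j, eagonNorthcottX R s r (j + 1) ⟶ eagonNorthcottX R s r j
  | 0 => ModuleCat.ofHom (augDiff s (minorForm M))
  | j + 1 => ModuleCat.ofHom (polyDiff (fun t => contractRow M t (s + j)) j)

theorem eagonNorthcottD_comp {R : Type u} [CommRing R] {s r : ℕ} (M : Matrix (Fin s) (Fin r) R)
    (j : ℕ) : eagonNorthcottD M (j + 1) ≫ eagonNorthcottD M j = 0 := by
  cases j with
  | zero =>
    have := augDiff_comp (fun t => contractRow M t s) (minorForm M) (minorForm_contractRow M)
    exact ModuleCat.hom_ext this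
  | succ j =>
    have := polyDiff_comp (fun t => contractRow M t (s + j + 1))
      (fun t => contractRow M t (s + j)) (fun t => contractRow_self M t (s + j))
      (fun t t' => contractRow_comm M t t' (s + j)) j
    exact ModuleCat.hom_ext this

/-- The Eagon–Northcott complex `E(M)` of an `s × r` matrix `M` over `R` (used for `s ≤ r`). -/
def eagonNorthcott {R : Type u} [CommRing R] {s r : ℕ} (M : Matrix (Fin s) (Fin r) R) :
    ChainComplex (ModuleCat.{u} R) ℕ :=
  ChainComplex.of (eagonNorthcottX R s r) (eagonNorthcottD M) (eagonNorthcottD_comp M)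

/-- The ideal generated by the maximal minors `Δ_{i₁,…,i_s}(M)`, `i₁ < … < i_s`. -/
def maximalMinorsIdeal {R : Type u} [CommRing R] {s r : ℕ} (M : Matrix (Fin s) (Fin r) R) :
    Ideal R :=
  Ideal.span (Set.range fun i : Fin s ↪o Fin r => (M.submatrix id i).det)

/-! ### Cohen–Macaulay local rings -/

/-- A Noetherian local ring is Cohen–Macaulay if its depth equals its Krull dimension, i.e. if
it has a regular sequence whose length is the Krull dimension. (A regular sequence generates a
proper ideal, hence its members lie in the maximal ideal.) -/
def IsCohenMacaulayLocalRing (A : Type u) [CommRing A] : Prop :=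
  IsLocalRing A ∧ IsNoetherianRing A ∧
    ∃ rs : List A, RingTheory.Sequence.IsRegular A rs ∧
      ((rs.length : ℕ∞) : WithBot ℕ∞) = ringKrullDim A

/-! ### Germs of holomorphic functions and of holomorphic 1-forms at the origin of `ℂⁿ` -/

/-- The ring `𝒪_{ℂⁿ,0}` of germs at the origin of holomorphic functions. -/
def holoGerms (n : ℕ) : Subring (Filter.Germ (𝓝 (0 : Fin n → ℂ)) ℂ) where
  carrier := {g | ∃ f : (Fin n → ℂ) → ℂ, AnalyticAt ℂ f 0 ∧ (f : Filter.Germ _ ℂ) = g}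
  mul_mem' := by
    rintro _ _ ⟨f, hf, rfl⟩ ⟨g, hg, rfl⟩
    exact ⟨f * g, hf.mul hg, rfl⟩
  one_mem' := ⟨1, analyticAt_const, rfl⟩
  add_mem' := by
    rintro _ _ ⟨f, hf, rfl⟩ ⟨g, hg, rfl⟩
    exact ⟨f + g, hf.add hg, rfl⟩
  zero_mem' := ⟨0, analyticAt_const, rfl⟩
  neg_mem' := by
    rintro _ ⟨f, hf, rfl⟩
    exact ⟨-f, hf.neg, rfl⟩

/-- The module `Ω¹_{ℂⁿ,0}` of germs at the origin of holomorphic 1-forms, a 1-form being a map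
from (a neighbourhood of the origin in) `ℂⁿ` to the dual space of `ℂⁿ`. -/
def holoOneForms (n : ℕ) :
    Submodule (holoGerms n) (Filter.Germ (𝓝 (0 : Fin n → ℂ)) ((Fin n → ℂ) →L[ℂ] ℂ)) where
  carrier := {g | ∃ ω : (Fin n → ℂ) → ((Fin n → ℂ) →L[ℂ] ℂ), AnalyticAt ℂ ω 0 ∧
    (ω : Filter.Germ _ ((Fin n → ℂ) →L[ℂ] ℂ)) = g}
  add_mem' := by
    rintro _ _ ⟨f, hf, rfl⟩ ⟨g, hg, rfl⟩
    exact ⟨f + g, hf.add hg, rfl⟩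
  zero_mem' := ⟨0, analyticAt_const, rfl⟩
  smul_mem' := by
    rintro ⟨_, f, hf, rfl⟩ _ ⟨ω, hω, rfl⟩
    exact ⟨fun x => f x • ω x, hf.smul hω, rfl⟩

/-- The coefficient `m_t` of `dx_t` in a holomorphic 1-form `ω = ∑ m_t dx_t`: the value of `ω`
on the `t`-th coordinate vector field. -/
def coefficient {n : ℕ} (ω : holoOneForms n) (t : Fin n) : holoGerms n :=
  ⟨(ω : Filter.Germ (𝓝 (0 : Fin n → ℂ)) ((Fin n → ℂ) →L[ℂ] ℂ)).map
      (fun L => L (Pi.single t 1)), by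
    obtain ⟨_, f, hf, rfl⟩ := ω
    exact ⟨fun x => f x (Pi.single t 1),
      ((ContinuousLinearMap.apply ℂ ℂ (Pi.single t 1 : Fin n → ℂ)).analyticAt _).comp hf,
      rfl⟩⟩

/-- The matrix of coefficients of a collection of 1-forms `ω_i = ∑ₜ m_{it} dx_t`. -/
def coefficientMatrix {n s : ℕ} (ω : Fin s → holoOneForms n) :
    Matrix (Fin s) (Fin n) (holoGerms n) :=
  Matrix.of fun i t => coefficient (ω i) t

/-- The local ring at the origin of the degeneracy locus `Z(ℂⁿ; ω₁, …, ω_s)`, where the 1-forms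
are linearly dependent: the quotient of `𝒪_{ℂⁿ,0}` by the maximal minors of the matrix of
coefficients. -/
abbrev degeneracyLocalRing {n s : ℕ} (ω : Fin s → holoOneForms n) : Type :=
  holoGerms n ⧸ maximalMinorsIdeal (coefficientMatrix ω)

end CollectionIndex

end

/-! The isomorphism in (1) is a Hodge star. The dx_t form a basis of Ω¹ (`oneFormBasis`), so R^n
pairs perfectly with Ω¹, and contracting an element of ⋀^q R^n into dx_1 ∧ … ∧ dx_n gives a form of
degree n - q. Up to signs depending only on degrees, this carries contraction by the l-th row of M
to right multiplication by ω_l (`star_mul_ι`), and contraction by all rows, which is the minor form,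
to multiplication by ω_1 ∧ … ∧ ω_s. The signs are absorbed in `star` and `topEquiv`, and the factors
S^jW are carried along unchanged.

For (2) it then suffices that E(M) is exact in positive degrees when the ideal I of maximal minors
has grade at least k = n - s + 1, the length of the complex.

Torsion: a power of each element of I kills the positive homology, even modulo an arbitrary ideal J.
For a minor Δ the adjugate gives vectors b_u with M b_u = Δ e_u. By Euler's identity the homotopy h
= ∑ (b_l ∧ ·) ⊗ u_l satisfies dh + hd = (j + s)Δ - N on the term with S^jW (without hd if j = 0),
where N = ∑ b_t ∧ (c_t ⌟ ·) and c_t is the t-th row. After inverting Δ, N has eigenvalues among 0,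
Δ, …, sΔ; accordingly N(N - Δ)⋯(N - sΔ) = 0 over R itself (`fallingOp_succ_card_eq_zero`). On cycles
N agrees with (j + s)Δ up to boundaries, so for j > 0 a nonzero integer times Δ^{s+1} kills the
homology, and nonzero integers are units. For j = 0 the last factor would contribute 0; the product
of the first s factors is used instead, which factors through the minor form and so vanishes on
cycles (`exists_fallingOp_eq_minorForm_smul`).

Acyclicity: a complex of free modules of length at most k with such torsion homology is exact in
positive degrees, by induction along a regular sequence of length k in I
(`mem_boundariesMod_of_regularSeqMod`).

Grade: a regular sequence of length n - k on R/I, lifted to R and added to I, gives an ideal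
containing a power of the maximal ideal, hence of grade at least n; dropping a generator costs at
most one (`depthGE_of_isCohenMacaulayLocalRing`). This uses that R is Noetherian local of depth at
least n. Through `germEquiv`, R is the ring of convergent power series, which is Noetherian by
division with respect to leading exponents and in which the coordinates form a regular sequence. -/

noncomputable section

namespace CollectionIndex

universe u

/-! ### Grade of an ideal, measured by weakly regular sequences. -/

section Depth

variable {R : Type*} [CommRing R]

/-- `y` is a nonzerodivisor modulo the ideal `J`. -/
def RegularMod (J : Ideal R) (y : R) : Prop := ∀ r, y * r ∈ J → r ∈ J

/-- `ys` is a weakly regular sequence on `R ⧸ J`. -/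
def RegularSeqMod : Ideal R → List R → Prop
  | _, [] => True
  | J, y :: ys => RegularMod J y ∧ RegularSeqMod (J ⊔ Ideal.span {y}) ys

/-- The ideal `a` contains a weakly regular sequence of length `d` on `R ⧸ J`. -/
def DepthGE (a J : Ideal R) (d : ℕ) : Prop :=
  ∃ ys : List R, ys.length = d ∧ (∀ y ∈ ys, y ∈ a) ∧ RegularSeqMod J ys

theorem depthGE_zero (a J : Ideal R) : DepthGE a J 0 := ⟨[], rfl, by simp, trivial⟩

theorem depthGE_succ_iff {a J : Ideal R} {d : ℕ} :
    DepthGE a J (d + 1) ↔ ∃ y ∈ a, RegularMod J y ∧ DepthGE a (J ⊔ Ideal.span {y}) d := by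
  constructor
  · rintro ⟨_ | ⟨y, ys⟩, hl, ha, hr⟩
    · simp at hl
    · exact ⟨y, ha y (by simp), hr.1, ys, by simpa using hl, fun z hz => ha z (by simp [hz]), hr.2⟩
  · rintro ⟨y, hy, hr, ys, hl, ha, h⟩
    exact ⟨y :: ys, by simp [hl], by simpa [hy] using ha, hr, h⟩

theorem mem_sup_span_singleton {J : Ideal R} {y x : R} :
    x ∈ J ⊔ Ideal.span {y} ↔ ∃ v, x - y * v ∈ J := by
  rw [Submodule.mem_sup]
  constructor
  · rintro ⟨j, hj, z, hz, rfl⟩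
    obtain ⟨v, rfl⟩ := Ideal.mem_span_singleton'.1 hz
    exact ⟨v, by simpa [mul_comm] using hj⟩
  · rintro ⟨v, hv⟩
    exact ⟨_, hv, y * v, Ideal.mul_mem_right _ _ (Ideal.mem_span_singleton_self y), by ring⟩

theorem RegularMod.pow {J : Ideal R} {y : R} (h : RegularMod J y) (N : ℕ) :
    RegularMod J (y ^ N) := by
  induction N with
  | zero => intro r hr; simpa using hr
  | succ N ih => intro r hr; exact h _ (ih _ (by rwa [pow_succ, mul_assoc] at hr))

/-- Nakayama's lemma: the hypothesis says K ⊆ J + zK. It is applied below to colon ideals K. -/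
theorem le_of_forall_exists_sub_mul_mem [IsLocalRing R] [IsNoetherianRing R] {K J : Ideal R}
    {z : R} (hz : z ∈ IsLocalRing.maximalIdeal R) (h : ∀ u ∈ K, ∃ v ∈ K, u - z * v ∈ J) :
    K ≤ J := by
  refine Submodule.le_of_le_smul_of_le_jacobson_bot (I := Ideal.span {z})
    (IsNoetherian.noetherian K) ?_ ?_
  · rw [IsLocalRing.jacobson_eq_maximalIdeal ⊥ bot_ne_top, Ideal.span_le]
    simpa using hz
  · intro u hu
    obtain ⟨v, hv, huv⟩ := h u hu
    rw [show u = (u - z * v) + z * v by ring]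
    exact Submodule.add_mem_sup huv
      (Submodule.smul_mem_smul (Ideal.mem_span_singleton_self z) hv)

/-- Prime avoidance: an ideal with no common annihilated element in `R ⧸ J₁` and in `R ⧸ J₂`
contains a common nonzerodivisor. -/
theorem exists_regularMod_of_forall [IsNoetherianRing R] {a J₁ J₂ : Ideal R}
    (h₁ : ∀ u, (∀ x ∈ a, x * u ∈ J₁) → u ∈ J₁) (h₂ : ∀ u, (∀ x ∈ a, x * u ∈ J₂) → u ∈ J₂) :
    ∃ w ∈ a, RegularMod J₁ w ∧ RegularMod J₂ w := by
  by_contra! hcon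
  -- Passing to the product of the two quotients lets a single prime avoidance serve both: an
  -- element that is not regular on one factor kills a vector supported there.
  have hsub : (a : Set R) ⊆ ⋃ p ∈ associatedPrimes R ((R ⧸ J₁) × (R ⧸ J₂)), (p : Set R) := by
    rw [biUnion_associatedPrimes_eq_zero_divisors]
    intro w hw
    by_cases hr : RegularMod J₁ w
    · have := hcon w hw hr
      simp only [RegularMod, not_forall] at this
      obtain ⟨r, hr1, hr2⟩ := this
      refine ⟨(0, Ideal.Quotient.mk J₂ r), ?_, ?_⟩
      · simpa [Prod.ext_iff, Ideal.Quotient.eq_zero_iff_mem] using hr2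
      · simpa [Prod.ext_iff, Algebra.smul_def, ← map_mul, Ideal.Quotient.eq_zero_iff_mem] using hr1
    · simp only [RegularMod, not_forall] at hr
      obtain ⟨r, hr1, hr2⟩ := hr
      refine ⟨(Ideal.Quotient.mk J₁ r, 0), ?_, ?_⟩
      · simpa [Prod.ext_iff, Ideal.Quotient.eq_zero_iff_mem] using hr2
      · simpa [Prod.ext_iff, Algebra.smul_def, ← map_mul, Ideal.Quotient.eq_zero_iff_mem] using hr1
  have hfin := associatedPrimes.finite R ((R ⧸ J₁) × (R ⧸ J₂))
  have := (Ideal.subset_union_prime (s := hfin.toFinset) (f := id) (I := a) ⊤ ⊤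
    (fun p hp _ _ => IsAssociatedPrime.isPrime (hfin.mem_toFinset.1 hp))).1 (by simpa using hsub)
  obtain ⟨p, hp, hap⟩ := this
  obtain ⟨hpp, ⟨⟨m₁, m₂⟩, hm⟩⟩ := isAssociatedPrime_iff.1 (hfin.mem_toFinset.1 hp)
  obtain ⟨u₁, rfl⟩ := Ideal.Quotient.mk_surjective m₁
  obtain ⟨u₂, rfl⟩ := Ideal.Quotient.mk_surjective m₂
  have key : ∀ x ∈ a, x * u₁ ∈ J₁ ∧ x * u₂ ∈ J₂ := by
    intro x hx
    have hx' : x ∈ p := hap hx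
    rw [hm, Submodule.mem_colon_singleton] at hx'
    simpa [Prod.ext_iff, Algebra.smul_def, ← map_mul, Ideal.Quotient.eq_zero_iff_mem] using hx'
  have e₁ := Ideal.Quotient.eq_zero_iff_mem.2 (h₁ u₁ fun x hx => (key x hx).1)
  have e₂ := Ideal.Quotient.eq_zero_iff_mem.2 (h₂ u₂ fun x hx => (key x hx).2)
  apply hpp.ne_top
  rw [hm, e₁, e₂, Ideal.eq_top_iff_one, Submodule.mem_colon_singleton]
  simp

theorem DepthGE.socle {a J : Ideal R} {d : ℕ} (h : DepthGE a J (d + 1)) (u : R)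
    (hu : ∀ x ∈ a, x * u ∈ J) : u ∈ J := by
  obtain ⟨y, hy, hr, -⟩ := depthGE_succ_iff.1 h
  exact hr u (hu y hy)

/-- The socles of `R ⧸ (J + y)` and `R ⧸ (J + z)` vanish simultaneously. -/
theorem socle_exchange {a J : Ideal R} {y z : R} (hz : z ∈ a)
    (ry : RegularMod J y) (rz : RegularMod J z)
    (h : ∀ u, (∀ x ∈ a, x * u ∈ J ⊔ Ideal.span {z}) → u ∈ J ⊔ Ideal.span {z}) (u : R)
    (hu : ∀ x ∈ a, x * u ∈ J ⊔ Ideal.span {y}) : u ∈ J ⊔ Ideal.span {y} := by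
  -- The relation zu ≡ yv mod J trades u for v. For y, z ∈ a this is the comparison of both socles
  -- with Ext¹(R/a, R/J), in terms of elements.
  obtain ⟨v, hv⟩ := mem_sup_span_singleton.1 (hu z hz)
  have hvz : v ∈ J ⊔ Ideal.span {z} := by
    refine h v fun x hx => ?_
    obtain ⟨w, hw⟩ := mem_sup_span_singleton.1 (hu x hx)
    refine mem_sup_span_singleton.2 ⟨w, ry _ ?_⟩
    have := J.sub_mem (J.mul_mem_left z hw) (J.mul_mem_left x hv)
    ring_nf at this ⊢
    exact this
  obtain ⟨v', hv'⟩ := mem_sup_span_singleton.1 hvz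
  refine mem_sup_span_singleton.2 ⟨v', rz _ ?_⟩
  have := J.add_mem hv (J.mul_mem_left y hv')
  ring_nf at this ⊢
  exact this

section Local

variable [IsLocalRing R] [IsNoetherianRing R]

/-- Permutability of regular sequences in a Noetherian local ring: if wu ∈ J, then u ≡ zv mod J with
wv ∈ J again, so the colon ideal (J : w) satisfies Nakayama's condition. -/
theorem RegularMod.swap {J : Ideal R} {z w : R} (hzm : z ∈ IsLocalRing.maximalIdeal R)
    (hz : RegularMod J z) (hw : RegularMod (J ⊔ Ideal.span {z}) w) :
    RegularMod J w ∧ RegularMod (J ⊔ Ideal.span {w}) z := by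
  have hwJ : RegularMod J w := by
    let K : Ideal R := Submodule.comap (LinearMap.mulLeft R w) J
    have hK : K ≤ J := by
      refine le_of_forall_exists_sub_mul_mem hzm fun u hu => ?_
      have hu' : w * u ∈ J := hu
      obtain ⟨v, hv⟩ := mem_sup_span_singleton.1 (hw u (Ideal.mem_sup_left hu'))
      refine ⟨v, ?_, hv⟩
      change w * v ∈ J
      refine hz _ ?_
      have := J.sub_mem hu' (J.mul_mem_left w hv)
      ring_nf at this ⊢
      exact this
    exact fun r hr => hK hr
  refine ⟨hwJ, fun r hr => ?_⟩
  obtain ⟨v, hv⟩ := mem_sup_span_singleton.1 hr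
  have hvz : v ∈ J ⊔ Ideal.span {z} := by
    refine hw _ (mem_sup_span_singleton.2 ⟨r, ?_⟩)
    simpa using J.neg_mem hv
  obtain ⟨v', hv'⟩ := mem_sup_span_singleton.1 hvz
  refine mem_sup_span_singleton.2 ⟨v', hz _ ?_⟩
  have := J.add_mem hv (J.mul_mem_left w hv')
  ring_nf at this ⊢
  exact this

/-- Every nonzerodivisor in `a` can be taken as the first term of a regular sequence in `a`. -/
theorem DepthGE.exchange {a : Ideal R} (ha : a ≤ IsLocalRing.maximalIdeal R) (d : ℕ) :
    ∀ {J : Ideal R} {y : R}, DepthGE a J (d + 1) → y ∈ a → RegularMod J y →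
      DepthGE a (J ⊔ Ideal.span {y}) d := by
  induction d with
  | zero => intro J y _ _ _; exact depthGE_zero _ _
  | succ d ih =>
    intro J y h hy ry
    obtain ⟨z, hz, rz, hd⟩ := depthGE_succ_iff.1 h
    -- The terms y and z need not form a regular sequence together. An element w regular modulo each
    -- of them links the two: pass from (z, w) to (w, z), then to (w, y), then to (y, w).
    obtain ⟨w, hw, hwz, hwy⟩ := exists_regularMod_of_forall hd.socle
      (socle_exchange hz ry rz hd.socle)
    have h1 := ih hd hw hwz
    obtain ⟨rw', rzw⟩ := rz.swap (ha hz) hwz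
    obtain ⟨-, ryw⟩ := ry.swap (ha hy) hwy
    rw [sup_right_comm] at h1
    have h2 : DepthGE a (J ⊔ Ideal.span {w}) (d + 1) := depthGE_succ_iff.2 ⟨z, hz, rzw, h1⟩
    have h3 := ih h2 hy ryw
    rw [sup_right_comm] at h3
    exact depthGE_succ_iff.2 ⟨w, hw, hwy, h3⟩

/-- Terms of a regular sequence may be replaced by powers, so grade does not change when an ideal is
replaced by one containing a power of it. -/
theorem DepthGE.of_pow_le {a b : Ideal R} (ha : a ≤ IsLocalRing.maximalIdeal R) {N : ℕ}
    (hab : a ^ N ≤ b) (d : ℕ) : ∀ {J : Ideal R}, DepthGE a J d → DepthGE b J d := by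
  induction d with
  | zero => intro J _; exact depthGE_zero _ _
  | succ d ih =>
    intro J h
    obtain ⟨z, hz, rz, -⟩ := depthGE_succ_iff.1 h
    -- The exponent N + 1 instead of N keeps the power inside `a` even for N = 0.
    have hm : z ^ (N + 1) ∈ a := by rw [pow_succ]; exact a.mul_mem_left _ hz
    refine depthGE_succ_iff.2 ⟨z ^ (N + 1), ?_, rz.pow _, ih (h.exchange ha d hm (rz.pow _))⟩
    rw [pow_succ]
    exact b.mul_mem_right _ (hab (Ideal.pow_mem_pow hz N))

/-- Dropping one generator costs at most one unit of grade. The point is that I contains an element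
regular modulo J as soon as I + (x) has grade at least two; by prime avoidance this amounts to (J :
I) ⊆ J, which Nakayama's lemma with z = x yields. -/
theorem DepthGE.of_sup_span_singleton {I : Ideal R} {x : R}
    (hI : I ≤ IsLocalRing.maximalIdeal R) (hx : x ∈ IsLocalRing.maximalIdeal R) (d : ℕ) :
    ∀ {J : Ideal R}, DepthGE (I ⊔ Ideal.span {x}) J (d + 1) → DepthGE I J d := by
  have hIx : I ⊔ Ideal.span {x} ≤ IsLocalRing.maximalIdeal R :=
    sup_le hI ((Ideal.span_singleton_le_iff_mem _).2 hx)
  induction d with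
  | zero => intro J _; exact depthGE_zero _ _
  | succ d ih =>
    intro J h
    let K : Ideal R := J.colon (I : Set R)
    have memK : ∀ u, u ∈ K ↔ ∀ i ∈ I, i * u ∈ J := fun u => by
      simp [K, Submodule.mem_colon, mul_comm]
    have hK : K ≤ J := by
      refine le_of_forall_exists_sub_mul_mem hx fun u hu => ?_
      obtain ⟨b, hb, rb, hd⟩ := depthGE_succ_iff.1 h
      obtain ⟨i, hi, rx, hrx, rfl⟩ := Submodule.mem_sup.1 hb
      obtain ⟨r, rfl⟩ := Ideal.mem_span_singleton'.1 hrx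
      have h0 := (memK u).1 hu
      -- Put b = i + rx. Since I kills u modulo J, every c = i' + sx satisfies c·ru ≡ b·su mod J. So
      -- ru is in the socle modulo b, which vanishes because a further regular element remains.
      have hru : r * u ∈ J ⊔ Ideal.span {i + r * x} := by
        refine hd.socle _ fun c hc => ?_
        obtain ⟨i', hi', sx, hsx, rfl⟩ := Submodule.mem_sup.1 hc
        obtain ⟨s, rfl⟩ := Ideal.mem_span_singleton'.1 hsx
        refine mem_sup_span_singleton.2 ⟨s * u, ?_⟩
        have := J.sub_mem (J.mul_mem_left r (h0 i' hi')) (J.mul_mem_left s (h0 i hi))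
        ring_nf at this ⊢
        exact this
      obtain ⟨v, hv⟩ := mem_sup_span_singleton.1 hru
      have hvK : v ∈ K := (memK v).2 fun i' hi' => rb _ <| by
        have := J.sub_mem (J.mul_mem_left r (h0 i' hi')) (J.mul_mem_left i' hv)
        ring_nf at this ⊢
        exact this
      refine ⟨v, hvK, rb _ ?_⟩
      have h2 := (memK v).1 hvK i hi
      have := J.add_mem (J.add_mem (h0 i hi) (J.mul_mem_left x hv)) (J.mul_mem_left 0 h2)
      ring_nf at this ⊢
      exact this
    obtain ⟨y, hy, ry, -⟩ := exists_regularMod_of_forall (a := I) (J₁ := J) (J₂ := J)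
      (fun u hu => hK ((memK u).2 hu)) (fun u hu => hK ((memK u).2 hu))
    exact depthGE_succ_iff.2 ⟨y, hy, ry, ih (h.exchange hIx _ (Ideal.mem_sup_left hy) ry)⟩

theorem DepthGE.of_sup_ofList {I : Ideal R} (hI : I ≤ IsLocalRing.maximalIdeal R)
    (d : ℕ) : ∀ {xs : List R}, (∀ x ∈ xs, x ∈ IsLocalRing.maximalIdeal R) → ∀ {J : Ideal R},
      DepthGE (I ⊔ Ideal.ofList xs) J (d + xs.length) → DepthGE I J d := by
  intro xs
  induction xs generalizing d with
  | nil => intro _ J h; simpa using h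
  | cons x xs ih =>
    intro hxs J h
    have hxs' : ∀ x ∈ xs, x ∈ IsLocalRing.maximalIdeal R := fun y hy => hxs y (by simp [hy])
    refine ih d hxs' (DepthGE.of_sup_span_singleton (x := x) ?_ (hxs x (by simp)) _ ?_)
    · exact sup_le hI (Ideal.span_le.2 hxs')
    · rw [Ideal.ofList_cons, sup_comm (Ideal.span {x}), ← sup_assoc, List.length_cons,
        ← add_assoc] at h
      exact h

end Local

end Depth

/-! ### Grade of an ideal with Cohen–Macaulay quotient. -/

section CohenMacaulay

variable {R : Type*} [CommRing R] [IsLocalRing R] [IsNoetherianRing R]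

theorem exists_pow_maximalIdeal_le_of_krullDimLE_zero {S : Type*} [CommRing S] [IsLocalRing S]
    [Ring.KrullDimLE 0 S] (f : R →+* S) [IsLocalHom f] {b : Ideal R} (hb : RingHom.ker f ≤ b) :
    ∃ N : ℕ, IsLocalRing.maximalIdeal R ^ N ≤ b := by
  refine Ideal.exists_pow_le_of_le_radical_of_fg (fun x hx => ?_) (IsNoetherian.noetherian _)
  have h1 : f x ∈ IsLocalRing.maximalIdeal S := by
    rw [IsLocalRing.mem_maximalIdeal, mem_nonunits_iff] at hx ⊢
    exact fun h => hx (isUnit_of_map_unit f x h)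
  obtain ⟨N, hN⟩ := Ring.KrullDimLE.isNilpotent_iff_mem_maximalIdeal.2 h1
  exact ⟨N, hb (by rw [RingHom.mem_ker, map_pow, hN])⟩

/-- In a local ring of depth at least `n`, an ideal with Cohen–Macaulay quotient of dimension
`d ≤ n` has grade at least `n - d`. -/
theorem depthGE_of_isCohenMacaulayLocalRing {n d k : ℕ} (hn : n = k + d)
    (h : DepthGE (IsLocalRing.maximalIdeal R) ⊥ n) {I : Ideal R}
    (hCM : IsCohenMacaulayLocalRing (R ⧸ I)) (hdim : ringKrullDim (R ⧸ I) = ((d : ℕ) : WithBot ℕ∞)) :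
    DepthGE I ⊥ k := by
  obtain ⟨hloc, hnoeth, rs, hreg, hlen⟩ := hCM
  obtain ⟨xs, rfl⟩ : ∃ xs : List R, xs.map (Ideal.Quotient.mk I) = rs :=
    List.map_surjective_iff.2 Ideal.Quotient.mk_surjective rs
  have hne : Ideal.ofList (xs.map (Ideal.Quotient.mk I)) ≠ ⊤ := fun h => by
    have h1 := hreg.top_ne_smul
    rw [h] at h1
    exact h1 (by simp)
  have hd : xs.length = d := by
    rw [hdim, List.length_map] at hlen
    exact_mod_cast hlen
  set b := Ideal.ofList (xs.map (Ideal.Quotient.mk I)) with hb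
  have : Nontrivial ((R ⧸ I) ⧸ b) := Ideal.Quotient.nontrivial_iff.2 hne
  have hzero : ringKrullDim ((R ⧸ I) ⧸ b) = 0 := by
    have h1 := ringKrullDim_add_length_eq_ringKrullDim_of_isRegular _ hreg
    rw [hdim, List.length_map, hd, ← hb] at h1
    generalize ringKrullDim ((R ⧸ I) ⧸ b) = e at h1
    induction e using WithBot.recBotCoe with
    | bot => simp at h1
    | coe e =>
      have h2 : e + (d : ℕ∞) = d := by exact_mod_cast h1
      have h3 : e = 0 := by
        rw [← zero_add (d : ℕ∞)] at h2
        simpa using h2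
      rw [h3]; rfl
  have : Ring.KrullDimLE 0 ((R ⧸ I) ⧸ b) := ringKrullDimZero_iff_ringKrullDim_eq_zero.2 hzero
  have : IsLocalRing ((R ⧸ I) ⧸ b) :=
    IsLocalRing.of_surjective' (Ideal.Quotient.mk b) Ideal.Quotient.mk_surjective
  let f : R →+* (R ⧸ I) ⧸ b := (Ideal.Quotient.mk b).comp (Ideal.Quotient.mk I)
  have hf : Function.Surjective f :=
    Ideal.Quotient.mk_surjective.comp Ideal.Quotient.mk_surjective
  have := IsLocalHom.of_surjective f hf
  have hker : RingHom.ker f ≤ I ⊔ Ideal.ofList xs := by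
    intro x hx
    have h1 : Ideal.Quotient.mk I x ∈ b := Ideal.Quotient.eq_zero_iff_mem.1 hx
    rw [hb, ← Ideal.map_ofList, Ideal.mem_quotient_iff_mem_sup, sup_comm] at h1
    exact h1
  obtain ⟨N, hN⟩ := exists_pow_maximalIdeal_le_of_krullDimLE_zero f hker
  have hI : I ≤ IsLocalRing.maximalIdeal R :=
    IsLocalRing.le_maximalIdeal (Ideal.Quotient.nontrivial_iff.1 inferInstance)
  have hxs : ∀ x ∈ xs, x ∈ IsLocalRing.maximalIdeal R := fun x hx hu =>
    hne (Ideal.eq_top_of_isUnit_mem _ (Ideal.subset_span (List.mem_map_of_mem hx))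
      (hu.map (Ideal.Quotient.mk I)))
  -- I + (xs) contains a power of the maximal ideal, so its grade is at least n; removing the d
  -- lifted elements leaves k.
  refine DepthGE.of_sup_ofList hI k hxs ?_
  rw [hd, ← hn]
  exact h.of_pow_le le_rfl hN

end CohenMacaulay

section

open scoped ENNReal

/-! ### Weighted ℓ¹ norms adapted to a monomial order. -/

section WeightedNorm

variable {n : ℕ}

/-- A strict multiplicative encoding of exponents by natural numbers: `α ↦ ∏ p_i ^ α_i`, with
`p_i` the `i`-th prime number. -/
def primeWeight (α : Fin n →₀ ℕ) : ℕ := α.prod fun i k => Nat.nth Nat.Prime i ^ k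

theorem primeWeight_add (α β : Fin n →₀ ℕ) :
    primeWeight (α + β) = primeWeight α * primeWeight β :=
  Finsupp.prod_add_index' (fun _ => pow_zero _) fun _ _ _ => pow_add _ _ _

theorem primeWeight_pos (α : Fin n →₀ ℕ) : 0 < primeWeight α :=
  Finset.prod_pos fun _ _ => pow_pos (Nat.prime_nth_prime _).pos _

/-- Unique factorization. Distinct exponents thus have integer weights differing by at least 1,
which gives a total monomial order with a usable gap. -/
theorem primeWeight_injective : Function.Injective (primeWeight : (Fin n →₀ ℕ) → ℕ) := by
  intro α β h
  have key : ∀ (γ : Fin n →₀ ℕ) (i : Fin n),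
      (primeWeight γ).factorization (Nat.nth Nat.Prime i) = γ i := by
    intro γ i
    rw [primeWeight, Finsupp.prod, Nat.factorization_prod]
    · simp only [Finsupp.coe_finsetSum, Finset.sum_apply, Nat.Prime.factorization_pow,
        Nat.prime_nth_prime]
      rw [Finset.sum_eq_single i]
      · simp
      · intro j _ hj
        rw [Finsupp.single_apply, if_neg]
        exact fun e => hj (Fin.ext (Nat.nth_injective Nat.infinite_setOfPred_prime e))
      · intro hi
        simpa using hi
    · intro j _
      exact pow_ne_zero _ (Nat.prime_nth_prime _).ne_zero
  ext i
  rw [← key α i, ← key β i, h]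

/-- The reciprocal of `primeWeight`. -/
def weight (α : Fin n →₀ ℕ) : ℝ≥0∞ := (primeWeight α : ℝ≥0∞)⁻¹

theorem weight_add (α β : Fin n →₀ ℕ) : weight (α + β) = weight α * weight β := by
  rw [weight, primeWeight_add, Nat.cast_mul, ENNReal.mul_inv (by simp) (by simp)]
  rfl

theorem weight_le_one (α : Fin n →₀ ℕ) : weight α ≤ 1 := by
  rw [weight, ENNReal.inv_le_one]
  exact_mod_cast primeWeight_pos α

theorem weight_ne_zero (α : Fin n →₀ ℕ) : weight α ≠ 0 := by simp [weight]

/-- The weighted `ℓ¹` norm `∑ |f_α| (∏ p_i ^ α_i)⁻ᵗ` of a power series. -/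
def wnorm (t : ℕ) (f : MvPowerSeries (Fin n) ℂ) : ℝ≥0∞ :=
  ∑' α, ‖MvPowerSeries.coeff α f‖ₑ * weight α ^ t

theorem wnorm_mono {t t' : ℕ} (h : t ≤ t') (f : MvPowerSeries (Fin n) ℂ) :
    wnorm t' f ≤ wnorm t f := by
  refine ENNReal.tsum_le_tsum fun α => ?_
  exact mul_le_mul_right (pow_le_pow_right_of_le_one' (weight_le_one α) h) _

theorem wnorm_add_le (t : ℕ) (f g : MvPowerSeries (Fin n) ℂ) :
    wnorm t (f + g) ≤ wnorm t f + wnorm t g := by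
  rw [wnorm, wnorm, wnorm, ← ENNReal.tsum_add]
  refine ENNReal.tsum_le_tsum fun α => ?_
  rw [← add_mul, map_add]
  gcongr
  exact enorm_add_le _ _

theorem wnorm_zero (t : ℕ) : wnorm t (0 : MvPowerSeries (Fin n) ℂ) = 0 := by simp [wnorm]

theorem wnorm_neg (t : ℕ) (f : MvPowerSeries (Fin n) ℂ) : wnorm t (-f) = wnorm t f := by
  simp [wnorm]

theorem wnorm_sum_le {ι : Type*} (t : ℕ) (s : Finset ι) (f : ι → MvPowerSeries (Fin n) ℂ) :
    wnorm t (∑ i ∈ s, f i) ≤ ∑ i ∈ s, wnorm t (f i) :=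
  Finset.le_sum_of_subadditive _ (wnorm_zero t).le (wnorm_add_le t) s f

theorem wnorm_monomial (t : ℕ) (σ : Fin n →₀ ℕ) (c : ℂ) :
    wnorm t (MvPowerSeries.monomial σ c) = ‖c‖ₑ * weight σ ^ t := by
  classical
  rw [wnorm, tsum_eq_single σ]
  · simp
  · intro α h
    simp [MvPowerSeries.coeff_monomial, h]

theorem wnorm_mul_le (t : ℕ) (f g : MvPowerSeries (Fin n) ℂ) :
    wnorm t (f * g) ≤ wnorm t f * wnorm t g := by
  classical
  have h : wnorm t f * wnorm t g = ∑' α, ∑ p ∈ Finset.HasAntidiagonal.antidiagonal α,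
      (‖MvPowerSeries.coeff p.1 f‖ₑ * weight p.1 ^ t) *
        (‖MvPowerSeries.coeff p.2 g‖ₑ * weight p.2 ^ t) := by
    rw [wnorm, wnorm, ← ENNReal.tsum_mul_right]
    simp_rw [← ENNReal.tsum_mul_left]
    rw [← ENNReal.tsum_prod, ← Finset.HasAntidiagonal.sigmaAntidiagonalEquivProd.tsum_eq, ENNReal.tsum_sigma']
    refine tsum_congr fun α => ?_
    rw [← Finset.tsum_subtype]
    rfl
  rw [h]
  refine ENNReal.tsum_le_tsum fun α => ?_
  rw [MvPowerSeries.coeff_mul]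
  calc _ ≤ (∑ p ∈ Finset.HasAntidiagonal.antidiagonal α,
        ‖MvPowerSeries.coeff p.1 f * MvPowerSeries.coeff p.2 g‖ₑ) * weight α ^ t := by
        gcongr
        exact enorm_sum_le _ _
    _ = _ := by
        rw [Finset.sum_mul]
        refine Finset.sum_congr rfl fun p hp => ?_
        rw [← Finset.HasAntidiagonal.mem_antidiagonal.1 hp, weight_add, mul_pow, enorm_mul]
        ring

/-- A power series with leading term `x^σ` is close to `x^σ` in the norms with large `t`. -/
theorem eventually_wnorm_sub_monomial_le {f : MvPowerSeries (Fin n) ℂ} {σ : Fin n →₀ ℕ} {t₀ : ℕ}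
    (hf : wnorm t₀ f ≠ ∞) (h1 : MvPowerSeries.coeff σ f = 1)
    (h : ∀ α, MvPowerSeries.coeff α f ≠ 0 → primeWeight σ ≤ primeWeight α) :
    ∀ᶠ t in Filter.atTop, wnorm t (f - MvPowerSeries.monomial σ 1) ≤ 2⁻¹ * weight σ ^ t := by
  classical
  -- Let P be the prime weight of σ. All other exponents of f have prime weight at least P + 1, so
  -- each unit added to t shrinks their terms relative to x^σ by at least ρ = P / (P + 1).
  set ρ : ℝ≥0∞ := (primeWeight σ : ℝ≥0∞) * (primeWeight σ + 1 : ℝ≥0∞)⁻¹ with hρ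
  have hσ0 : (primeWeight σ : ℝ≥0∞) ≠ 0 := by exact_mod_cast (primeWeight_pos σ).ne'
  have hρ1 : ρ < 1 := by
    rw [hρ, ← div_eq_mul_inv, ENNReal.div_lt_iff (by simp) (by simp)]
    rw [one_mul]
    exact_mod_cast Nat.lt_succ_self _
  have bound : ∀ u, wnorm (t₀ + u) (f - MvPowerSeries.monomial σ 1) ≤
      (ρ ^ u * (wnorm t₀ f * (primeWeight σ : ℝ≥0∞) ^ t₀)) * weight σ ^ (t₀ + u) := by
    intro u
    have e : (ρ ^ u * (wnorm t₀ f * (primeWeight σ : ℝ≥0∞) ^ t₀)) * weight σ ^ (t₀ + u) =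
        wnorm t₀ f * ((primeWeight σ + 1 : ℝ≥0∞)⁻¹) ^ u := by
      have hc : (primeWeight σ : ℝ≥0∞) * weight σ = 1 := ENNReal.mul_inv_cancel hσ0 (by simp)
      rw [hρ, mul_pow, pow_add]
      calc _ = wnorm t₀ f * ((primeWeight σ + 1 : ℝ≥0∞)⁻¹) ^ u *
            (((primeWeight σ : ℝ≥0∞) * weight σ) ^ u *
              ((primeWeight σ : ℝ≥0∞) * weight σ) ^ t₀) := by ring
        _ = _ := by rw [hc]; simp
    rw [e, wnorm, wnorm, ← ENNReal.tsum_mul_right]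
    refine ENNReal.tsum_le_tsum fun α => ?_
    rw [map_sub, MvPowerSeries.coeff_monomial]
    split_ifs with hα
    · rw [hα, h1]; simp
    · rw [sub_zero]
      by_cases h0 : MvPowerSeries.coeff α f = 0
      · simp [h0]
      · rw [pow_add, ← mul_assoc]
        gcongr
        rw [weight]
        gcongr
        have := lt_of_le_of_ne (h α h0) fun e => hα (primeWeight_injective e.symm)
        exact_mod_cast this
  have lim : Filter.Tendsto (fun u : ℕ => ρ ^ u * (wnorm t₀ f * (primeWeight σ : ℝ≥0∞) ^ t₀))
      Filter.atTop (nhds 0) := by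
    have := ENNReal.Tendsto.mul_const (ENNReal.tendsto_pow_atTop_nhds_zero_of_lt_one hρ1)
      (b := wnorm t₀ f * (primeWeight σ : ℝ≥0∞) ^ t₀)
      (Or.inr (ENNReal.mul_ne_top hf (by simp)))
    simpa using this
  have ev : ∀ᶠ u in Filter.atTop, wnorm (t₀ + u) (f - MvPowerSeries.monomial σ 1) ≤
      2⁻¹ * weight σ ^ (t₀ + u) := by
    filter_upwards [lim.eventually_le_const (show (0 : ℝ≥0∞) < 2⁻¹ by simp)] with u hu
    exact (bound u).trans (by gcongr)
  obtain ⟨U, hU⟩ := Filter.eventually_atTop.1 ev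
  refine Filter.eventually_atTop.2 ⟨t₀ + U, fun t ht => ?_⟩
  obtain ⟨v, rfl⟩ := Nat.exists_eq_add_of_le ht
  rw [add_assoc]
  exact hU _ (by omega)

end WeightedNorm

end

section

open scoped ENNReal

/-! ### Division of convergent series by series with prescribed leading monomials. -/

section Division

variable {n : ℕ}

/-- A chosen element of `S` that divides the exponent `α`, if there is one. -/
def chosenDivisor (S : Finset (Fin n →₀ ℕ)) (α : Fin n →₀ ℕ) : Fin n →₀ ℕ :=
  open Classical in if h : ∃ σ ∈ S, σ ≤ α then h.choose else 0

theorem chosenDivisor_mem {S : Finset (Fin n →₀ ℕ)} {α : Fin n →₀ ℕ} (h : ∃ σ ∈ S, σ ≤ α) :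
    chosenDivisor S α ∈ S := by
  rw [chosenDivisor, dif_pos h]; exact h.choose_spec.1

theorem chosenDivisor_le {S : Finset (Fin n →₀ ℕ)} {α : Fin n →₀ ℕ} (h : ∃ σ ∈ S, σ ≤ α) :
    chosenDivisor S α ≤ α := by
  rw [chosenDivisor, dif_pos h]; exact h.choose_spec.2

/-- The quotient by `x^σ` of those terms of a power series whose chosen divisor is `σ`. -/
def monomialQuotient (S : Finset (Fin n →₀ ℕ)) (σ : Fin n →₀ ℕ) :
    MvPowerSeries (Fin n) ℂ →ₗ[ℂ] MvPowerSeries (Fin n) ℂ where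
  toFun g := fun γ => open Classical in
    (if chosenDivisor S (γ + σ) = σ then 1 else 0) * MvPowerSeries.coeff (γ + σ) g
  map_add' _ _ := funext fun _ => mul_add _ _ _
  map_smul' _ _ := funext fun _ => mul_left_comm _ _ _

/-- The sum of the terms of a power series whose exponent is divisible by no element of `S`. -/
def monomialRemainder (S : Finset (Fin n →₀ ℕ)) (g : MvPowerSeries (Fin n) ℂ) :
    MvPowerSeries (Fin n) ℂ := fun α => open Classical in
  if ∃ σ ∈ S, σ ≤ α then 0 else MvPowerSeries.coeff α g

open Classical in
theorem coeff_monomialQuotient (S : Finset (Fin n →₀ ℕ)) (σ : Fin n →₀ ℕ)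
    (g : MvPowerSeries (Fin n) ℂ) (γ : Fin n →₀ ℕ) :
    MvPowerSeries.coeff γ (monomialQuotient S σ g) =
      if chosenDivisor S (γ + σ) = σ then MvPowerSeries.coeff (γ + σ) g else 0 := by
  refine Eq.trans (b := (if chosenDivisor S (γ + σ) = σ then 1 else 0) *
    MvPowerSeries.coeff (γ + σ) g) rfl ?_
  split_ifs <;> simp

open Classical in
theorem coeff_monomialRemainder (S : Finset (Fin n →₀ ℕ)) (g : MvPowerSeries (Fin n) ℂ)
    (α : Fin n →₀ ℕ) : MvPowerSeries.coeff α (monomialRemainder S g) =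
      if ∃ σ ∈ S, σ ≤ α then 0 else MvPowerSeries.coeff α g := rfl

/-- Each exponent divisible by some element of S is assigned to exactly one σ, so no term is counted
twice. -/
theorem sum_monomialQuotient_add_remainder (S : Finset (Fin n →₀ ℕ))
    (g : MvPowerSeries (Fin n) ℂ) :
    ∑ σ ∈ S, monomialQuotient S σ g * MvPowerSeries.monomial σ 1 + monomialRemainder S g = g := by
  classical
  ext α
  rw [map_add, map_sum, coeff_monomialRemainder]
  simp only [MvPowerSeries.coeff_mul_monomial, coeff_monomialQuotient, mul_one]
  split_ifs with h
  · rw [Finset.sum_eq_single (chosenDivisor S α), add_zero, if_pos (chosenDivisor_le h),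
      tsub_add_cancel_of_le (chosenDivisor_le h), if_pos rfl]
    · intro σ _ hne
      by_cases hle : σ ≤ α
      · rw [if_pos hle, tsub_add_cancel_of_le hle, if_neg (Ne.symm hne)]
      · rw [if_neg hle]
    · intro hn; exact absurd (chosenDivisor_mem h) hn
  · rw [Finset.sum_eq_zero, zero_add]
    intro σ hσ
    rw [if_neg fun hle => h ⟨σ, hσ, hle⟩]

/-- Terms assigned to different σ have disjoint supports, and the factor `weight σ ^ t` restores
their weights. That the bound has constant 1 is what makes the error operator of the division
contract. -/
theorem sum_wnorm_monomialQuotient_le (t : ℕ) (S : Finset (Fin n →₀ ℕ))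
    (g : MvPowerSeries (Fin n) ℂ) :
    ∑ σ ∈ S, wnorm t (monomialQuotient S σ g) * weight σ ^ t ≤ wnorm t g := by
  classical
  have h1 : ∀ σ, wnorm t (monomialQuotient S σ g) * weight σ ^ t ≤
      ∑' α, if chosenDivisor S α = σ then ‖MvPowerSeries.coeff α g‖ₑ * weight α ^ t else 0 := by
    intro σ
    refine le_trans (le_of_eq ?_) (ENNReal.tsum_comp_le_tsum_of_injective
      (add_left_injective σ) fun α => if chosenDivisor S α = σ then
        ‖MvPowerSeries.coeff α g‖ₑ * weight α ^ t else 0)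
    rw [wnorm, ← ENNReal.tsum_mul_right]
    refine tsum_congr fun γ => ?_
    rw [coeff_monomialQuotient]
    split_ifs
    · rw [weight_add, mul_pow, mul_assoc]
    · simp
  calc _ ≤ ∑ σ ∈ S, ∑' α, (if chosenDivisor S α = σ then
        ‖MvPowerSeries.coeff α g‖ₑ * weight α ^ t else 0) := Finset.sum_le_sum fun σ _ => h1 σ
    _ = ∑' α, ∑ σ ∈ S, (if chosenDivisor S α = σ then
        ‖MvPowerSeries.coeff α g‖ₑ * weight α ^ t else 0) :=
        (Summable.tsum_finsetSum fun _ _ => ENNReal.summable).symm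
    _ ≤ _ := by
        refine ENNReal.tsum_le_tsum fun α => ?_
        rw [Finset.sum_ite_eq]
        split_ifs <;> simp

theorem wnorm_monomialQuotient_ne_top {t : ℕ} {S : Finset (Fin n →₀ ℕ)} {σ : Fin n →₀ ℕ}
    (hσ : σ ∈ S) {g : MvPowerSeries (Fin n) ℂ} (hg : wnorm t g ≠ ∞) :
    wnorm t (monomialQuotient S σ g) ≠ ∞ := by
  intro h
  refine hg (top_le_iff.1 (le_trans ?_ (sum_wnorm_monomialQuotient_le t S g)))
  refine le_trans ?_ (Finset.single_le_sum (fun _ _ => zero_le) hσ)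
  rw [h, ENNReal.top_mul (pow_ne_zero _ (weight_ne_zero σ))]

section Neumann

open scoped MvPowerSeries.WithPiTopology

/-- A continuous operator that halves a weighted norm can be subtracted from the identity without
losing surjectivity. -/
theorem exists_sub_apply_eq_of_wnorm_le {t : ℕ}
    (T : MvPowerSeries (Fin n) ℂ →ₗ[ℂ] MvPowerSeries (Fin n) ℂ) (hT : Continuous T)
    (hle : ∀ g, wnorm t (T g) ≤ 2⁻¹ * wnorm t g) {g : MvPowerSeries (Fin n) ℂ}
    (hg : wnorm t g ≠ ∞) : ∃ G, wnorm t G ≠ ∞ ∧ G - T G = g := by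
  have hk : ∀ k : ℕ, wnorm t ((T ^ k) g) ≤ 2⁻¹ ^ k * wnorm t g := by
    intro k
    induction k with
    | zero => simp
    | succ k ih =>
      rw [pow_succ', Module.End.mul_apply]
      refine (hle _).trans ?_
      rw [pow_succ', mul_assoc]
      gcongr
  have hfin : ∑' k, wnorm t ((T ^ k) g) ≠ ∞ := by
    refine ne_top_of_le_ne_top ?_ (ENNReal.tsum_le_tsum hk)
    rw [ENNReal.tsum_mul_right, ENNReal.tsum_geometric]
    refine ENNReal.mul_ne_top ?_ hg
    simp
  -- Finiteness in the norm forces summability of each coefficient, hence convergence of the Neumann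
  -- series in the product topology, where T is continuous.
  have hcoef : ∀ α, ∑' k, ‖MvPowerSeries.coeff α ((T ^ k) g)‖ₑ ≠ ∞ := by
    intro α h
    refine hfin (top_le_iff.1 ?_)
    calc ∞ = (∑' k, ‖MvPowerSeries.coeff α ((T ^ k) g)‖ₑ) * weight α ^ t := by
          rw [h, ENNReal.top_mul (pow_ne_zero _ (weight_ne_zero α))]
      _ ≤ _ := by
          rw [← ENNReal.tsum_mul_right]
          exact ENNReal.tsum_le_tsum fun k => ENNReal.le_tsum α
  have hsc : ∀ α, Summable fun k => MvPowerSeries.coeff α ((T ^ k) g) := fun α =>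
    Summable.of_enorm (hcoef α)
  have hs : Summable fun k => (T ^ k) g :=
    MvPowerSeries.WithPiTopology.summable_iff_summable_coeff.2 hsc
  refine ⟨∑' k, (T ^ k) g, ?_, ?_⟩
  · refine ne_top_of_le_ne_top hfin ?_
    simp only [wnorm]
    rw [ENNReal.tsum_comm]
    refine ENNReal.tsum_le_tsum fun α => ?_
    rw [ENNReal.tsum_mul_right]
    gcongr
    rw [(hs.hasSum.map (MvPowerSeries.coeff α) (MvPowerSeries.WithPiTopology.continuous_coeff ℂ α)
      ).tsum_eq.symm]
    exact enorm_tsum_le_tsum_enorm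
  · have h1 : T (∑' k, (T ^ k) g) = ∑' k, (T ^ (k + 1)) g := by
      rw [← (hs.hasSum.map T hT).tsum_eq]
      refine tsum_congr fun k => ?_
      rw [pow_succ', Module.End.mul_apply]
      rfl
    rw [h1, hs.tsum_eq_zero_add]
    simp

theorem continuous_monomialQuotient (S : Finset (Fin n →₀ ℕ)) (σ : Fin n →₀ ℕ) :
    Continuous (monomialQuotient S σ) := by
  refine continuous_pi fun γ => ?_
  exact continuous_const.mul (MvPowerSeries.WithPiTopology.continuous_coeff ℂ _)

/-- Division of a convergent power series by power series `f_σ` with leading terms `x^σ`. -/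
theorem exists_division {t : ℕ} (S : Finset (Fin n →₀ ℕ))
    (f : (Fin n →₀ ℕ) → MvPowerSeries (Fin n) ℂ)
    (hf : ∀ σ ∈ S, wnorm t (f σ - MvPowerSeries.monomial σ 1) ≤ 2⁻¹ * weight σ ^ t)
    {g : MvPowerSeries (Fin n) ℂ} (hg : wnorm t g ≠ ∞) :
    ∃ G, wnorm t G ≠ ∞ ∧
      g = ∑ σ ∈ S, monomialQuotient S σ G * f σ + monomialRemainder S G := by
  -- T is the error of using x^σ in place of f_σ. Monomial division of G and the equation G - TG = g
  -- together give the division of g by the f_σ, so only 1 - T has to be inverted.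
  let T : MvPowerSeries (Fin n) ℂ →ₗ[ℂ] MvPowerSeries (Fin n) ℂ :=
    ∑ σ ∈ S, LinearMap.mulRight ℂ (MvPowerSeries.monomial σ 1 - f σ) ∘ₗ monomialQuotient S σ
  have hTapp : ∀ g, T g =
      ∑ σ ∈ S, monomialQuotient S σ g * (MvPowerSeries.monomial σ 1 - f σ) := by
    intro g; simp [T, LinearMap.sum_apply]
  have hcont : Continuous T := by
    have : (T : MvPowerSeries (Fin n) ℂ → MvPowerSeries (Fin n) ℂ) = fun g =>
        ∑ σ ∈ S, monomialQuotient S σ g * (MvPowerSeries.monomial σ 1 - f σ) := funext hTapp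
    rw [this]
    exact continuous_finsetSum _ fun σ _ =>
      (continuous_monomialQuotient S σ).mul continuous_const
  have hle : ∀ g, wnorm t (T g) ≤ 2⁻¹ * wnorm t g := by
    intro g
    rw [hTapp]
    calc _ ≤ ∑ σ ∈ S, wnorm t (monomialQuotient S σ g) * (2⁻¹ * weight σ ^ t) := by
          refine (wnorm_sum_le _ _ _).trans (Finset.sum_le_sum fun σ hσ => ?_)
          refine (wnorm_mul_le _ _ _).trans ?_
          rw [← neg_sub, wnorm_neg]
          gcongr
          exact hf σ hσ
      _ = 2⁻¹ * ∑ σ ∈ S, wnorm t (monomialQuotient S σ g) * weight σ ^ t := by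
          rw [Finset.mul_sum]
          exact Finset.sum_congr rfl fun σ _ => by ring
      _ ≤ _ := by
          gcongr
          exact sum_wnorm_monomialQuotient_le t S g
  obtain ⟨G, hG, e⟩ := exists_sub_apply_eq_of_wnorm_le (t := t) T hcont hle hg
  refine ⟨G, hG, ?_⟩
  have h2 := sum_monomialQuotient_add_remainder S G
  rw [← e, hTapp]
  nth_rewrite 1 [← h2]
  simp only [mul_sub, Finset.sum_sub_distrib]
  abel

end Neumann

end Division

/-! ### Convergent power series form a Noetherian ring. -/

section ConvergentSeries

variable {n : ℕ}

variable (n) in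
/-- The ring of convergent power series in `n` variables. -/
def convergentSeries : Subring (MvPowerSeries (Fin n) ℂ) where
  carrier := {f | ∃ t, wnorm t f ≠ ∞}
  mul_mem' := by
    rintro f g ⟨t, hf⟩ ⟨t', hg⟩
    refine ⟨max t t', ne_top_of_le_ne_top ?_ (wnorm_mul_le _ f g)⟩
    exact ENNReal.mul_ne_top (ne_top_of_le_ne_top hf (wnorm_mono (le_max_left _ _) f))
      (ne_top_of_le_ne_top hg (wnorm_mono (le_max_right _ _) g))
  one_mem' := ⟨0, by
    have := wnorm_monomial (n := n) 0 0 1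
    rw [MvPowerSeries.monomial_zero_one] at this
    simp [this]⟩
  add_mem' := by
    rintro f g ⟨t, hf⟩ ⟨t', hg⟩
    refine ⟨max t t', ne_top_of_le_ne_top ?_ (wnorm_add_le _ f g)⟩
    exact ENNReal.add_ne_top.2 ⟨ne_top_of_le_ne_top hf (wnorm_mono (le_max_left _ _) f),
      ne_top_of_le_ne_top hg (wnorm_mono (le_max_right _ _) g)⟩
  zero_mem' := ⟨0, by simp [wnorm_zero]⟩
  neg_mem' := by
    rintro f ⟨t, hf⟩
    exact ⟨t, by rwa [wnorm_neg]⟩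

theorem monomial_mem_convergentSeries (σ : Fin n →₀ ℕ) (c : ℂ) :
    MvPowerSeries.monomial σ c ∈ convergentSeries n :=
  ⟨0, by rw [wnorm_monomial]; simp⟩

/-- Every nonzero power series has a leading exponent for the order given by `primeWeight`. -/
theorem exists_leading_exponent {f : MvPowerSeries (Fin n) ℂ} (hf : f ≠ 0) :
    ∃ σ, MvPowerSeries.coeff σ f ≠ 0 ∧
      ∀ α, MvPowerSeries.coeff α f ≠ 0 → primeWeight σ ≤ primeWeight α := by
  have hne : {α | MvPowerSeries.coeff α f ≠ 0}.Nonempty := by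
    by_contra h
    rw [Set.not_nonempty_iff_eq_empty] at h
    refine hf (MvPowerSeries.ext fun α => ?_)
    by_contra hα
    exact (h ▸ (show α ∈ {α | MvPowerSeries.coeff α f ≠ 0} from hα) : α ∈ (∅ : Set _))
  refine ⟨Function.argminOn primeWeight _ hne, Function.argminOn_mem primeWeight _ hne, ?_⟩
  intro α hα
  exact Function.argminOn_le primeWeight _ hα

/-- Dickson's lemma. -/
theorem exists_finset_forall_exists_le (L : Set (Fin n →₀ ℕ)) :
    ∃ S : Finset (Fin n →₀ ℕ), (∀ σ ∈ S, σ ∈ L) ∧ ∀ α ∈ L, ∃ σ ∈ S, σ ≤ α := by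
  have hfin : {σ | Minimal (· ∈ L) σ}.Finite :=
    WellQuasiOrderedLE.finite_of_isAntichain (setOfPred_minimal_antichain _)
  refine ⟨hfin.toFinset, fun σ hσ => ((hfin.mem_toFinset).1 hσ).1, fun α hα => ?_⟩
  obtain ⟨σ, hle, hσ⟩ := exists_minimal_le_of_wellFoundedLT (· ∈ L) α hα
  exact ⟨σ, hfin.mem_toFinset.2 hσ, hle⟩

instance isNoetherianRing_convergentSeries : IsNoetherianRing (convergentSeries n) := by
  classical
  refine ⟨fun I => ?_⟩
  -- A standard basis argument: L is the set of leading exponents of I, realized with leading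
  -- coefficient 1, and the generators realize a finite subset of L that divides all of L.
  let L : Set (Fin n →₀ ℕ) := {σ | ∃ f : convergentSeries n, f ∈ I ∧
    MvPowerSeries.coeff σ (f : MvPowerSeries (Fin n) ℂ) = 1 ∧
    ∀ α, MvPowerSeries.coeff α (f : MvPowerSeries (Fin n) ℂ) ≠ 0 → primeWeight σ ≤ primeWeight α}
  have hlead : ∀ f ∈ I, (f : MvPowerSeries (Fin n) ℂ) ≠ 0 → ∃ σ ∈ L,
      MvPowerSeries.coeff σ (f : MvPowerSeries (Fin n) ℂ) ≠ 0 := by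
    intro f hf h0
    obtain ⟨σ, hσ, hmin⟩ := exists_leading_exponent h0
    let c : convergentSeries n := ⟨MvPowerSeries.C (MvPowerSeries.coeff σ
      (f : MvPowerSeries (Fin n) ℂ))⁻¹, monomial_mem_convergentSeries 0 _⟩
    refine ⟨σ, ⟨c * f, Ideal.mul_mem_left I _ hf, ?_, ?_⟩, hσ⟩
    · simp [c, hσ]
    · intro α hα
      refine hmin α fun h => hα ?_
      simp [c, h]
  obtain ⟨S, hSL, hS⟩ := exists_finset_forall_exists_le L
  have hex : ∀ σ, ∃ f : convergentSeries n, σ ∈ S → f ∈ I ∧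
      MvPowerSeries.coeff σ (f : MvPowerSeries (Fin n) ℂ) = 1 ∧
      ∀ α, MvPowerSeries.coeff α (f : MvPowerSeries (Fin n) ℂ) ≠ 0 →
        primeWeight σ ≤ primeWeight α := by
    intro σ
    by_cases h : σ ∈ S
    · obtain ⟨f, hf⟩ := hSL σ h
      exact ⟨f, fun _ => hf⟩
    · exact ⟨0, fun h' => absurd h' h⟩
  choose f hf using hex
  refine ⟨S.image f, le_antisymm ?_ ?_⟩
  · rw [Ideal.submodule_span_eq, Ideal.span_le]
    intro x hx
    obtain ⟨σ, hσ, rfl⟩ := Finset.mem_image.1 (Finset.mem_coe.1 hx)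
    exact (hf σ hσ).1
  · intro g hg
    -- One t must serve all divisors and g at once. The closeness estimates hold for all large t,
    -- and norms decrease with t.
    have ev : ∀ᶠ t in Filter.atTop, ∀ σ ∈ S,
        wnorm t ((f σ : MvPowerSeries (Fin n) ℂ) - MvPowerSeries.monomial σ 1) ≤
          2⁻¹ * weight σ ^ t := by
      rw [Finset.eventually_all]
      intro σ hσ
      obtain ⟨t₀, ht₀⟩ := (f σ).2
      exact eventually_wnorm_sub_monomial_le ht₀ (hf σ hσ).2.1 (hf σ hσ).2.2
    obtain ⟨t₁, hg1⟩ := g.2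
    obtain ⟨t, ht, htt⟩ := (ev.and (Filter.eventually_ge_atTop t₁)).exists
    obtain ⟨G, hG, e⟩ := exists_division S (fun σ => (f σ : MvPowerSeries (Fin n) ℂ)) ht
      (ne_top_of_le_ne_top hg1 (wnorm_mono htt _))
    let q : (Fin n →₀ ℕ) → convergentSeries n := fun σ => if hσ : σ ∈ S then
      ⟨monomialQuotient S σ G, t, wnorm_monomialQuotient_ne_top hσ hG⟩ else 0
    have hq : ((∑ σ ∈ S, q σ * f σ : convergentSeries n) : MvPowerSeries (Fin n) ℂ) =
        ∑ σ ∈ S, monomialQuotient S σ G * f σ := by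
      push_cast
      refine Finset.sum_congr rfl fun σ hσ => ?_
      simp [q, hσ]
    have hmem : ∑ σ ∈ S, q σ * f σ ∈ I :=
      I.sum_mem fun σ hσ => Ideal.mul_mem_left I _ (hf σ hσ).1
    have hrem : ((g - ∑ σ ∈ S, q σ * f σ : convergentSeries n) : MvPowerSeries (Fin n) ℂ) =
        monomialRemainder S G := by
      rw [AddSubgroupClass.coe_sub, hq]
      nth_rewrite 1 [e]
      ring
    -- The remainder lies in I. If it were nonzero, it would have a nonzero coefficient at an
    -- exponent in L, which some element of S divides; the remainder has no such terms.
    have hzero : g - ∑ σ ∈ S, q σ * f σ = 0 := by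
      by_contra hne
      obtain ⟨σ, hσ, hc⟩ := hlead _ (I.sub_mem hg hmem) (fun h0 => hne (Subtype.ext h0))
      rw [hrem, coeff_monomialRemainder, if_pos (hS σ hσ)] at hc
      exact hc rfl
    rw [sub_eq_zero.1 hzero]
    refine Ideal.sum_mem _ fun σ hσ => Ideal.mul_mem_left _ _ (Submodule.subset_span ?_)
    simpa using ⟨σ, hσ, rfl⟩

end ConvergentSeries

end

section

open scoped ENNReal

/-! ### The coordinates form a regular sequence. -/

section CoordinateIdeals

variable {n : ℕ}

/-- The `i`-th coordinate as a convergent power series. -/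
def coordSeries (i : Fin n) : convergentSeries n :=
  ⟨MvPowerSeries.X i, monomial_mem_convergentSeries _ _⟩

/-- The ideal generated by the coordinates with indices in `S`. -/
def coordIdeal (S : Finset (Fin n)) : Ideal (convergentSeries n) :=
  Ideal.span (coordSeries '' (S : Set (Fin n)))

theorem coordIdeal_empty : coordIdeal (∅ : Finset (Fin n)) = ⊥ := by simp [coordIdeal]

theorem coordIdeal_insert [DecidableEq (Fin n)] (S : Finset (Fin n)) (j : Fin n) :
    coordIdeal (insert j S) = coordIdeal S ⊔ Ideal.span {coordSeries j} := by
  rw [coordIdeal, coordIdeal, Finset.coe_insert, Set.image_insert_eq, Ideal.span_insert, sup_comm]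

/-- Monomial division by the x_i with i ∈ S leaves exactly the terms free of these variables, and
the quotients converge by the norm bound. -/
theorem mem_coordIdeal {S : Finset (Fin n)} {f : convergentSeries n} :
    f ∈ coordIdeal S ↔ ∀ α : Fin n →₀ ℕ, (∀ i ∈ S, α i = 0) →
      MvPowerSeries.coeff α (f : MvPowerSeries (Fin n) ℂ) = 0 := by
  classical
  constructor
  · intro hf
    induction hf using Submodule.span_induction with
    | mem x hx =>
      obtain ⟨i, hi, rfl⟩ := hx
      intro α hα
      rw [coordSeries, MvPowerSeries.coeff_X, if_neg]
      rintro rfl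
      simpa using hα i hi
    | zero => intro α _; simp
    | add x y _ _ hx hy =>
      intro α hα
      rw [Subring.coe_add, map_add, hx α hα, hy α hα, add_zero]
    | smul a x _ hx =>
      intro α hα
      rw [smul_eq_mul, Subring.coe_mul, MvPowerSeries.coeff_mul]
      refine Finset.sum_eq_zero fun p hp => ?_
      rw [hx p.2, mul_zero]
      intro i hi
      have h := DFunLike.congr_fun (Finset.HasAntidiagonal.mem_antidiagonal.1 hp) i
      rw [Finsupp.add_apply, hα i hi] at h
      omega
  · intro h
    obtain ⟨t, ht⟩ := f.2
    let S' : Finset (Fin n →₀ ℕ) := S.image fun i => Finsupp.single i 1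
    have hrem : monomialRemainder S' (f : MvPowerSeries (Fin n) ℂ) = 0 := by
      ext α
      rw [coeff_monomialRemainder]
      split_ifs with hα
      · simp
      · refine h α fun i hi => ?_
        by_contra h0
        refine hα ⟨Finsupp.single i 1, Finset.mem_image_of_mem _ hi, ?_⟩
        simpa [Nat.one_le_iff_ne_zero] using h0
    have e := sum_monomialQuotient_add_remainder S' (f : MvPowerSeries (Fin n) ℂ)
    rw [hrem, add_zero, Finset.sum_image fun i _ j _ hij =>
      (Finsupp.single_left_injective one_ne_zero) hij] at e
    let q : Fin n → convergentSeries n := fun i => if hi : i ∈ S then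
      ⟨monomialQuotient S' (Finsupp.single i 1) f, t,
        wnorm_monomialQuotient_ne_top (Finset.mem_image_of_mem _ hi) ht⟩ else 0
    have hq : f = ∑ i ∈ S, q i * coordSeries i := by
      apply Subtype.ext
      rw [← e]
      push_cast
      refine Finset.sum_congr rfl fun i hi => ?_
      simp only [q, dif_pos hi]
      rfl
    rw [hq]
    exact Ideal.sum_mem _ fun i hi =>
      Ideal.mul_mem_left _ _ (Ideal.subset_span ⟨i, hi, rfl⟩)

/-- Multiplication by x_j shifts exponents in a direction outside S, which preserves the criterion
of `mem_coordIdeal`. -/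
theorem regularMod_coordIdeal {S : Finset (Fin n)} {j : Fin n} (hj : j ∉ S) :
    RegularMod (coordIdeal S) (coordSeries j) := by
  intro r hr
  rw [mem_coordIdeal] at hr ⊢
  intro α hα
  have h := hr (Finsupp.single j 1 + α) fun i hi => by
    have : j ≠ i := fun e => hj (e ▸ hi)
    simp [hα i hi, this]
  rw [Subring.coe_mul] at h
  exact (one_mul _).symm.trans ((MvPowerSeries.coeff_add_monomial_mul _ α _ 1).symm.trans h)

theorem regularSeqMod_coordIdeal (l : List (Fin n)) : ∀ S : Finset (Fin n), l.Nodup →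
    (∀ i ∈ l, i ∉ S) → RegularSeqMod (coordIdeal S) (l.map coordSeries) := by
  classical
  induction l with
  | nil => intro S _ _; trivial
  | cons j l ih =>
    intro S hl hS
    rw [List.nodup_cons] at hl
    refine ⟨regularMod_coordIdeal (hS j (by simp)), ?_⟩
    rw [← coordIdeal_insert]
    refine ih _ hl.2 fun i hi => ?_
    rw [Finset.mem_insert, not_or]
    exact ⟨fun e => hl.1 (e ▸ hi), hS i (by simp [hi])⟩

theorem depthGE_coordIdeal_univ : DepthGE (coordIdeal (Finset.univ : Finset (Fin n))) ⊥ n := by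
  refine ⟨(List.finRange n).map coordSeries, by simp, ?_, ?_⟩
  · intro y hy
    obtain ⟨i, -, rfl⟩ := List.mem_map.1 hy
    exact Ideal.subset_span ⟨i, by simp, rfl⟩
  · rw [← coordIdeal_empty]
    exact regularSeqMod_coordIdeal _ _ (List.nodup_finRange n) (by simp)

theorem mem_coordIdeal_univ {f : convergentSeries n} :
    f ∈ coordIdeal (Finset.univ : Finset (Fin n)) ↔
      MvPowerSeries.constantCoeff (f : MvPowerSeries (Fin n) ℂ) = 0 := by
  rw [mem_coordIdeal, ← MvPowerSeries.coeff_zero_eq_constantCoeff_apply]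
  constructor
  · intro h; exact h 0 (by simp)
  · intro h α hα
    rwa [show α = 0 from Finsupp.ext fun i => hα i (Finset.mem_univ i)]

end CoordinateIdeals

end

section

open scoped ENNReal NNReal

/-! ### Values of monomials, and words as noncommutative monomials. -/

section MonomialValues

variable {n : ℕ}

/-- Together with `primeWeight_le` this compares the weights with geometric weights in the total
degree, so that finiteness of some `wnorm t` means ordinary convergence near the origin. -/
theorem two_pow_degree_le_primeWeight (α : Fin n →₀ ℕ) : 2 ^ α.degree ≤ primeWeight α := by
  rw [primeWeight, Finsupp.degree_apply, Finsupp.prod, ← Finset.prod_pow_eq_pow_sum]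
  exact Finset.prod_le_prod' fun i _ => Nat.pow_le_pow_left (Nat.prime_nth_prime _).two_le _

theorem primeWeight_le (α : Fin n →₀ ℕ) :
    primeWeight α ≤ (1 + ∑ i : Fin n, Nat.nth Nat.Prime i) ^ α.degree := by
  rw [primeWeight, Finsupp.degree_apply, Finsupp.prod, ← Finset.prod_pow_eq_pow_sum]
  refine Finset.prod_le_prod' fun i _ => Nat.pow_le_pow_left ?_ _
  have := Finset.single_le_sum (f := fun i : Fin n => Nat.nth Nat.Prime i) (fun _ _ => Nat.zero_le _)
    (Finset.mem_univ i)
  exact this.trans (Nat.le_add_left _ _)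

theorem weight_le (α : Fin n →₀ ℕ) : weight α ≤ 2⁻¹ ^ α.degree := by
  rw [weight, ← ENNReal.inv_pow, ENNReal.inv_le_inv]
  exact_mod_cast two_pow_degree_le_primeWeight α

variable (n) in
/-- A polyradius on which the series of finite `t`-norm converge. -/
def polyradius (t : ℕ) : ℝ≥0 := ((1 + ∑ i : Fin n, Nat.nth Nat.Prime i : ℕ) : ℝ≥0)⁻¹ ^ t

theorem polyradius_pos (t : ℕ) : 0 < polyradius n t := by
  unfold polyradius
  positivity

theorem polyradius_pow_le (t : ℕ) (α : Fin n →₀ ℕ) :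
    (polyradius n t : ℝ≥0∞) ^ α.degree ≤ weight α ^ t := by
  rw [polyradius, ENNReal.coe_pow, ENNReal.coe_inv (by positivity), ← pow_mul, mul_comm, pow_mul]
  gcongr
  rw [weight, ← ENNReal.inv_pow, ENNReal.inv_le_inv]
  have := primeWeight_le α
  exact_mod_cast this

/-- The value `x^α` of a monomial. -/
def monomialValue (x : Fin n → ℂ) (α : Fin n →₀ ℕ) : ℂ := α.prod fun i k => x i ^ k

theorem monomialValue_add (x : Fin n → ℂ) (α β : Fin n →₀ ℕ) :
    monomialValue x (α + β) = monomialValue x α * monomialValue x β :=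
  Finsupp.prod_add_index' (fun _ => pow_zero _) fun _ _ _ => pow_add _ _ _

theorem enorm_monomialValue_le (x : Fin n → ℂ) (α : Fin n →₀ ℕ) :
    ‖monomialValue x α‖ₑ ≤ ‖x‖ₑ ^ α.degree := by
  have h : ‖monomialValue x α‖₊ ≤ ‖x‖₊ ^ α.degree := by
    rw [monomialValue, Finsupp.degree_apply, Finsupp.prod, ← Finset.prod_pow_eq_pow_sum,
      nnnorm_prod]
    refine Finset.prod_le_prod' fun i _ => ?_
    rw [nnnorm_pow]
    exact pow_le_pow_left' (nnnorm_le_pi_nnnorm x i) _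
  simp only [enorm_eq_nnnorm]
  exact_mod_cast h

/-- The exponent of the monomial `x_{w 0} ⋯ x_{w (m-1)}`. -/
def content {m : ℕ} (w : Fin m → Fin n) : Fin n →₀ ℕ := ∑ j, Finsupp.single (w j) 1

theorem degree_content {m : ℕ} (w : Fin m → Fin n) : (content w).degree = m := by
  simp [content, map_sum]

theorem monomialValue_content (x : Fin n → ℂ) {m : ℕ} (w : Fin m → Fin n) :
    monomialValue x (content w) = ∏ j, x (w j) := by
  have : ∀ s : Finset (Fin m), monomialValue x (∑ j ∈ s, Finsupp.single (w j) 1) =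
      ∏ j ∈ s, x (w j) := by
    classical
    intro s
    induction s using Finset.induction_on with
    | empty => simp [monomialValue]
    | insert j s hj ih =>
      rw [Finset.sum_insert hj, Finset.prod_insert hj, monomialValue_add, ih]
      simp [monomialValue]
  exact this Finset.univ

theorem exists_content_eq (α : Fin n →₀ ℕ) :
    ∃ w : (m : ℕ) × (Fin m → Fin n), content w.2 = α := by
  induction α using Finsupp.induction_linear with
  | zero => exact ⟨⟨0, Fin.elim0⟩, by simp [content]⟩
  | add α β hα hβ =>
    obtain ⟨⟨m, w⟩, rfl⟩ := hα
    obtain ⟨⟨m', w'⟩, rfl⟩ := hβ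
    exact ⟨⟨m + m', Fin.append w w'⟩, by simp [content, Fin.sum_univ_add]⟩
  | single i k => exact ⟨⟨k, fun _ => i⟩, by simp [content]⟩

/-- A word of given content. -/
def wordOf (α : Fin n →₀ ℕ) : (m : ℕ) × (Fin m → Fin n) := (exists_content_eq α).choose

theorem content_wordOf (α : Fin n →₀ ℕ) : content (wordOf α).2 = α :=
  (exists_content_eq α).choose_spec

theorem wordOf_injective : Function.Injective (wordOf : (Fin n →₀ ℕ) → _) := fun α β h => by
  rw [← content_wordOf α, ← content_wordOf β, h]

end MonomialValues

/-! ### Sums of convergent power series near the origin. -/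

section Evaluation

variable {n : ℕ}

theorem tsum_enorm_coeff_mul_le {f : MvPowerSeries (Fin n) ℂ} {t : ℕ} {ρ : ℝ≥0∞}
    (hρ : ρ ≤ polyradius n t) :
    ∑' α, ‖MvPowerSeries.coeff α f‖ₑ * ρ ^ α.degree ≤ wnorm t f := by
  exact ENNReal.tsum_le_tsum fun α =>
    mul_le_mul_right ((pow_le_pow_left' hρ _).trans (polyradius_pow_le t α)) _

theorem summable_norm_eval {f : MvPowerSeries (Fin n) ℂ} {t : ℕ} (hf : wnorm t f ≠ ∞)
    {x : Fin n → ℂ} (hx : ‖x‖ₑ ≤ polyradius n t) :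
    Summable fun α => ‖MvPowerSeries.coeff α f * monomialValue x α‖ := by
  have h : ∑' α, ‖MvPowerSeries.coeff α f * monomialValue x α‖ₑ ≤ wnorm t f := by
    refine le_trans (ENNReal.tsum_le_tsum fun α => ?_) (tsum_enorm_coeff_mul_le hx)
    rw [enorm_mul]
    exact mul_le_mul_right (enorm_monomialValue_le x α) _
  have h2 : Summable fun α => MvPowerSeries.coeff α f * monomialValue x α :=
    Summable.of_enorm (ne_top_of_le_ne_top hf h)
  exact h2.norm

/-- The sum of a power series. -/
def evalSeries (f : MvPowerSeries (Fin n) ℂ) (x : Fin n → ℂ) : ℂ :=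
  ∑' α, MvPowerSeries.coeff α f * monomialValue x α

theorem eventually_enorm_le (t : ℕ) :
    ∀ᶠ x : Fin n → ℂ in 𝓝 0, ‖x‖ₑ ≤ polyradius n t := by
  filter_upwards [Metric.closedBall_mem_nhds (0 : Fin n → ℂ)
    (NNReal.coe_pos.2 (polyradius_pos (n := n) t))] with x hx
  rw [mem_closedBall_zero_iff] at hx
  rw [enorm_eq_nnnorm]
  exact_mod_cast hx

/-- The coefficient of a word: the coefficient of the power series if the word is the chosen one
of its content, and zero otherwise. -/
def wordCoeff (f : MvPowerSeries (Fin n) ℂ) (w : (m : ℕ) × (Fin m → Fin n)) : ℂ :=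
  open Classical in
  if wordOf (content w.2) = w then MvPowerSeries.coeff (content w.2) f else 0

theorem wordCoeff_wordOf (f : MvPowerSeries (Fin n) ℂ) (α : Fin n →₀ ℕ) :
    wordCoeff f (wordOf α) = MvPowerSeries.coeff α f := by
  rw [wordCoeff, content_wordOf, if_pos rfl]

theorem wordCoeff_eq_zero (f : MvPowerSeries (Fin n) ℂ) {w : (m : ℕ) × (Fin m → Fin n)}
    (hw : w ∉ Set.range wordOf) : wordCoeff f w = 0 := by
  rw [wordCoeff, if_neg fun h => hw ⟨_, h⟩]

/-- The multilinear form `(v_0, …, v_{m-1}) ↦ ∏ (v_j)_{w j}`. -/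
def wordForm {m : ℕ} (w : Fin m → Fin n) :
    ContinuousMultilinearMap ℂ (fun _ : Fin m => Fin n → ℂ) ℂ :=
  (ContinuousMultilinearMap.mkPiAlgebra ℂ (Fin m) ℂ).compContinuousLinearMap
    fun j => ContinuousLinearMap.proj (w j)

theorem wordForm_apply {m : ℕ} (w : Fin m → Fin n) (v : Fin m → Fin n → ℂ) :
    wordForm w v = ∏ j, v j (w j) := by simp [wordForm]

theorem norm_wordForm_le {m : ℕ} (w : Fin m → Fin n) : ‖wordForm w‖ ≤ 1 := by
  refine ContinuousMultilinearMap.opNorm_le_bound zero_le_one fun v => ?_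
  rw [wordForm_apply, one_mul, norm_prod]
  exact Finset.prod_le_prod (fun _ _ => norm_nonneg _) fun j _ => norm_le_pi_norm (v j) (w j)

/-- The formal multilinear series of a power series. -/
def multilinearSeries (f : MvPowerSeries (Fin n) ℂ) :
    FormalMultilinearSeries ℂ (Fin n → ℂ) ℂ := fun m =>
  ∑ w : Fin m → Fin n, wordCoeff f ⟨m, w⟩ • wordForm w

theorem multilinearSeries_apply (f : MvPowerSeries (Fin n) ℂ) (m : ℕ) (x : Fin n → ℂ) :
    (multilinearSeries f m fun _ => x) =
      ∑ w : Fin m → Fin n, wordCoeff f ⟨m, w⟩ * monomialValue x (content w) := by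
  simp [multilinearSeries, wordForm_apply, monomialValue_content]

theorem tsum_enorm_multilinearSeries_le (f : MvPowerSeries (Fin n) ℂ) (t : ℕ) :
    ∑' m, ‖multilinearSeries f m‖ₑ * (polyradius n t : ℝ≥0∞) ^ m ≤ wnorm t f := by
  refine le_trans ?_ (tsum_enorm_coeff_mul_le le_rfl)
  have h1 : ∑' w : (m : ℕ) × (Fin m → Fin n), ‖wordCoeff f w‖ₑ * (polyradius n t : ℝ≥0∞) ^ w.1 =
      ∑' α, ‖MvPowerSeries.coeff α f‖ₑ * (polyradius n t : ℝ≥0∞) ^ α.degree := by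
    rw [← wordOf_injective.tsum_eq]
    · refine tsum_congr fun α => ?_
      rw [wordCoeff_wordOf]
      congr 2
      conv_rhs => rw [← content_wordOf α, degree_content]
    · intro w hw
      by_contra h
      exact hw (by simp [wordCoeff_eq_zero f h])
  rw [← h1, ENNReal.tsum_sigma']
  refine ENNReal.tsum_le_tsum fun m => ?_
  rw [tsum_fintype]
  change _ ≤ ∑ w : Fin m → Fin n, ‖wordCoeff f ⟨m, w⟩‖ₑ * (polyradius n t : ℝ≥0∞) ^ m
  rw [← Finset.sum_mul]
  refine mul_le_mul_left ?_ _
  have h2 : ‖multilinearSeries f m‖₊ ≤ ∑ w : Fin m → Fin n, ‖wordCoeff f ⟨m, w⟩‖₊ := by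
    refine (nnnorm_sum_le _ _).trans (Finset.sum_le_sum fun w _ => ?_)
    rw [nnnorm_smul]
    exact mul_le_of_le_one_right' (norm_wordForm_le w)
  simp only [enorm_eq_nnnorm]
  exact_mod_cast h2

/-- The whole coefficient of x^α sits on one chosen word of content α, so the sum over words is a
reindexing of the power series, and grouping words by length gives the multilinear series. -/
theorem hasFPowerSeriesOnBall_evalSeries {f : MvPowerSeries (Fin n) ℂ} {t : ℕ}
    (hf : wnorm t f ≠ ∞) :
    HasFPowerSeriesOnBall (evalSeries f) (multilinearSeries f) 0 (polyradius n t) where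
  r_le := by
    refine FormalMultilinearSeries.le_radius_of_summable _ ?_
    have h := ne_top_of_le_ne_top hf (tsum_enorm_multilinearSeries_le f t)
    have h2 := ENNReal.tsum_coe_ne_top_iff_summable.1
      (show ∑' m, ((‖multilinearSeries f m‖₊ * polyradius n t ^ m : ℝ≥0) : ℝ≥0∞) ≠ ∞ by
        simpa [enorm_eq_nnnorm] using h)
    have h3 := NNReal.summable_coe.2 h2
    simpa using h3
  r_pos := by exact_mod_cast polyradius_pos t
  hasSum := by
    intro x hx
    have hx' : ‖x‖ₑ ≤ polyradius n t := by simpa using (Metric.mem_eball.1 hx).le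
    rw [zero_add]
    have h1 := (summable_norm_eval hf hx').of_norm.hasSum
    have h2 : HasSum (fun w : (m : ℕ) × (Fin m → Fin n) =>
        wordCoeff f w * monomialValue x (content w.2)) (evalSeries f x) := by
      rw [← wordOf_injective.hasSum_iff]
      · have e : ((fun w : (m : ℕ) × (Fin m → Fin n) =>
            wordCoeff f w * monomialValue x (content w.2)) ∘ wordOf) =
            fun α => MvPowerSeries.coeff α f * monomialValue x α := by
          funext α
          rw [Function.comp_apply, wordCoeff_wordOf, content_wordOf]
        rw [e]
        exact h1
      · intro w hw
        rw [wordCoeff_eq_zero f hw, zero_mul]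
    refine h2.sigma fun m => ?_
    rw [multilinearSeries_apply]
    exact hasSum_fintype _

theorem analyticAt_evalSeries {f : MvPowerSeries (Fin n) ℂ} (hf : f ∈ convergentSeries n) :
    AnalyticAt ℂ (evalSeries f) 0 := by
  obtain ⟨t, ht⟩ := hf
  exact (hasFPowerSeriesOnBall_evalSeries ht).analyticAt

/-- The multilinear series is not symmetric, so only its diagonal values are known to vanish. In
each degree these are values of a polynomial, whose coefficients vanish because ℂ is infinite. -/
theorem eq_zero_of_evalSeries_eventuallyEq {f : MvPowerSeries (Fin n) ℂ}
    (hf : f ∈ convergentSeries n) (h : evalSeries f =ᶠ[𝓝 0] 0) : f = 0 := by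
  classical
  obtain ⟨t, ht⟩ := hf
  have h1 : HasFPowerSeriesAt 0 (multilinearSeries f) (0 : Fin n → ℂ) :=
    (hasFPowerSeriesOnBall_evalSeries ht).hasFPowerSeriesAt.congr h
  ext α
  let P : MvPolynomial (Fin n) ℂ := ∑ w : Fin (wordOf α).1 → Fin n,
    MvPolynomial.monomial (content w) (wordCoeff f ⟨_, w⟩)
  have hP : P = 0 := by
    refine MvPolynomial.funext fun x => ?_
    have := h1.apply_eq_zero (wordOf α).1 x
    rw [multilinearSeries_apply] at this
    simpa [P, MvPolynomial.eval_monomial, monomialValue] using this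
  have hc : MvPolynomial.coeff α P = MvPowerSeries.coeff α f := by
    simp only [P, MvPolynomial.coeff_sum, MvPolynomial.coeff_monomial]
    rw [Finset.sum_eq_single (wordOf α).2]
    · rw [if_pos (content_wordOf α)]
      exact wordCoeff_wordOf f α
    · intro w _ hw
      split_ifs with hα
      · refine wordCoeff_eq_zero f ?_
        rintro ⟨β, hβ⟩
        have : β = α := by rw [← content_wordOf β, hβ]; exact hα
        subst this
        refine hw ?_
        have := Sigma.ext_iff.1 hβ
        exact (eq_of_heq this.2).symm
      · rfl
    · simp
  rw [← hc, hP]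
  simp

end Evaluation

end

section

open scoped ENNReal NNReal

/-! ### Power series expansion of an analytic function. -/

section Expansion

variable {n : ℕ}

/-- The coefficient of the word `w` in a formal multilinear series. -/
def seriesCoeff (p : FormalMultilinearSeries ℂ (Fin n → ℂ) ℂ)
    (w : (m : ℕ) × (Fin m → Fin n)) : ℂ := p w.1 fun j => Pi.single (w.2 j) 1

theorem enorm_seriesCoeff_le (p : FormalMultilinearSeries ℂ (Fin n → ℂ) ℂ)
    (w : (m : ℕ) × (Fin m → Fin n)) : ‖seriesCoeff p w‖ₑ ≤ ‖p w.1‖ₑ := by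
  have h : ‖seriesCoeff p w‖ ≤ ‖p w.1‖ :=
    le_trans (b := ‖p w.1‖ * ∏ j, ‖(Pi.single (w.2 j) 1 : Fin n → ℂ)‖)
      (ContinuousMultilinearMap.le_opNorm _ _)
      (mul_le_of_le_one_right (norm_nonneg _)
        (Finset.prod_le_one (fun _ _ => norm_nonneg _) fun j _ => by
          rw [Pi.norm_single, norm_one]))
  exact enorm_le_iff_norm_le.2 h

theorem apply_eq_sum_seriesCoeff (p : FormalMultilinearSeries ℂ (Fin n → ℂ) ℂ) (m : ℕ)
    (x : Fin n → ℂ) : (p m fun _ => x) =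
      ∑ w : Fin m → Fin n, seriesCoeff p ⟨m, w⟩ * monomialValue x (content w) := by
  classical
  have hx : (fun _ : Fin m => x) = fun _ => ∑ i, x i • Pi.single i (1 : ℂ) := by
    funext _
    exact (pi_eq_sum_univ' x).trans (by simp)
  rw [hx, ContinuousMultilinearMap.map_sum]
  refine Finset.sum_congr rfl fun w _ => ?_
  rw [ContinuousMultilinearMap.map_smul_univ, monomialValue_content, smul_eq_mul, mul_comm]
  rfl

/-- The power series with the coefficients of a formal multilinear series. -/
def toPowerSeries (p : FormalMultilinearSeries ℂ (Fin n → ℂ) ℂ) : MvPowerSeries (Fin n) ℂ :=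
  fun α => ∑' w : (fun w : (m : ℕ) × (Fin m → Fin n) => content w.2) ⁻¹' {α}, seriesCoeff p w

/-- There are n^m words of length m, each with coefficient bounded by ‖p m‖; hence the factor n in
the radius. -/
theorem tsum_enorm_seriesCoeff_le (p : FormalMultilinearSeries ℂ (Fin n → ℂ) ℂ) (ρ : ℝ≥0∞) :
    ∑' w : (m : ℕ) × (Fin m → Fin n), ‖seriesCoeff p w‖ₑ * ρ ^ w.1 ≤
      ∑' m, ‖p m‖ₑ * (n * ρ) ^ m := by
  rw [ENNReal.tsum_sigma']
  refine ENNReal.tsum_le_tsum fun m => ?_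
  rw [tsum_fintype]
  calc _ ≤ ∑ w : Fin m → Fin n, ‖p m‖ₑ * ρ ^ m :=
        Finset.sum_le_sum fun w _ => mul_le_mul_left (enorm_seriesCoeff_le p ⟨m, w⟩) _
    _ = _ := by
        rw [Finset.sum_const, nsmul_eq_mul, mul_pow]
        simp only [Finset.card_univ, Fintype.card_fun, Fintype.card_fin, Nat.cast_pow]
        ring

theorem wnorm_toPowerSeries_le (p : FormalMultilinearSeries ℂ (Fin n → ℂ) ℂ) (t : ℕ) :
    wnorm t (toPowerSeries p) ≤ ∑' m, ‖p m‖ₑ * (n * 2⁻¹ ^ t) ^ m := by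
  refine le_trans ?_ (tsum_enorm_seriesCoeff_le p _)
  rw [← (Equiv.sigmaFiberEquiv fun w : (m : ℕ) × (Fin m → Fin n) => content w.2).tsum_eq,
    ENNReal.tsum_sigma']
  refine ENNReal.tsum_le_tsum fun α => ?_
  calc _ ≤ (∑' w : (fun w : (m : ℕ) × (Fin m → Fin n) => content w.2) ⁻¹' {α},
          ‖seriesCoeff p w‖ₑ) * weight α ^ t := mul_le_mul_left enorm_tsum_le_tsum_enorm _
    _ ≤ _ := by
        rw [← ENNReal.tsum_mul_right]
        refine ENNReal.tsum_le_tsum ?_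
        rintro ⟨w, hw⟩
        refine mul_le_mul_right ?_ _
        change _ ≤ ((2⁻¹ : ℝ≥0∞) ^ t) ^ w.1
        have hd : α.degree = w.1 := by rw [← degree_content w.2]; exact congrArg _ hw.symm
        rw [← hd, ← pow_mul, mul_comm, pow_mul]
        exact pow_le_pow_left' (weight_le α) _

theorem hasSum_toPowerSeries {f : (Fin n → ℂ) → ℂ} {p : FormalMultilinearSeries ℂ (Fin n → ℂ) ℂ}
    {x : Fin n → ℂ} (hs : ∑' m, ‖p m‖ₑ * (n * ‖x‖ₑ) ^ m ≠ ∞)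
    (h : HasSum (fun m => p m fun _ => x) (f x)) : f x = evalSeries (toPowerSeries p) x := by
  have hsum : Summable fun w : (m : ℕ) × (Fin m → Fin n) =>
      seriesCoeff p w * monomialValue x (content w.2) := by
    refine Summable.of_enorm (ne_top_of_le_ne_top hs
      (le_trans (ENNReal.tsum_le_tsum fun w => ?_) (tsum_enorm_seriesCoeff_le p _)))
    rw [enorm_mul]
    refine mul_le_mul_right ((enorm_monomialValue_le x _).trans ?_) _
    rw [degree_content]
  have h1 : HasSum (fun w : (m : ℕ) × (Fin m → Fin n) =>
      seriesCoeff p w * monomialValue x (content w.2)) (f x) := by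
    refine HasSum.sigma_of_hasSum h (fun m => ?_) hsum
    rw [apply_eq_sum_seriesCoeff]
    exact hasSum_fintype _
  have h2 := h1.tsum_fiberwise fun w => content w.2
  rw [evalSeries, ← h2.tsum_eq]
  refine tsum_congr fun α => ?_
  change _ = (∑' w : (fun w : (m : ℕ) × (Fin m → Fin n) => content w.2) ⁻¹' {α},
    seriesCoeff p w) * monomialValue x α
  rw [← tsum_mul_right]
  refine tsum_congr ?_
  rintro ⟨w, hw⟩
  rw [show content w.2 = α from hw]

/-- Every function analytic at the origin is the sum of a convergent power series. -/
theorem exists_evalSeries_eventuallyEq {f : (Fin n → ℂ) → ℂ} (hf : AnalyticAt ℂ f 0) :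
    ∃ g ∈ convergentSeries n, evalSeries g =ᶠ[𝓝 0] f := by
  obtain ⟨p, r, hp⟩ := hf
  obtain ⟨ρ, hρ0, hρ⟩ := ENNReal.lt_iff_exists_nnreal_btwn.1 hp.r_pos
  have hρ0' : 0 < ρ := by exact_mod_cast hρ0
  have hsum : ∑' m, ‖p m‖ₑ * (ρ : ℝ≥0∞) ^ m ≠ ∞ := by
    have h1 := p.summable_norm_mul_pow (hρ.trans_le hp.r_le)
    have h2 : Summable fun m => ‖p m‖₊ * ρ ^ m := by
      rw [← NNReal.summable_coe]; simpa using h1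
    have h3 := ENNReal.tsum_coe_ne_top_iff_summable.2 h2
    simpa [enorm_eq_nnnorm] using h3
  have hmono : ∀ σ : ℝ≥0∞, σ ≤ ρ → ∑' m, ‖p m‖ₑ * σ ^ m ≠ ∞ := fun σ hσ =>
    ne_top_of_le_ne_top hsum (ENNReal.tsum_le_tsum fun m =>
      mul_le_mul_right (pow_le_pow_left' hσ m) _)
  -- The bound on `wnorm t` sums the series at radius n·2⁻ᵗ, which falls below ρ for large t.
  have hlim : Filter.Tendsto (fun t : ℕ => (n : ℝ≥0∞) * 2⁻¹ ^ t) Filter.atTop (𝓝 0) := by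
    have := ENNReal.Tendsto.const_mul (a := (n : ℝ≥0∞))
      (ENNReal.tendsto_pow_atTop_nhds_zero_of_lt_one (r := 2⁻¹) (by norm_num))
      (Or.inr (by simp))
    simpa using this
  obtain ⟨t, ht⟩ := (hlim.eventually_le_const hρ0).exists
  refine ⟨toPowerSeries p, ⟨t, ne_top_of_le_ne_top (hmono _ ht) (wnorm_toPowerSeries_le p t)⟩, ?_⟩
  have hcont : Filter.Tendsto (fun x : Fin n → ℂ => (n : ℝ≥0∞) * ‖x‖ₑ) (𝓝 0) (𝓝 0) := by
    have := ENNReal.Tendsto.const_mul (a := (n : ℝ≥0∞))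
      ((continuous_enorm (E := Fin n → ℂ)).tendsto 0) (Or.inr (by simp))
    simpa using this
  filter_upwards [hcont.eventually_le_const hρ0, Metric.eball_mem_nhds (0 : Fin n → ℂ) hp.r_pos]
    with x hx hxr
  have := hp.hasSum hxr
  rw [zero_add] at this
  exact (hasSum_toPowerSeries (hmono _ hx) this).symm

end Expansion

/-! ### Germs as convergent series: a Noetherian local ring of depth at least n. -/

section GermIso

variable {n : ℕ}

theorem evalSeries_add_eventuallyEq {f g : MvPowerSeries (Fin n) ℂ}
    (hf : f ∈ convergentSeries n) (hg : g ∈ convergentSeries n) :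
    evalSeries (f + g) =ᶠ[𝓝 0] evalSeries f + evalSeries g := by
  obtain ⟨t, ht⟩ := hf
  obtain ⟨t', ht'⟩ := hg
  filter_upwards [eventually_enorm_le t, eventually_enorm_le t'] with x hx hx'
  rw [Pi.add_apply, evalSeries, evalSeries, evalSeries,
    ← (summable_norm_eval ht hx).of_norm.tsum_add (summable_norm_eval ht' hx').of_norm]
  simp [add_mul]

theorem coeff_mul_mul_monomialValue (f g : MvPowerSeries (Fin n) ℂ) (x : Fin n → ℂ)
    (α : Fin n →₀ ℕ) : MvPowerSeries.coeff α (f * g) * monomialValue x α =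
      ∑ p ∈ Finset.HasAntidiagonal.antidiagonal α, MvPowerSeries.coeff p.1 f *
        monomialValue x p.1 * (MvPowerSeries.coeff p.2 g * monomialValue x p.2) := by
  rw [MvPowerSeries.coeff_mul, Finset.sum_mul]
  refine Finset.sum_congr rfl fun p hp => ?_
  rw [← Finset.HasAntidiagonal.mem_antidiagonal.1 hp, monomialValue_add]
  ring

theorem evalSeries_mul {f g : MvPowerSeries (Fin n) ℂ} {x : Fin n → ℂ}
    (hf : Summable fun α => ‖MvPowerSeries.coeff α f * monomialValue x α‖)
    (hg : Summable fun α => ‖MvPowerSeries.coeff α g * monomialValue x α‖) :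
    evalSeries (f * g) x = evalSeries f x * evalSeries g x := by
  have h := summable_mul_of_summable_norm hf hg
  have hf' := hf.of_norm
  have hg' := hg.of_norm
  exact (tsum_congr (coeff_mul_mul_monomialValue f g x)).trans
    (Summable.tsum_mul_tsum_eq_tsum_sum_antidiagonal (A := Fin n →₀ ℕ) (α := ℂ)
      (f := fun α => MvPowerSeries.coeff α f * monomialValue x α)
      (g := fun α => MvPowerSeries.coeff α g * monomialValue x α) hf' hg' h).symm

theorem evalSeries_mul_eventuallyEq {f g : MvPowerSeries (Fin n) ℂ}
    (hf : f ∈ convergentSeries n) (hg : g ∈ convergentSeries n) :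
    evalSeries (f * g) =ᶠ[𝓝 0] evalSeries f * evalSeries g := by
  obtain ⟨t, ht⟩ := hf
  obtain ⟨t', ht'⟩ := hg
  filter_upwards [eventually_enorm_le t, eventually_enorm_le t'] with x hx hx'
  exact evalSeries_mul (summable_norm_eval ht hx) (summable_norm_eval ht' hx')

theorem evalSeries_one : evalSeries (1 : MvPowerSeries (Fin n) ℂ) = 1 := by
  classical
  funext x
  rw [evalSeries, tsum_eq_single 0]
  · simp [monomialValue]
  · intro α hα
    rw [MvPowerSeries.coeff_one, if_neg hα, zero_mul]

theorem evalSeries_zero_arg (f : MvPowerSeries (Fin n) ℂ) :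
    evalSeries f 0 = MvPowerSeries.constantCoeff f := by
  rw [evalSeries, tsum_eq_single 0]
  · simp [monomialValue]
  · intro α hα
    obtain ⟨i, hi⟩ := Finsupp.ne_iff.1 hα
    rw [monomialValue, Finsupp.prod, Finset.prod_eq_zero (Finsupp.mem_support_iff.2 hi), mul_zero]
    simp [show α i ≠ 0 from hi]

/-- The germ of a function analytic at the origin. -/
def holoGerm (f : (Fin n → ℂ) → ℂ) (hf : AnalyticAt ℂ f 0) : holoGerms n :=
  ⟨Filter.Germ.ofFun f, f, hf, rfl⟩

theorem holoGerm_eq_iff {f g : (Fin n → ℂ) → ℂ} {hf : AnalyticAt ℂ f 0} {hg : AnalyticAt ℂ g 0} :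
    holoGerm f hf = holoGerm g hg ↔ f =ᶠ[𝓝 0] g :=
  Subtype.ext_iff.trans Filter.Germ.coe_eq

theorem exists_holoGerm_eq (x : holoGerms n) : ∃ f hf, x = holoGerm f hf := by
  obtain ⟨_, f, hf, rfl⟩ := x
  exact ⟨f, hf, rfl⟩

/-- The germ of the sum of a convergent power series. -/
def germOfSeries : convergentSeries n →+* holoGerms n where
  toFun f := holoGerm (evalSeries (f : MvPowerSeries (Fin n) ℂ)) (analyticAt_evalSeries f.2)
  map_one' := (holoGerm_eq_iff (hg := analyticAt_const)).2 (by
    rw [Subring.coe_one, evalSeries_one]; rfl)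
  map_zero' := (holoGerm_eq_iff (hg := analyticAt_const)).2
    (Filter.Eventually.of_forall fun x => by simp [evalSeries])
  map_add' f g := (holoGerm_eq_iff (hg := (analyticAt_evalSeries f.2).add
    (analyticAt_evalSeries g.2))).2 (evalSeries_add_eventuallyEq f.2 g.2)
  map_mul' f g := (holoGerm_eq_iff (hg := (analyticAt_evalSeries f.2).mul
    (analyticAt_evalSeries g.2))).2 (evalSeries_mul_eventuallyEq f.2 g.2)

theorem germOfSeries_bijective : Function.Bijective (germOfSeries (n := n)) := by
  constructor
  · rw [injective_iff_map_eq_zero]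
    intro f hf
    refine Subtype.ext (eq_zero_of_evalSeries_eventuallyEq f.2 ?_)
    exact (holoGerm_eq_iff (hf := analyticAt_evalSeries f.2) (hg := analyticAt_const)).1 hf
  · intro x
    obtain ⟨f, hf, rfl⟩ := exists_holoGerm_eq x
    obtain ⟨g, hg, h⟩ := exists_evalSeries_eventuallyEq hf
    exact ⟨⟨g, hg⟩, (holoGerm_eq_iff (hf := analyticAt_evalSeries hg)).2 h⟩

variable (n) in
/-- Germs of holomorphic functions are convergent power series. -/
def germEquiv : convergentSeries n ≃+* holoGerms n :=
  RingEquiv.ofBijective germOfSeries germOfSeries_bijective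

/-- Inversion is done on germs, where the reciprocal of a nonvanishing analytic function is
analytic; no estimate of a reciprocal series is needed. -/
theorem isUnit_of_constantCoeff_ne_zero {f : convergentSeries n}
    (hf : MvPowerSeries.constantCoeff (f : MvPowerSeries (Fin n) ℂ) ≠ 0) : IsUnit f := by
  rw [← MulEquiv.isUnit_map (germEquiv n)]
  have han := analyticAt_evalSeries f.2
  rw [← evalSeries_zero_arg] at hf
  refine IsUnit.of_mul_eq_one (holoGerm _ (han.inv hf))
    ((holoGerm_eq_iff (hf := han.mul (han.inv hf)) (hg := analyticAt_const)).2 ?_)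
  filter_upwards [han.continuousAt.eventually_ne hf] with x hx
  exact mul_inv_cancel₀ hx

instance isLocalRing_convergentSeries : IsLocalRing (convergentSeries n) := by
  let ev : convergentSeries n →+* ℂ := MvPowerSeries.constantCoeff.comp (convergentSeries n).subtype
  have : IsLocalHom ev := ⟨fun f hf => isUnit_of_constantCoeff_ne_zero hf.ne_zero⟩
  exact RingHom.domain_isLocalRing ev

theorem maximalIdeal_convergentSeries :
    IsLocalRing.maximalIdeal (convergentSeries n) = coordIdeal Finset.univ := by
  ext f
  rw [mem_coordIdeal_univ, IsLocalRing.mem_maximalIdeal, mem_nonunits_iff]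
  constructor
  · intro h
    by_contra h0
    exact h (isUnit_of_constantCoeff_ne_zero h0)
  · intro h hu
    have := hu.map (MvPowerSeries.constantCoeff.comp (convergentSeries n).subtype)
    exact this.ne_zero h

instance isNoetherianRing_holoGerms : IsNoetherianRing (holoGerms n) :=
  isNoetherianRing_of_ringEquiv _ (germEquiv n)

instance isLocalRing_holoGerms : IsLocalRing (holoGerms n) := (germEquiv n).isLocalRing

theorem RegularSeqMod.map {R S : Type*} [CommRing R] [CommRing S] (e : R ≃+* S) (ys : List R) :
    ∀ {J : Ideal R}, RegularSeqMod J ys → RegularSeqMod (J.map e) (ys.map e) := by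
  induction ys with
  | nil => intro J _; trivial
  | cons y ys ih =>
    rintro J ⟨h1, h2⟩
    refine ⟨fun r hr => ?_, ?_⟩
    · obtain ⟨r, rfl⟩ := e.surjective r
      rw [← map_mul, Ideal.mem_map_of_equiv] at hr
      obtain ⟨x, hx, hxe⟩ := hr
      rw [e.injective hxe] at hx
      exact Ideal.mem_map_of_mem _ (h1 r hx)
    · have := ih h2
      rwa [Ideal.map_sup, Ideal.map_span, Set.image_singleton] at this

theorem depthGE_maximalIdeal_holoGerms :
    DepthGE (IsLocalRing.maximalIdeal (holoGerms n)) ⊥ n := by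
  obtain ⟨ys, hl, hm, hr⟩ := depthGE_coordIdeal_univ (n := n)
  refine ⟨ys.map (germEquiv n), by simpa using hl, ?_, ?_⟩
  · intro y hy
    obtain ⟨x, hx, rfl⟩ := List.mem_map.1 hy
    have hx' := hm x hx
    rw [← maximalIdeal_convergentSeries, IsLocalRing.mem_maximalIdeal, mem_nonunits_iff] at hx'
    rw [IsLocalRing.mem_maximalIdeal, mem_nonunits_iff]
    rwa [MulEquiv.isUnit_map]
  · have := hr.map (germEquiv n)
    rwa [Ideal.map_bot] at this

end GermIso

end

/-! ### Contractions in the exterior algebra and minors. -/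

section Contraction

variable {R : Type u} [CommRing R] {V : Type u} [AddCommGroup V] [Module R V]

/-- The contraction of the exterior algebra by a linear form. -/
def contr : Module.Dual R V →ₗ[R] Module.End R (ExteriorAlgebra R V) :=
  CliffordAlgebra.contractLeft (Q := (0 : QuadraticForm R V))

theorem contr_ι_mul (d : Module.Dual R V) (v : V) (x : ExteriorAlgebra R V) :
    contr d (ExteriorAlgebra.ι R v * x) = d v • x - ExteriorAlgebra.ι R v * contr d x :=
  CliffordAlgebra.contractLeft_ι_mul d v x

theorem contr_algebraMap (d : Module.Dual R V) (r : R) :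
    contr d (algebraMap R (ExteriorAlgebra R V) r) = 0 :=
  CliffordAlgebra.contractLeft_algebraMap _ d r

theorem contr_contr_self (d : Module.Dual R V) (x : ExteriorAlgebra R V) :
    contr d (contr d x) = 0 :=
  CliffordAlgebra.contractLeft_contractLeft d x

theorem contr_comm (d d' : Module.Dual R V) (x : ExteriorAlgebra R V) :
    contr d (contr d' x) = -contr d' (contr d x) :=
  CliffordAlgebra.contractLeft_comm d d' x

theorem contr_ιMulti (d : Module.Dual R V) (m : ℕ) (v : Fin (m + 1) → V) :
    contr d (ExteriorAlgebra.ιMulti R (m + 1) v) =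
      ∑ l : Fin (m + 1), ((-1) ^ (l : ℕ) * d (v l)) •
        ExteriorAlgebra.ιMulti R m (v ∘ l.succAbove) :=
  contractLeft_ιMulti d m v

theorem exists_algebraMap_of_mem_zero {x : ExteriorAlgebra R V} (hx : x ∈ ⋀[R]^0 V) :
    ∃ r, x = algebraMap R _ r := by
  change x ∈ LinearMap.range (ExteriorAlgebra.ι R) ^ 0 at hx
  rw [pow_zero, Submodule.mem_one] at hx
  obtain ⟨r, rfl⟩ := hx
  exact ⟨r, rfl⟩

theorem contr_mem (d : Module.Dual R V) (m : ℕ) {x : ExteriorAlgebra R V}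
    (hx : x ∈ ⋀[R]^m V) : contr d x ∈ ⋀[R]^(m - 1) V := by
  cases m with
  | zero =>
    obtain ⟨r, rfl⟩ := exists_algebraMap_of_mem_zero hx
    rw [contr_algebraMap]
    exact zero_mem _
  | succ m => exact contractLeft_mem d m hx

theorem ι_mul_mem (v : V) (m : ℕ) {x : ExteriorAlgebra R V} (hx : x ∈ ⋀[R]^m V) :
    ExteriorAlgebra.ι R v * x ∈ ⋀[R]^(m + 1) V := by
  change _ ∈ LinearMap.range (ExteriorAlgebra.ι R) ^ (m + 1)
  rw [pow_succ']
  exact Submodule.mul_mem_mul (LinearMap.mem_range_self _ _) hx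

theorem ι_mul_contr_mem (v : V) (d : Module.Dual R V) (m : ℕ) {x : ExteriorAlgebra R V}
    (hx : x ∈ ⋀[R]^m V) : ExteriorAlgebra.ι R v * contr d x ∈ ⋀[R]^m V := by
  cases m with
  | zero =>
    obtain ⟨r, rfl⟩ := exists_algebraMap_of_mem_zero hx
    rw [contr_algebraMap, mul_zero]
    exact zero_mem _
  | succ m => exact ι_mul_mem v m (contractLeft_mem d m hx)

variable (R V) in
/-- The action of the exterior algebra of the dual by contractions. -/
def contrAlg : ExteriorAlgebra R (Module.Dual R V) →ₐ[R] Module.End R (ExteriorAlgebra R V) :=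
  ExteriorAlgebra.lift R ⟨contr, fun d => LinearMap.ext fun x => contr_contr_self d x⟩

theorem contrAlg_ι (d : Module.Dual R V) : contrAlg R V (ExteriorAlgebra.ι R d) = contr d :=
  ExteriorAlgebra.lift_ι_apply R _ _ d

theorem ιMulti_mul_ι {W : Type*} [AddCommGroup W] [Module R W] (m : ℕ) (v : Fin (m + 1) → W) :
    ExteriorAlgebra.ιMulti R m (fun i => v i.castSucc) * ExteriorAlgebra.ι R (v (Fin.last m)) =
      ExteriorAlgebra.ιMulti R (m + 1) v := by
  rw [ExteriorAlgebra.ιMulti_apply, ExteriorAlgebra.ιMulti_apply, List.ofFn_succ',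
    List.concat_eq_append, List.prod_append]
  simp

theorem contrAlg_ιMulti_succ (m : ℕ) (d : Fin (m + 1) → Module.Dual R V)
    (x : ExteriorAlgebra R V) : contrAlg R V (ExteriorAlgebra.ιMulti R (m + 1) d) x =
      contrAlg R V (ExteriorAlgebra.ιMulti R m fun i => d i.castSucc) (contr (d (Fin.last m)) x) := by
  rw [← ιMulti_mul_ι, map_mul, contrAlg_ι]
  rfl

/-- The iterated contraction of a product of vectors is a determinant, up to a sign depending only
on the degree. -/
theorem exists_contrAlg_ιMulti_eq_det (m : ℕ) : ∃ ε : ℤˣ, ∀ (d : Fin m → Module.Dual R V)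
    (v : Fin m → V), contrAlg R V (ExteriorAlgebra.ιMulti R m d) (ExteriorAlgebra.ιMulti R m v) =
      algebraMap R _ (((ε : ℤ) : R) * Matrix.det (Matrix.of fun i j => d i (v j))) := by
  induction m with
  | zero => exact ⟨1, fun d v => by simp⟩
  | succ m ih =>
    obtain ⟨ε, hε⟩ := ih
    -- The last form contracts first, so the recursion is Laplace expansion along the last row; its
    -- index m accounts for the extra sign.
    refine ⟨ε * (-1) ^ m, fun d v => ?_⟩
    rw [contrAlg_ιMulti_succ, contr_ιMulti, map_sum, Matrix.det_succ_row _ (Fin.last m),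
      Finset.mul_sum, map_sum]
    refine Finset.sum_congr rfl fun l _ => ?_
    rw [map_smul, hε, Algebra.smul_def, ← map_mul]
    congr 1
    have e : (Matrix.of fun i j => d i (v j)).submatrix (Fin.last m).succAbove l.succAbove =
        Matrix.of fun (i j : Fin m) => d i.castSucc ((v ∘ l.succAbove) j) := by
      ext i j; simp
    rw [e]
    have hs : ((-1 : R) ^ m) * (-1) ^ m = 1 := by rw [← mul_pow]; simp
    simp only [Matrix.of_apply, Fin.val_last, Units.val_mul, Units.val_pow_eq_pow_val,
      Units.val_neg, Units.val_one, Int.cast_mul, Int.cast_pow, Int.cast_neg, Int.cast_one, pow_add]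
    linear_combination (-((-1) ^ (l : ℕ) * d (Fin.last m) (v l) * ((ε : ℤ) : R) *
      Matrix.det (Matrix.of fun (i j : Fin m) => d i.castSucc ((v ∘ l.succAbove) j)))) * hs

end Contraction

section MatrixContraction

variable {R : Type u} [CommRing R] {s r : ℕ}

/-- The linear form given by a row of a matrix. -/
def rowForm (M : Matrix (Fin s) (Fin r) R) (t : Fin s) : Module.Dual R (Fin r → R) :=
  LinearMap.proj t ∘ₗ M.mulVecLin

theorem rowForm_apply (M : Matrix (Fin s) (Fin r) R) (t : Fin s) (v : Fin r → R) :
    rowForm M t v = M.mulVec v t := rfl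

/-- The minor form is the contraction by all rows. -/
theorem exists_contrAlg_rowForm_eq_minorForm : ∃ ε : ℤˣ, ∀ (M : Matrix (Fin s) (Fin r) R)
    (x : ⋀[R]^s (Fin r → R)), contrAlg R (Fin r → R) (ExteriorAlgebra.ιMulti R s (rowForm M)) x =
      algebraMap R _ (((ε : ℤ) : R) * minorForm M x) := by
  obtain ⟨ε, hε⟩ := exists_contrAlg_ιMulti_eq_det (R := R) (V := Fin r → R) s
  refine ⟨ε, fun M x => ?_⟩
  have : (contrAlg R (Fin r → R) (ExteriorAlgebra.ιMulti R s (rowForm M))) ∘ₗ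
      (⋀[R]^s (Fin r → R)).subtype =
      Algebra.linearMap R (ExteriorAlgebra R (Fin r → R)) ∘ₗ (((ε : ℤ) : R) • minorForm M) := by
    refine exteriorPower.linearMap_ext (AlternatingMap.ext fun v => ?_)
    have h2 : ((minorForm M) (exteriorPower.ιMulti R s v)) =
        Matrix.det (Matrix.of fun i j => rowForm M i (v j)) := by
      rw [minorForm_ιMulti, ← Matrix.det_transpose]
      rfl
    refine (hε (rowForm M) v).trans ?_
    rw [← h2]
    rfl
  exact LinearMap.congr_fun this x

end MatrixContraction

/-! ### The number operator and its falling products. -/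

section FallingOperators

variable {R : Type u} [CommRing R] {V : Type u} [AddCommGroup V] [Module R V] {s : ℕ}

/-- The operator `∑ₜ bₜ ∧ (cₜ ⌟ ·)` on the exterior algebra. -/
def numberOp (b : Fin s → V) (c : Fin s → Module.Dual R V) :
    Module.End R (ExteriorAlgebra R V) :=
  ∑ t, LinearMap.mulLeft R (ExteriorAlgebra.ι R (b t)) ∘ₗ contr (c t)

theorem numberOp_apply (b : Fin s → V) (c : Fin s → Module.Dual R V) (x : ExteriorAlgebra R V) :
    numberOp b c x = ∑ t, ExteriorAlgebra.ι R (b t) * contr (c t) x := by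
  simp [numberOp, LinearMap.sum_apply]

/-- The product `N (N - Δ) ⋯ (N - (p - 1) Δ)`, where `N` is the number operator. -/
def fallingOp (b : Fin s → V) (c : Fin s → Module.Dual R V) (Δ : R) :
    ℕ → Module.End R (ExteriorAlgebra R V)
  | 0 => 1
  | p + 1 => fallingOp b c Δ p * (numberOp b c - (p * Δ) • 1)

theorem fallingOp_succ_apply (b : Fin s → V) (c : Fin s → Module.Dual R V) (Δ : R) (p : ℕ)
    (x : ExteriorAlgebra R V) : fallingOp b c Δ (p + 1) x =
      fallingOp b c Δ p (numberOp b c x - (p * Δ) • x) := rfl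

theorem numberOp_mem (b : Fin s → V) (c : Fin s → Module.Dual R V) (m : ℕ)
    {x : ExteriorAlgebra R V} (hx : x ∈ ⋀[R]^m V) : numberOp b c x ∈ ⋀[R]^m V := by
  rw [numberOp_apply]
  exact Submodule.sum_mem _ fun t _ => ι_mul_contr_mem _ _ _ hx

theorem fallingOp_mem (b : Fin s → V) (c : Fin s → Module.Dual R V) (Δ : R) (p m : ℕ) :
    ∀ {x : ExteriorAlgebra R V}, x ∈ ⋀[R]^m V → fallingOp b c Δ p x ∈ ⋀[R]^m V := by
  induction p with
  | zero => intro x hx; exact hx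
  | succ p ih =>
    intro x hx
    exact ih (Submodule.sub_mem _ (numberOp_mem b c m hx) (Submodule.smul_mem _ _ hx))

variable {b : Fin s → V} {c : Fin s → Module.Dual R V} {Δ : R}

/-- Contraction by c_t behaves like an annihilation operator: it lowers the eigenvalue of N by Δ. -/
theorem contr_numberOp (h : ∀ t u, c t (b u) = if t = u then Δ else 0) (t : Fin s)
    (x : ExteriorAlgebra R V) :
    numberOp b c (contr (c t) x) = contr (c t) (numberOp b c x) - Δ • contr (c t) x := by
  rw [numberOp_apply, numberOp_apply, map_sum]
  simp only [contr_ι_mul, h, ite_smul, zero_smul, Finset.sum_sub_distrib, Finset.sum_ite_eq,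
    Finset.mem_univ, if_true]
  rw [sub_right_comm, sub_self, zero_sub, ← Finset.sum_neg_distrib]
  refine Finset.sum_congr rfl fun u _ => ?_
  rw [contr_comm, mul_neg]

/-- Normal ordering: the shift by Δ in `contr_numberOp` is exactly what the falling factors
compensate, so all contractions can be moved to act first. -/
theorem fallingOp_succ_apply_eq_sum (h : ∀ t u, c t (b u) = if t = u then Δ else 0) (p : ℕ) :
    ∀ x : ExteriorAlgebra R V, fallingOp b c Δ (p + 1) x =
      ∑ t, ExteriorAlgebra.ι R (b t) * fallingOp b c Δ p (contr (c t) x) := by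
  induction p with
  | zero =>
    intro x
    simp [fallingOp, numberOp_apply]
  | succ p ih =>
    intro x
    rw [fallingOp_succ_apply, ih]
    refine Finset.sum_congr rfl fun t _ => ?_
    rw [fallingOp_succ_apply, contr_numberOp h, map_sub, map_smul]
    congr 2
    push_cast
    module

-- By iteration, every term of the p-fold product starts with p contractions by the c_t. Of the left
-- factor only the degree is recorded, which suffices for p = s + 1 and p = s below.
variable (b c Δ) in
theorem fallingOp_mem_span (h : ∀ t u, c t (b u) = if t = u then Δ else 0) (p : ℕ) :
    fallingOp b c Δ p ∈ Submodule.span R {f : Module.End R (ExteriorAlgebra R V) |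
      ∃ β ∈ ⋀[R]^p V, ∃ T : Fin p → Fin s,
        f = LinearMap.mulLeft R β ∘ₗ contrAlg R V (ExteriorAlgebra.ιMulti R p (c ∘ T))} := by
  induction p with
  | zero =>
    refine Submodule.subset_span ⟨1, ?_, Fin.elim0, ?_⟩
    · change (1 : ExteriorAlgebra R V) ∈ LinearMap.range (ExteriorAlgebra.ι R) ^ 0
      rw [pow_zero]
      exact Submodule.one_le.1 le_rfl
    · refine LinearMap.ext fun x => ?_
      simp [fallingOp]
  | succ p ih =>
    have e : fallingOp b c Δ (p + 1) = ∑ t, LinearMap.mulLeft R (ExteriorAlgebra.ι R (b t)) ∘ₗ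
        fallingOp b c Δ p ∘ₗ contr (c t) := by
      refine LinearMap.ext fun x => ?_
      rw [fallingOp_succ_apply_eq_sum h]
      simp [LinearMap.sum_apply]
    rw [e]
    refine Submodule.sum_mem _ fun t _ => ?_
    generalize fallingOp b c Δ p = f at ih
    induction ih using Submodule.span_induction with
    | mem f hf =>
      obtain ⟨β, hβ, T, rfl⟩ := hf
      refine Submodule.subset_span ⟨ExteriorAlgebra.ι R (b t) * β, ι_mul_mem _ _ hβ,
        Fin.snoc T t, ?_⟩
      refine LinearMap.ext fun x => ?_
      have := contrAlg_ιMulti_succ p (c ∘ (Fin.snoc T t : Fin (p + 1) → Fin s)) x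
      simp only [Function.comp_apply, Fin.snoc_castSucc, Fin.snoc_last] at this
      simp only [LinearMap.comp_apply, LinearMap.mulLeft_apply, this, mul_assoc]
      rfl
    | zero => simp
    | add f g _ _ hf hg =>
      rw [LinearMap.add_comp, LinearMap.comp_add]
      exact add_mem hf hg
    | smul a f _ hf =>
      rw [LinearMap.smul_comp, LinearMap.comp_smul]
      exact Submodule.smul_mem _ _ hf

/-- Among s + 1 forms taken from c_1, …, c_s two coincide. -/
theorem fallingOp_succ_card_eq_zero (h : ∀ t u, c t (b u) = if t = u then Δ else 0) :
    fallingOp b c Δ (s + 1) = 0 := by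
  have hmem := fallingOp_mem_span b c Δ h (s + 1)
  refine (Submodule.mem_bot R).1 ((Submodule.span_le.2 ?_) hmem)
  rintro f ⟨β, -, T, rfl⟩
  have hT : ¬ Function.Injective T := fun hi => by
    simpa using Fintype.card_le_of_injective T hi
  rw [ExteriorAlgebra.ιMulti_eq_zero_of_not_inj fun hi => hT fun i j hij => hi (by simp [hij])]
  simp

end FallingOperators

section MinorForm

variable {R : Type u} [CommRing R] {s r : ℕ}

/-- Only permutations of the s rows survive, and on ⋀^s each of them contracts to the scalar ± the
minor form. So in this degree the operator factors through the minor form. -/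
theorem exists_fallingOp_eq_minorForm_smul {M : Matrix (Fin s) (Fin r) R} {b : Fin s → Fin r → R}
    {Δ : R} (h : ∀ t u, rowForm M t (b u) = if t = u then Δ else 0) :
    ∃ w ∈ ⋀[R]^s (Fin r → R), ∀ x : ⋀[R]^s (Fin r → R),
      fallingOp b (rowForm M) Δ s x = minorForm M x • w := by
  obtain ⟨ε, hε⟩ := exists_contrAlg_rowForm_eq_minorForm (R := R) (s := s) (r := r)
  have hmem := fallingOp_mem_span b (rowForm M) Δ h s
  generalize fallingOp b (rowForm M) Δ s = f at hmem
  induction hmem using Submodule.span_induction with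
  | mem f hf =>
    obtain ⟨β, hβ, T, rfl⟩ := hf
    by_cases hT : Function.Injective T
    · let σ : Equiv.Perm (Fin s) := Equiv.ofBijective T (Finite.injective_iff_bijective.1 hT)
      refine ⟨(((Equiv.Perm.sign σ : ℤˣ) : ℤ) * ((ε : ℤ) : R)) • β, Submodule.smul_mem _ _ hβ,
        fun x => ?_⟩
      have e : ExteriorAlgebra.ιMulti R s (rowForm M ∘ T) =
          Equiv.Perm.sign σ • ExteriorAlgebra.ιMulti R s (rowForm M) :=
        (ExteriorAlgebra.ιMulti R s).map_perm (rowForm M) σ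
      have e2 : ExteriorAlgebra.ιMulti R s (rowForm M ∘ T) =
          (((Equiv.Perm.sign σ : ℤˣ) : ℤ) : R) • ExteriorAlgebra.ιMulti R s (rowForm M) := by
        rw [e, Units.smul_def, Int.cast_smul_eq_zsmul]
      rw [LinearMap.comp_apply, LinearMap.mulLeft_apply, e2, map_smul, LinearMap.smul_apply, hε,
        Algebra.algebraMap_eq_smul_one]
      simp only [mul_smul_comm, mul_one, smul_smul]
      congr 1
      ring
    · refine ⟨0, zero_mem _, fun x => ?_⟩
      rw [ExteriorAlgebra.ιMulti_eq_zero_of_not_inj fun hi => hT fun i j hij =>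
        hi (by simp [hij])]
      simp
  | zero => exact ⟨0, zero_mem _, fun x => by simp⟩
  | add f g _ _ hf hg =>
    obtain ⟨w, hw, h1⟩ := hf
    obtain ⟨w', hw', h2⟩ := hg
    exact ⟨w + w', add_mem hw hw', fun x => by rw [LinearMap.add_apply, h1, h2, smul_add]⟩
  | smul a f _ hf =>
    obtain ⟨w, hw, h1⟩ := hf
    exact ⟨a • w, Submodule.smul_mem _ _ hw, fun x => by
      rw [LinearMap.smul_apply, h1, smul_comm]⟩

/-- For each maximal minor `Δ` there are vectors on which the rows take the values `Δ δ_{tu}`. -/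
theorem exists_rowForm_eq_det (M : Matrix (Fin s) (Fin r) R) (i : Fin s → Fin r) :
    ∃ b : Fin s → Fin r → R, ∀ t u, rowForm M t (b u) =
      if t = u then (M.submatrix id i).det else 0 := by
  let A := M.submatrix id i
  -- b_u is the u-th column of the adjugate of the chosen square submatrix, placed at the positions
  -- i.
  refine ⟨fun u => ∑ a, A.adjugate a u • Pi.single (i a) 1, fun t u => ?_⟩
  have h := congrFun (congrFun (Matrix.mul_adjugate A) t) u
  rw [Matrix.mul_apply, Matrix.smul_apply, Matrix.one_apply, smul_eq_mul, mul_ite, mul_one,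
    mul_zero] at h
  rw [← h, map_sum]
  refine Finset.sum_congr rfl fun a _ => ?_
  rw [map_smul, rowForm_apply, Matrix.mulVec_single_one, smul_eq_mul, mul_comm]
  rfl

end MinorForm

/-! ### Multiplication and differentiation on the polynomial factor. -/

section SymOperators

variable (R : Type u) [CommRing R] (s : ℕ)

/-- Multiplication by `u_l` from `S^j W` to `S^{j+1} W`. -/
def mulXSym (j : ℕ) (l : Fin s) : Sym R s j →ₗ[R] Sym R s (j + 1) :=
  (LinearMap.mulRight R (MvPolynomial.X l : MvPolynomial (Fin s) R)).restrict
    (fun _ hp => MvPolynomial.IsHomogeneous.mul hp (MvPolynomial.isHomogeneous_X R l))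

variable {R s}

theorem exists_eq_C (φ : Sym R s 0) : ∃ r, (φ : MvPolynomial (Fin s) R) = MvPolynomial.C r :=
  ⟨_, MvPolynomial.totalDegree_eq_zero_iff_eq_C.1
    ((MvPolynomial.totalDegree_zero_iff_isHomogeneous (Fin s)).2 φ.2)⟩

theorem coe_ite_sym (j : ℕ) (p : Prop) [Decidable p] (φ : Sym R s j) :
    ((if p then φ else 0 : Sym R s j) : MvPolynomial (Fin s) R) =
      if p then (φ : MvPolynomial (Fin s) R) else 0 := by
  split_ifs <;> rfl

theorem pderiv_mul_X (t l : Fin s) (p : MvPolynomial (Fin s) R) :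
    MvPolynomial.pderiv t (p * MvPolynomial.X l) =
      MvPolynomial.pderiv t p * MvPolynomial.X l + if t = l then p else 0 := by
  rw [MvPolynomial.pderiv_mul]
  by_cases h : t = l
  · subst h; rw [MvPolynomial.pderiv_X_self, mul_one, if_pos rfl]
  · rw [if_neg h, MvPolynomial.pderiv_X_of_ne (Ne.symm h), mul_zero]

theorem partialSym_mulXSym_zero (t l : Fin s) (φ : Sym R s 0) :
    partialSym R s 0 t (mulXSym R s 0 l φ) = if t = l then φ else 0 := by
  obtain ⟨r, hr⟩ := exists_eq_C φ
  refine Subtype.ext ?_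
  rw [coe_ite_sym]
  refine (pderiv_mul_X t l (φ : MvPolynomial (Fin s) R)).trans ?_
  rw [hr, MvPolynomial.pderiv_C, zero_mul, zero_add]

theorem partialSym_mulXSym_succ (j : ℕ) (t l : Fin s) (φ : Sym R s (j + 1)) :
    partialSym R s (j + 1) t (mulXSym R s (j + 1) l φ) =
      mulXSym R s j l (partialSym R s j t φ) + if t = l then φ else 0 := by
  refine Subtype.ext ?_
  rw [Submodule.coe_add, coe_ite_sym]
  exact pderiv_mul_X t l (φ : MvPolynomial (Fin s) R)

/-- Euler's identity; it supplies the polynomial degree in the homotopy formula. -/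
theorem sum_mulXSym_partialSym (j : ℕ) (φ : Sym R s (j + 1)) :
    ∑ t, mulXSym R s j t (partialSym R s j t φ) = ((j + 1 : ℕ) : R) • φ := by
  refine Subtype.ext ?_
  have h := MvPolynomial.IsHomogeneous.sum_X_mul_pderiv φ.2
  rw [Submodule.coe_sum, Submodule.coe_smul, Nat.cast_smul_eq_nsmul, ← h]
  exact Finset.sum_congr rfl fun t _ => mul_comm _ _

theorem eq_constSym_smul (φ : Sym R s 0) :
    φ = constSym R s φ • ⟨1, MvPolynomial.isHomogeneous_one (Fin s) R⟩ := by
  obtain ⟨r, hr⟩ := exists_eq_C φ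
  refine Subtype.ext ?_
  change (φ : MvPolynomial (Fin s) R) = MvPolynomial.coeff 0 (φ : MvPolynomial (Fin s) R) • 1
  rw [hr, MvPolynomial.coeff_zero_C, MvPolynomial.smul_eq_C_mul, mul_one]

end SymOperators

/-! ### The homotopy formula for the Eagon–Northcott differentials. -/

section Homotopy

variable {R : Type u} [CommRing R] {s r : ℕ}

/-- Left multiplication `⋀^m V → ⋀^{m+1} V` by a vector. -/
def wedgeVec {V : Type u} [AddCommGroup V] [Module R V] (v : V) (m : ℕ) :
    ⋀[R]^m V →ₗ[R] ⋀[R]^(m + 1) V :=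
  (LinearMap.mulLeft R (ExteriorAlgebra.ι R v)).restrict fun _ hx => ι_mul_mem v m hx

/-- The number operator on `⋀^m V`. -/
def numberEnd {V : Type u} [AddCommGroup V] [Module R V] (b : Fin s → V)
    (c : Fin s → Module.Dual R V) (m : ℕ) : Module.End R (⋀[R]^m V) :=
  (numberOp b c).restrict fun _ hx => numberOp_mem b c m hx

/-- The falling product of the number operator on `⋀^m V`. -/
def fallingEnd {V : Type u} [AddCommGroup V] [Module R V] (b : Fin s → V)
    (c : Fin s → Module.Dual R V) (Δ : R) (p m : ℕ) : Module.End R (⋀[R]^m V) :=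
  (fallingOp b c Δ p).restrict fun _ hx => fallingOp_mem b c Δ p m hx

/-- The homotopy `∑ₗ (bₗ ∧ ·) ⊗ uₗ`. -/
def polyHomotopy {V : Type u} [AddCommGroup V] [Module R V] (b : Fin s → V) (m j : ℕ) :
    ⋀[R]^m V ⊗[R] Sym R s j →ₗ[R] ⋀[R]^(m + 1) V ⊗[R] Sym R s (j + 1) :=
  ∑ l, TensorProduct.map (wedgeVec (b l) m) (mulXSym R s j l)

variable {M : Matrix (Fin s) (Fin r) R} {b : Fin s → Fin r → R} {Δ : R}

theorem contractRow_wedgeVec_zero (h : ∀ t u, rowForm M t (b u) = if t = u then Δ else 0)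
    (t l : Fin s) (a : ⋀[R]^0 (Fin r → R)) :
    contractRow M t 0 (wedgeVec (b l) 0 a) = if t = l then Δ • a else 0 := by
  refine Subtype.ext ?_
  obtain ⟨x, hx⟩ := exists_algebraMap_of_mem_zero a.2
  refine (contr_ι_mul (rowForm M t) (b l) (a : ExteriorAlgebra R (Fin r → R))).trans ?_
  rw [h, hx, contr_algebraMap, mul_zero, sub_zero]
  split_ifs <;> simp [← hx]

theorem contractRow_wedgeVec_succ (h : ∀ t u, rowForm M t (b u) = if t = u then Δ else 0)
    (m : ℕ) (t l : Fin s) (a : ⋀[R]^(m + 1) (Fin r → R)) :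
    contractRow M t (m + 1) (wedgeVec (b l) (m + 1) a) =
      (if t = l then Δ • a else 0) - wedgeVec (b l) m (contractRow M t m a) := by
  refine Subtype.ext ?_
  refine (contr_ι_mul (rowForm M t) (b l) (a : ExteriorAlgebra R (Fin r → R))).trans ?_
  rw [h, Submodule.coe_sub]
  congr 1
  split_ifs <;> simp

theorem numberEnd_eq_zero (a : ⋀[R]^0 (Fin r → R)) : numberEnd b (rowForm M) 0 a = 0 := by
  refine Subtype.ext ?_
  obtain ⟨x, hx⟩ := exists_algebraMap_of_mem_zero a.2
  change numberOp b (rowForm M) a = 0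
  simp [numberOp_apply, hx, contr_algebraMap]

theorem numberEnd_eq_sum (m : ℕ) (a : ⋀[R]^(m + 1) (Fin r → R)) :
    numberEnd b (rowForm M) (m + 1) a = ∑ t, wedgeVec (b t) m (contractRow M t m a) := by
  refine Subtype.ext ?_
  rw [Submodule.coe_sum]
  exact numberOp_apply _ _ _

/-- Moving each contraction past its own b_t produces Δ once for each of the s indices. -/
theorem sum_contractRow_wedgeVec (h : ∀ t u, rowForm M t (b u) = if t = u then Δ else 0)
    (m : ℕ) (a : ⋀[R]^m (Fin r → R)) :
    ∑ t, contractRow M t m (wedgeVec (b t) m a) =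
      ((s : R) * Δ) • a - numberEnd b (rowForm M) m a := by
  cases m with
  | zero =>
    rw [numberEnd_eq_zero, sub_zero]
    simp only [contractRow_wedgeVec_zero h, if_true, Finset.sum_const, Finset.card_univ,
      Fintype.card_fin, mul_smul, Nat.cast_smul_eq_nsmul]
  | succ m =>
    simp only [contractRow_wedgeVec_succ h, if_true, Finset.sum_sub_distrib, numberEnd_eq_sum,
      Finset.sum_const, Finset.card_univ, Fintype.card_fin, mul_smul, Nat.cast_smul_eq_nsmul]

/-- On S^0W the derivatives vanish, so there is no second homotopy term and no contribution from
Euler's identity. -/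
theorem polyDiff_polyHomotopy_zero (h : ∀ t u, rowForm M t (b u) = if t = u then Δ else 0)
    (m : ℕ) (z : ⋀[R]^m (Fin r → R) ⊗[R] Sym R s 0) :
    polyDiff (fun t => contractRow M t m) 0 (polyHomotopy b m 0 z) =
      ((s : R) * Δ) • z - TensorProduct.map (numberEnd b (rowForm M) m) LinearMap.id z := by
  induction z using TensorProduct.induction_on with
  | zero => simp
  | add z w hz hw => simp only [map_add, smul_add, hz, hw]; abel
  | tmul a φ =>
    simp only [polyDiff, polyHomotopy, LinearMap.sum_apply, map_sum, TensorProduct.map_tmul,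
      partialSym_mulXSym_zero, LinearMap.id_apply]
    rw [Finset.sum_comm]
    simp only [TensorProduct.tmul_ite, Finset.sum_ite_eq, Finset.mem_univ, if_true]
    rw [← TensorProduct.sum_tmul, sum_contractRow_wedgeVec h, TensorProduct.sub_tmul,
      TensorProduct.smul_tmul']

/-- Contractions and multiplications by vectors anticommute while ∂/∂u_t and u_l commute, up to
terms with t = l. Of these, one kind gives (j + 1)Δ by Euler's identity, the other gives sΔ - N on
the exterior factor. -/
theorem polyDiff_polyHomotopy_succ (h : ∀ t u, rowForm M t (b u) = if t = u then Δ else 0)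
    (m j : ℕ) (z : ⋀[R]^(m + 1) (Fin r → R) ⊗[R] Sym R s (j + 1)) :
    polyDiff (fun t => contractRow M t (m + 1)) (j + 1) (polyHomotopy b (m + 1) (j + 1) z) +
        polyHomotopy b m j (polyDiff (fun t => contractRow M t m) j z) =
      (((j + 1 + s : ℕ) : R) * Δ) • z -
        TensorProduct.map (numberEnd b (rowForm M) (m + 1)) LinearMap.id z := by
  induction z using TensorProduct.induction_on with
  | zero => simp
  | add z w hz hw =>
    simp only [map_add, smul_add]
    rw [add_add_add_comm, hz, hw]
    abel
  | tmul a φ =>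
    have e1 : polyDiff (fun t => contractRow M t (m + 1)) (j + 1)
        (polyHomotopy b (m + 1) (j + 1) (a ⊗ₜ[R] φ)) =
        ∑ l, ∑ t, (contractRow M t (m + 1) (wedgeVec (b l) (m + 1) a)) ⊗ₜ[R]
          (mulXSym R s j l (partialSym R s j t φ)) +
        (∑ t, contractRow M t (m + 1) (wedgeVec (b t) (m + 1) a)) ⊗ₜ[R] φ := by
      simp only [polyDiff, polyHomotopy, LinearMap.sum_apply, map_sum, TensorProduct.map_tmul,
        partialSym_mulXSym_succ, TensorProduct.tmul_add, Finset.sum_add_distrib,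
        TensorProduct.tmul_ite, TensorProduct.sum_tmul]
      rw [Finset.sum_comm]
      congr 1
      simp
    have e2 : polyHomotopy b m j (polyDiff (fun t => contractRow M t m) j (a ⊗ₜ[R] φ)) =
        ∑ l, ∑ t, (wedgeVec (b l) m (contractRow M t m a)) ⊗ₜ[R]
          (mulXSym R s j l (partialSym R s j t φ)) := by
      simp only [polyDiff, polyHomotopy, LinearMap.sum_apply, map_sum, TensorProduct.map_tmul]
      rw [Finset.sum_comm]
    have e3 : ∑ l, ∑ t, (contractRow M t (m + 1) (wedgeVec (b l) (m + 1) a)) ⊗ₜ[R]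
          (mulXSym R s j l (partialSym R s j t φ)) +
        ∑ l, ∑ t, (wedgeVec (b l) m (contractRow M t m a)) ⊗ₜ[R]
          (mulXSym R s j l (partialSym R s j t φ)) = (((j + 1 : ℕ) : R) * Δ) • (a ⊗ₜ[R] φ) := by
      simp only [← Finset.sum_add_distrib, ← TensorProduct.add_tmul, contractRow_wedgeVec_succ h,
        sub_add_cancel, TensorProduct.ite_tmul, Finset.sum_ite_eq',
        Finset.mem_univ, if_true]
      rw [← TensorProduct.tmul_sum, sum_mulXSym_partialSym, TensorProduct.tmul_smul,
        TensorProduct.smul_tmul', smul_smul, TensorProduct.smul_tmul']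
    rw [e1, e2, add_right_comm, e3, sum_contractRow_wedgeVec h, TensorProduct.map_tmul,
      TensorProduct.sub_tmul, LinearMap.id_apply, ← add_sub_assoc, ← TensorProduct.smul_tmul',
      ← add_smul]
    push_cast
    ring_nf

end Homotopy

/-! ### Powers of the minors annihilate homology modulo an ideal. -/

section Annihilation

/-- If N acts on K as the scalar aΔ modulo B, then each factor N - qΔ acts as (a - q)Δ. -/
theorem fallingProduct_sub_mem {R : Type*} [CommRing R] {X : Type*} [AddCommGroup X] [Module R X]
    {N : Module.End R X} {F : ℕ → Module.End R X} {Δ a : R} {K B : Submodule R X}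
    (h0 : F 0 = 1) (hF : ∀ p z, F (p + 1) z = F p (N z - (p * Δ) • z))
    (hK : ∀ z ∈ K, N z ∈ K) (hB : ∀ z ∈ K, N z - (a * Δ) • z ∈ B) (p : ℕ) :
    ∀ z ∈ K, F p z - ((∏ q ∈ Finset.range p, (a - q)) * Δ ^ p) • z ∈ B := by
  induction p with
  | zero => intro z _; simp [h0]
  | succ p ih =>
    intro z hz
    have h1 := ih _ (K.sub_mem (hK z hz) (K.smul_mem (p * Δ) hz))
    have h2 := B.smul_mem ((∏ q ∈ Finset.range p, (a - q)) * Δ ^ p) (hB z hz)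
    have h3 := B.add_mem h1 h2
    rw [hF, Finset.prod_range_succ]
    convert h3 using 1
    module

theorem isUnit_prod_range_sub {R : Type*} [CommRing R] (hR : ∀ m : ℕ, m ≠ 0 → IsUnit (m : R))
    {a p : ℕ} (h : p ≤ a) : IsUnit (∏ q ∈ Finset.range p, ((a : R) - q)) := by
  refine IsUnit.prod_iff.2 fun q hq => ?_
  have hq' := Finset.mem_range.1 hq
  rw [← Nat.cast_sub (by omega)]
  exact hR _ (by omega)

theorem map_mem_smul_top {R : Type*} [CommRing R] {X Y : Type*} [AddCommGroup X] [Module R X]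
    [AddCommGroup Y] [Module R Y] (f : X →ₗ[R] Y) {J : Ideal R} {z : X}
    (hz : z ∈ J • (⊤ : Submodule R X)) : f z ∈ J • (⊤ : Submodule R Y) := by
  have h := Submodule.mem_map_of_mem (f := f) hz
  rw [Submodule.map_smul''] at h
  exact Submodule.smul_mono le_rfl le_top h

/-- On cycles modulo J the homotopy formula makes N equal to aΔ up to boundaries. For p ≤ a the
scalars a - q with q < p are positive integers, hence units, and only the power of Δ is left. -/
theorem pow_smul_mem_range_sup {R : Type*} [CommRing R] {X Y W : Type*} [AddCommGroup X]
    [Module R X] [AddCommGroup Y] [Module R Y] [AddCommGroup W] [Module R W]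
    (hR : ∀ m : ℕ, m ≠ 0 → IsUnit (m : R)) {d₁ : Y →ₗ[R] X} {d₀ : X →ₗ[R] W} {h₁ : X →ₗ[R] Y}
    {h₀ : W →ₗ[R] X} {N : Module.End R X} {F : ℕ → Module.End R X} {Δ : R} {a p : ℕ}
    (hd : d₀ ∘ₗ d₁ = 0) (hN : ∀ z, d₁ (h₁ z) + h₀ (d₀ z) = ((a : R) * Δ) • z - N z)
    (h0 : F 0 = 1) (hF : ∀ p z, F (p + 1) z = F p (N z - (p * Δ) • z)) (hpa : p ≤ a)
    {J : Ideal R} {z : X} (hz : d₀ z ∈ J • (⊤ : Submodule R W))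
    (hFz : F p z ∈ LinearMap.range d₁ ⊔ J • ⊤) :
    Δ ^ p • z ∈ LinearMap.range d₁ ⊔ J • ⊤ := by
  have hN' : ∀ z, N z = ((a : R) * Δ) • z - (d₁ (h₁ z) + h₀ (d₀ z)) := fun z => by
    rw [hN, sub_sub_cancel]
  have hd' : ∀ y, d₀ (d₁ y) = 0 := fun y => LinearMap.congr_fun hd y
  have h1 := fallingProduct_sub_mem (a := (a : R)) (Δ := Δ)
    (K := (J • (⊤ : Submodule R W)).comap d₀) (B := LinearMap.range d₁ ⊔ J • ⊤) h0 hF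
    (fun z hz => by
      rw [Submodule.mem_comap] at hz ⊢
      rw [hN', map_sub, map_add, map_smul, hd', zero_add]
      exact Submodule.sub_mem _ (Submodule.smul_mem _ _ hz)
        (map_mem_smul_top _ (map_mem_smul_top _ hz)))
    (fun z hz => by
      rw [hN', sub_right_comm, sub_self, zero_sub]
      exact Submodule.neg_mem _ (Submodule.add_mem_sup ⟨_, rfl⟩ (map_mem_smul_top _ hz)))
    p z hz
  have h4 := Submodule.sub_mem _ hFz h1
  rw [sub_sub_cancel, mul_smul] at h4
  exact (Submodule.smul_mem_iff_of_isUnit _ (isUnit_prod_range_sub hR hpa)).1 h4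

variable {R : Type u} [CommRing R] {s r : ℕ} {M : Matrix (Fin s) (Fin r) R}

theorem map_id_eq_augDiff_smul {A S : Type u} [AddCommGroup A] [Module R A] [AddCommGroup S]
    [Module R S] {f : A →ₗ[R] A} {g : A →ₗ[R] R} {w : A} (hf : ∀ x, f x = g x • w)
    {κ : S →ₗ[R] R} {e : S} (he : ∀ φ, φ = κ φ • e) (z : A ⊗[R] S) :
    TensorProduct.map f LinearMap.id z =
      ((TensorProduct.rid R R).toLinearMap ∘ₗ TensorProduct.map g κ) z • (w ⊗ₜ[R] e) := by
  induction z using TensorProduct.induction_on with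
  | zero => simp
  | add z z' hz hz' => rw [map_add, map_add, hz, hz', add_smul]
  | tmul a φ =>
    have e2 : ((TensorProduct.rid R R).toLinearMap ∘ₗ TensorProduct.map g κ) (a ⊗ₜ[R] φ) =
        κ φ * g a := by
      simp
    rw [TensorProduct.map_tmul, LinearMap.id_apply, hf, e2]
    nth_rewrite 1 [he φ]
    rw [TensorProduct.tmul_smul, TensorProduct.smul_tmul', TensorProduct.smul_tmul', smul_smul]

/-- The boundaries modulo the ideal `J`: the submodule `d(Y) + J X` of the target of `d : Y → X`. -/
def boundariesMod {X Y : Type u} [AddCommMonoid X] [Module R X] [AddCommMonoid Y] [Module R Y]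
    (d : Y →ₗ[R] X) (J : Ideal R) : Submodule R X :=
  LinearMap.range d ⊔ J • ⊤

theorem pow_smul_mem_range_sup_of_map {A S Y W : Type u} [AddCommGroup A] [Module R A]
    [AddCommMonoid S] [Module R S] [AddCommGroup Y] [Module R Y] [AddCommGroup W] [Module R W]
    (hR : ∀ m : ℕ, m ≠ 0 → IsUnit (m : R)) {N : A →ₗ[R] A} {F : ℕ → A →ₗ[R] A}
    {d₁ : Y →ₗ[R] A ⊗[R] S} {d₀ : A ⊗[R] S →ₗ[R] W}
    {h₁ : A ⊗[R] S →ₗ[R] Y} {h₀ : W →ₗ[R] A ⊗[R] S} {Δ : R} {a p : ℕ}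
    (hd : d₀ ∘ₗ d₁ = 0)
    (hN : ∀ z, d₁ (h₁ z) + h₀ (d₀ z) = ((a : R) * Δ) • z - TensorProduct.map N LinearMap.id z)
    (h0 : F 0 = LinearMap.id) (hF : ∀ p, F (p + 1) = F p ∘ₗ (N - ((p : R) * Δ) • LinearMap.id))
    (hpa : p ≤ a) {J : Ideal R} {z : A ⊗[R] S} (hz : d₀ z ∈ J • (⊤ : Submodule R W))
    (hFz : TensorProduct.map (F p) LinearMap.id z ∈ boundariesMod d₁ J) :
    Δ ^ p • z ∈ boundariesMod d₁ J := by
  have e0 : TensorProduct.map (F 0) (LinearMap.id : S →ₗ[R] S) = 1 := by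
    rw [h0, TensorProduct.map_id]; rfl
  have e1 : ∀ (p : ℕ) (z : A ⊗[R] S), TensorProduct.map (F (p + 1)) LinearMap.id z =
      TensorProduct.map (F p) LinearMap.id
        (TensorProduct.map N LinearMap.id z - ((p : R) * Δ) • z) := by
    intro p z
    induction z using TensorProduct.induction_on with
    | zero => simp
    | add z w hz hw =>
      rw [map_add, hz, hw, ← map_add]
      congr 1
      rw [map_add, smul_add]
      abel
    | tmul a φ =>
      simp only [hF, TensorProduct.map_tmul, TensorProduct.smul_tmul', ← TensorProduct.sub_tmul,
        LinearMap.comp_apply, LinearMap.sub_apply, LinearMap.smul_apply, LinearMap.id_apply]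
  exact pow_smul_mem_range_sup hR (N := TensorProduct.map N LinearMap.id)
    (F := fun p => TensorProduct.map (F p) LinearMap.id) hd hN e0 e1 hpa hz hFz

/-- Here a = p = s; a further factor N - sΔ would contribute the scalar 0. The s-fold product is
enough because it factors through the augmentation, which sends z into J. -/
theorem pow_smul_mem_boundariesMod_augDiff {A B : Type u} [AddCommGroup A] [Module R A]
    [AddCommGroup B] [Module R B] (hR : ∀ m : ℕ, m ≠ 0 → IsUnit (m : R)) {N : A →ₗ[R] A}
    {F : ℕ → A →ₗ[R] A} {f : Fin s → B →ₗ[R] A} {g : A →ₗ[R] R} {w : A} {Δ : R}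
    {h₁ : A ⊗[R] Sym R s 0 →ₗ[R] B ⊗[R] Sym R s 1} (hfg : ∀ t, g ∘ₗ f t = 0)
    (hN : ∀ z, polyDiff f 0 (h₁ z) = ((s : R) * Δ) • z - TensorProduct.map N LinearMap.id z)
    (h0 : F 0 = LinearMap.id) (hF : ∀ p, F (p + 1) = F p ∘ₗ (N - ((p : R) * Δ) • LinearMap.id))
    (hw : ∀ x, F s x = g x • w) {J : Ideal R} {z : A ⊗[R] Sym R s 0}
    (hz : augDiff s g z ∈ J • (⊤ : Submodule R R)) :
    Δ ^ s • z ∈ boundariesMod (polyDiff f 0) J := by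
  refine pow_smul_mem_range_sup_of_map hR (h₁ := h₁) (h₀ := 0) (augDiff_comp f g hfg)
    (fun z => by rw [LinearMap.zero_apply, add_zero, hN]) h0 hF le_rfl hz ?_
  rw [map_id_eq_augDiff_smul hw (κ := constSym R s) eq_constSym_smul z]
  rw [smul_eq_mul, Ideal.mul_top] at hz
  exact Submodule.mem_sup_right (Submodule.smul_mem_smul hz trivial)

/-- Now a = j + 1 + s ≥ s + 1, so all s + 1 factors may be used, and their product vanishes. -/
theorem pow_smul_mem_boundariesMod_polyDiff {A B C : Type u} [AddCommGroup A] [Module R A]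
    [AddCommGroup B] [Module R B] [AddCommGroup C] [Module R C]
    (hR : ∀ m : ℕ, m ≠ 0 → IsUnit (m : R)) {N : A →ₗ[R] A}
    {F : ℕ → A →ₗ[R] A} {f : Fin s → B →ₗ[R] A} {g : Fin s → A →ₗ[R] C} {Δ : R} {j : ℕ}
    {h₁ : A ⊗[R] Sym R s (j + 1) →ₗ[R] B ⊗[R] Sym R s (j + 2)}
    {h₀ : C ⊗[R] Sym R s j →ₗ[R] A ⊗[R] Sym R s (j + 1)}
    (hfg : ∀ l, g l ∘ₗ f l = 0) (hfg' : ∀ l l', g l ∘ₗ f l' = -(g l' ∘ₗ f l))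
    (hN : ∀ z, polyDiff f (j + 1) (h₁ z) + h₀ (polyDiff g j z) =
      (((j + 1 + s : ℕ) : R) * Δ) • z - TensorProduct.map N LinearMap.id z)
    (h0 : F 0 = LinearMap.id) (hF : ∀ p, F (p + 1) = F p ∘ₗ (N - ((p : R) * Δ) • LinearMap.id))
    (hs : F (s + 1) = 0) {J : Ideal R} {z : A ⊗[R] Sym R s (j + 1)}
    (hz : polyDiff g j z ∈ J • (⊤ : Submodule R (C ⊗[R] Sym R s j))) :
    Δ ^ (s + 1) • z ∈ boundariesMod (polyDiff f (j + 1)) J := by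
  refine pow_smul_mem_range_sup_of_map hR (polyDiff_comp f g hfg hfg' j) hN h0 hF
    (by omega) hz ?_
  rw [hs, TensorProduct.map_zero_left, LinearMap.zero_apply]
  exact zero_mem _


theorem fallingEnd_zero {V : Type u} [AddCommGroup V] [Module R V] (b : Fin s → V)
    (c : Fin s → Module.Dual R V) (Δ : R) (m : ℕ) : fallingEnd b c Δ 0 m = LinearMap.id :=
  LinearMap.ext fun _ => Subtype.ext rfl

theorem fallingEnd_succ {V : Type u} [AddCommGroup V] [Module R V] (b : Fin s → V)
    (c : Fin s → Module.Dual R V) (Δ : R) (m p : ℕ) :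
    fallingEnd b c Δ (p + 1) m =
      fallingEnd b c Δ p m ∘ₗ (numberEnd b c m - ((p : R) * Δ) • LinearMap.id) :=
  LinearMap.ext fun x => Subtype.ext (fallingOp_succ_apply b c Δ p x)

/-- A power of each maximal minor annihilates `H₁` of the Eagon–Northcott complex, modulo any
ideal. -/
theorem det_pow_smul_mem_zero (hR : ∀ m : ℕ, m ≠ 0 → IsUnit (m : R)) (i : Fin s → Fin r)
    (J : Ideal R) (z : ⋀[R]^s (Fin r → R) ⊗[R] Sym R s 0)
    (hz : augDiff s (minorForm M) z ∈ J • (⊤ : Submodule R R)) :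
    ∃ L : ℕ, (M.submatrix id i).det ^ L • z ∈
      boundariesMod (polyDiff (fun t => contractRow M t s) 0) J := by
  obtain ⟨b, hb⟩ := exists_rowForm_eq_det M i
  obtain ⟨w, hw, hF⟩ := exists_fallingOp_eq_minorForm_smul hb
  exact ⟨s, pow_smul_mem_boundariesMod_augDiff hR
    (F := fun p => fallingEnd b (rowForm M) (M.submatrix id i).det p s) (w := ⟨w, hw⟩) (minorForm_contractRow M)
    (polyDiff_polyHomotopy_zero hb s) (fallingEnd_zero _ _ _ _)
    (fallingEnd_succ _ _ _ _)
    (fun x => Subtype.ext (hF x)) hz⟩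

/-- A power of each maximal minor annihilates the higher homology of the Eagon–Northcott complex,
modulo any ideal. -/
theorem det_pow_smul_mem_succ (hR : ∀ m : ℕ, m ≠ 0 → IsUnit (m : R)) (i : Fin s → Fin r)
    (J : Ideal R) (m j : ℕ) (z : ⋀[R]^(m + 1) (Fin r → R) ⊗[R] Sym R s (j + 1))
    (hz : polyDiff (fun t => contractRow M t m) j z ∈
      J • (⊤ : Submodule R (⋀[R]^m (Fin r → R) ⊗[R] Sym R s j))) :
    ∃ L : ℕ, (M.submatrix id i).det ^ L • z ∈
      boundariesMod (polyDiff (fun t => contractRow M t (m + 1)) (j + 1)) J := by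
  obtain ⟨b, hb⟩ := exists_rowForm_eq_det M i
  have h2 : fallingEnd b (rowForm M) (M.submatrix id i).det (s + 1) (m + 1) = 0 :=
    LinearMap.ext fun x => Subtype.ext
      (LinearMap.congr_fun (fallingOp_succ_card_eq_zero hb) (x : ExteriorAlgebra R (Fin r → R)))
  exact ⟨s + 1, pow_smul_mem_boundariesMod_polyDiff hR
    (F := fun p => fallingEnd b (rowForm M) (M.submatrix id i).det p (m + 1))
    (fun t => contractRow_self M t m)
    (contractRow_comm M · · m) (polyDiff_polyHomotopy_succ hb m j)
    (fallingEnd_zero _ _ _ _)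
    (fallingEnd_succ _ _ _ _) h2 hz⟩

end Annihilation

/-! ### Acyclicity from torsion homology and a long regular sequence. -/

section Acyclicity

variable {R : Type u} [CommRing R]

theorem mem_smul_top_of_free {X : Type*} [AddCommGroup X] [Module R X] [Module.Free R X]
    {J : Ideal R} {y : R} (hy : RegularMod J y) {z : X} (hz : y • z ∈ J • (⊤ : Submodule R X)) :
    z ∈ J • (⊤ : Submodule R X) := by
  let b := Module.Free.chooseBasis R X
  rw [← b.linearCombination_repr z, Finsupp.linearCombination_apply]
  refine Submodule.sum_mem _ fun i _ => Submodule.smul_mem_smul (hy _ ?_) trivial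
  have h := map_mem_smul_top (b.coord i) hz
  rw [smul_eq_mul, Ideal.mul_top] at h
  simpa using h

/-- The elements with some power carrying z into B form the radical of an ideal, so generators
suffice. -/
theorem exists_pow_smul_mem_of_mem_span {X : Type*} [AddCommGroup X] [Module R X]
    {B : Submodule R X} {z : X} {S : Set R} (hS : ∀ y ∈ S, ∃ L : ℕ, y ^ L • z ∈ B) {y : R}
    (hy : y ∈ Ideal.span S) : ∃ L : ℕ, y ^ L • z ∈ B := by
  have h : Ideal.span S ≤ Ideal.radical (B.comap (LinearMap.toSpanSingleton R X z)) := by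
    refine Ideal.span_le.2 fun x hx => ?_
    obtain ⟨L, hL⟩ := hS x hx
    exact ⟨L, hL⟩
  exact h hy

theorem mem_smul_top_sup_span_singleton {X : Type*} [AddCommGroup X] [Module R X] {J : Ideal R}
    {y : R} {z : X} (hz : z ∈ (J ⊔ Ideal.span {y}) • (⊤ : Submodule R X)) :
    ∃ t ∈ J • (⊤ : Submodule R X), ∃ u, z = t + y • u := by
  rw [Submodule.sup_smul] at hz
  obtain ⟨t, ht, w, hw, rfl⟩ := Submodule.mem_sup.1 hz
  rw [Submodule.ideal_span_singleton_smul] at hw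
  obtain ⟨u, -, rfl⟩ := (Submodule.mem_smul_pointwise_iff_exists _ _ _).1 hw
  exact ⟨t, ht, u, rfl⟩

theorem mem_boundariesMod {X Y : Type u} [AddCommGroup X] [Module R X] [AddCommGroup Y]
    [Module R Y] {d : Y →ₗ[R] X} {J : Ideal R} {z : X} :
    z ∈ boundariesMod d J ↔ ∃ w, ∃ t ∈ J • (⊤ : Submodule R X), z = d w + t := by
  rw [boundariesMod, Submodule.mem_sup]
  constructor
  · rintro ⟨_, ⟨w, rfl⟩, t, ht, rfl⟩
    exact ⟨w, t, ht, rfl⟩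
  · rintro ⟨w, t, ht, rfl⟩
    exact ⟨_, ⟨w, rfl⟩, t, ht, rfl⟩

/-- Acyclicity of a complex of free modules of length at most `k` whose homology modulo each ideal
is killed by powers of the elements of an ideal of grade at least `k`. -/
theorem mem_boundariesMod_of_regularSeqMod {X : ℕ → Type u} [∀ i, AddCommGroup (X i)]
    [∀ i, Module R (X i)] [∀ i, Module.Free R (X i)] {d : ∀ i, X (i + 1) →ₗ[R] X i}
    (hdd : ∀ i x, d i (d (i + 1) x) = 0) {k : ℕ} (hk : ∀ i, k < i → Subsingleton (X i))
    {I : Ideal R} (hkill : ∀ (J : Ideal R), ∀ y ∈ I, ∀ i (z : X (i + 1)),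
      d i z ∈ J • (⊤ : Submodule R (X i)) → ∃ L : ℕ, y ^ L • z ∈ boundariesMod (d (i + 1)) J)
    (ys : List R) : ∀ (J : Ideal R), (∀ y ∈ ys, y ∈ I) → RegularSeqMod J ys →
      ∀ i, k < i + 1 + ys.length → ∀ z : X (i + 1), d i z ∈ J • (⊤ : Submodule R (X i)) →
        z ∈ boundariesMod (d (i + 1)) J := by
  induction ys with
  | nil =>
    intro J _ _ i hi z _
    have := hk (i + 1) (by simpa using hi)
    rw [Subsingleton.elim z 0]
    exact zero_mem _
  | cons y ys ih =>
    intro J hI hreg i hi z hz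
    obtain ⟨L, hL⟩ := hkill J y (hI y (by simp)) i z hz
    -- It suffices that the homology modulo J has no y-torsion in this degree. By the sequence 0 →
    -- X/J → X/J → X/(J + (y)) → 0, with y as first map, such torsion comes from the next higher
    -- homology modulo J + (y), which vanishes by `ih`. This is why J has to vary in the induction.
    induction L with
    | zero => simpa using hL
    | succ L ihL =>
      refine ihL ?_
      generalize hz' : y ^ L • z = z'
      rw [pow_succ', mul_smul, hz'] at hL
      have hdz : d i z' ∈ J • (⊤ : Submodule R (X i)) := by
        rw [← hz', map_smul]
        exact Submodule.smul_mem _ _ hz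
      obtain ⟨w, t, ht, hw⟩ := mem_boundariesMod.1 hL
      have hdw : d (i + 1) w ∈ (J ⊔ Ideal.span {y}) • (⊤ : Submodule R (X (i + 1))) := by
        rw [← sub_eq_iff_eq_add.2 hw]
        refine Submodule.sub_mem _ (Submodule.smul_mem_smul ?_ trivial)
          (Submodule.smul_mono le_sup_left le_rfl ht)
        exact Ideal.mem_sup_right (Ideal.mem_span_singleton_self y)
      obtain ⟨v, t', ht', hw'⟩ := mem_boundariesMod.1
        (ih _ (fun x hx => hI x (by simp [hx])) hreg.2 (i + 1)
          (by rw [List.length_cons] at hi; omega) w hdw)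
      obtain ⟨t₁, ht₁, u, rfl⟩ := mem_smul_top_sup_span_singleton ht'
      have h1 : y • (z' - d (i + 1) u) ∈ J • (⊤ : Submodule R (X (i + 1))) := by
        have e : y • (z' - d (i + 1) u) = d (i + 1) t₁ + t := by
          rw [smul_sub, hw, hw', map_add, hdd, map_add, map_smul]
          abel
        rw [e]
        exact Submodule.add_mem _ (map_mem_smul_top _ ht₁) ht
      exact mem_boundariesMod.2 ⟨u, _, mem_smul_top_of_free hreg.1 h1, by abel⟩

end Acyclicity

/-! ### Exactness of the Eagon–Northcott complex. -/

section EagonNorthcott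

variable {R : Type u} [CommRing R] {s r : ℕ}

instance free_sym (j : ℕ) : Module.Free R (Sym R s j) := by
  have h := MvPolynomial.homogeneousSubmodule_eq_finsupp_supported (Fin s) R j
  exact Module.Free.of_equiv
    ((LinearEquiv.ofEq _ _ h).trans (AddMonoidAlgebra.supportedEquivFinsupp _)).symm

instance free_eagonNorthcottX (i : ℕ) : Module.Free R (eagonNorthcottX R s r i) := by
  cases i with
  | zero => exact inferInstanceAs (Module.Free R R)
  | succ j => exact inferInstanceAs (Module.Free R (⋀[R]^(s + j) (Fin r → R) ⊗[R] Sym R s j))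

theorem exteriorPower_subsingleton {V : Type*} [AddCommGroup V] [Module R V]
    (b : Module.Basis (Fin r) R V) {m : ℕ} (h : r < m) : Subsingleton (⋀[R]^m V) := by
  have : IsEmpty (Set.powersetCard (Fin r) m) := ⟨fun t => by
    have h1 := t.2
    have h2 := Finset.card_le_univ (t : Finset (Fin r))
    rw [Set.powersetCard.mem_iff] at h1
    rw [Fintype.card_fin] at h2
    omega⟩
  exact (b.exteriorPower m).repr.toEquiv.subsingleton

/-- The grade bound equals the length r - s + 1 of the complex, the last nonzero exterior power
being ⋀^r; so a regular sequence of that length reaches down to degree 1. -/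
theorem eagonNorthcott_exact {M : Matrix (Fin s) (Fin r) R}
    (hR : ∀ m : ℕ, m ≠ 0 → IsUnit (m : R)) (hsr : s ≤ r)
    (hI : DepthGE (maximalMinorsIdeal M) ⊥ (r - s + 1)) (i : ℕ)
    (z : eagonNorthcottX R s r (i + 1)) (hz : (eagonNorthcottD M i).hom z = 0) :
    ∃ w, (eagonNorthcottD M (i + 1)).hom w = z := by
  obtain ⟨ys, hl, hys, hreg⟩ := hI
  have h := mem_boundariesMod_of_regularSeqMod (X := fun i => eagonNorthcottX R s r i)
    (d := fun i => (eagonNorthcottD M i).hom) (k := r - s + 1) (I := maximalMinorsIdeal M)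
    (fun i x => congrArg (fun f => f.hom x) (eagonNorthcottD_comp M i))
    (fun i hi => by
      obtain ⟨j, rfl⟩ : ∃ j, i = j + 1 := ⟨i - 1, by omega⟩
      have := exteriorPower_subsingleton (Pi.basisFun R (Fin r)) (m := s + j) (by omega)
      exact inferInstanceAs (Subsingleton (⋀[R]^(s + j) (Fin r → R) ⊗[R] Sym R s j)))
    (fun J y hy i z hz => exists_pow_smul_mem_of_mem_span (S := _) (by
      rintro _ ⟨e, rfl⟩
      cases i with
      | zero => exact det_pow_smul_mem_zero hR e J z hz
      | succ j => exact det_pow_smul_mem_succ hR e J (s + j) j z hz) hy)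
    ys ⊥ hys hreg i (by omega) z (by
      change (eagonNorthcottD M i).hom z ∈ _
      rw [hz]; exact zero_mem _)
  obtain ⟨w, t, ht, hw⟩ := mem_boundariesMod.1 h
  rw [Submodule.bot_smul, Submodule.mem_bot] at ht
  exact ⟨w, by rw [hw, ht, add_zero]⟩

end EagonNorthcott

/-! ### The Hodge star: contraction into a volume form. -/

section Star

variable {R : Type u} [CommRing R] {V W : Type u} [AddCommGroup V] [Module R V] [AddCommGroup W]
  [Module R W]

theorem exteriorPower_induction {C : ℕ → ExteriorAlgebra R V → Prop}
    (h0 : ∀ r, C 0 (algebraMap R _ r)) (hadd : ∀ m x y, C m x → C m y → C m (x + y))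
    (hmul : ∀ m v x, x ∈ ⋀[R]^m V → C m x → C (m + 1) (ExteriorAlgebra.ι R v * x)) {m : ℕ}
    {x : ExteriorAlgebra R V} (hx : x ∈ ⋀[R]^m V) : C m x := by
  refine Submodule.pow_induction_on_left' _ (C := fun m x _ => C m x) h0
    (fun x y i _ _ => hadd i x y) ?_ hx
  rintro _ ⟨v, rfl⟩ i x hx h
  exact hmul i v x hx h

theorem mul_ι_eq (w : V) {m : ℕ} {x : ExteriorAlgebra R V} (hx : x ∈ ⋀[R]^m V) :
    x * ExteriorAlgebra.ι R w = (-1 : R) ^ m • (ExteriorAlgebra.ι R w * x) := by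
  refine exteriorPower_induction (C := fun m x => x * ExteriorAlgebra.ι R w =
    (-1 : R) ^ m • (ExteriorAlgebra.ι R w * x)) (fun r => ?_) (fun m x y hx hy => ?_)
    (fun m v x _ h => ?_) hx
  · rw [pow_zero, one_smul, Algebra.commutes]
  · rw [add_mul, hx, hy, mul_add, smul_add]
  · have h1 : ExteriorAlgebra.ι R v * ExteriorAlgebra.ι R w =
        -(ExteriorAlgebra.ι R w * ExteriorAlgebra.ι R v) :=
      eq_neg_of_add_eq_zero_left (ExteriorAlgebra.ι_add_mul_swap v w)
    rw [mul_assoc, h, mul_smul_comm, ← mul_assoc, h1, neg_mul, ← mul_assoc, pow_succ, mul_neg_one,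
      neg_smul, smul_neg]

/-- The graded Leibniz rule with the vector on the right: the contraction passes the m factors of x
before it meets w. -/
theorem contr_mul_ι (d : Module.Dual R V) (w : V) {m : ℕ} {x : ExteriorAlgebra R V}
    (hx : x ∈ ⋀[R]^m V) : contr d (x * ExteriorAlgebra.ι R w) =
      contr d x * ExteriorAlgebra.ι R w + ((-1) ^ m * d w) • x := by
  refine exteriorPower_induction (C := fun m x => contr d (x * ExteriorAlgebra.ι R w) =
      contr d x * ExteriorAlgebra.ι R w + ((-1) ^ m * d w) • x) (fun r => ?_)
      (fun m x y hx hy => ?_) (fun m v x _ h => ?_) hx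
  · rw [contr_algebraMap, Algebra.commutes, contr_ι_mul, contr_algebraMap]
    simp
  · rw [add_mul, map_add, hx, hy, map_add, add_mul, smul_add]
    abel
  · rw [mul_assoc, contr_ι_mul, h, contr_ι_mul, sub_mul, smul_mul_assoc, mul_add, mul_smul_comm,
      pow_succ, mul_assoc]
    module

/-- The map `x ↦ x ⌟ ν` from the exterior algebra of `V` to the exterior algebra of `W`, for a
pairing of `V` and `W`. -/
def contrInto (B : V →ₗ[R] Module.Dual R W) (ν : ExteriorAlgebra R W) :
    ExteriorAlgebra R V →ₗ[R] ExteriorAlgebra R W :=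
  LinearMap.applyₗ ν ∘ₗ ((contrAlg R W).comp (ExteriorAlgebra.map B)).toLinearMap

variable {B : V →ₗ[R] Module.Dual R W} {ν : ExteriorAlgebra R W}

theorem contrInto_algebraMap (r : R) : contrInto B ν (algebraMap R _ r) = r • ν := by
  simp [contrInto, Module.algebraMap_end_apply]

theorem contrInto_ι_mul (v : V) (x : ExteriorAlgebra R V) :
    contrInto B ν (ExteriorAlgebra.ι R v * x) = contr (B v) (contrInto B ν x) := by
  simp [contrInto, contrAlg_ι]

theorem contrInto_mem {n : ℕ} (hν : ν ∈ ⋀[R]^n W) {q : ℕ} {x : ExteriorAlgebra R V}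
    (hx : x ∈ ⋀[R]^q V) : contrInto B ν x ∈ ⋀[R]^(n - q) W := by
  refine exteriorPower_induction (C := fun q x => contrInto B ν x ∈ ⋀[R]^(n - q) W) (fun r => ?_)
    (fun m x y hx hy => ?_) (fun m v x _ h => ?_) hx
  · rw [contrInto_algebraMap]
    exact Submodule.smul_mem _ _ hν
  · rw [map_add]
    exact add_mem hx hy
  · rw [contrInto_ι_mul]
    exact contr_mem _ _ h

/-- Since ν ∧ w = 0, the vector w can act only by pairing with the factors of x. The Leibniz rule
moves it past them one at a time. -/
theorem contrInto_contr {n : ℕ} (hν : ν ∈ ⋀[R]^n W)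
    (hν' : ∀ w, ν * ExteriorAlgebra.ι R w = 0) (w : W) {q : ℕ} (hq : q ≤ n)
    {x : ExteriorAlgebra R V} (hx : x ∈ ⋀[R]^q V) :
    contrInto B ν x * ExteriorAlgebra.ι R w =
      (-1 : R) ^ (n + q) • contrInto B ν (contr (B.flip w) x) := by
  revert hq
  refine exteriorPower_induction (C := fun q x => q ≤ n → contrInto B ν x * ExteriorAlgebra.ι R w =
      (-1 : R) ^ (n + q) • contrInto B ν (contr (B.flip w) x)) (fun r _ => ?_)
      (fun m x y hx hy hm => ?_) (fun m v x hx h hm => ?_) hx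
  · rw [contrInto_algebraMap, contr_algebraMap, map_zero, smul_zero, smul_mul_assoc, hν',
      smul_zero]
  · rw [map_add, map_add, add_mul, hx hm, hy hm, map_add, smul_add]
  · have h1 := contr_mul_ι (B v) w (contrInto_mem (B := B) hν hx)
    rw [h (by omega), map_smul, ← contrInto_ι_mul, ← contrInto_ι_mul] at h1
    have h2 : (-1 : R) ^ (n - m) = (-1) ^ (n + m) := by
      rw [show n + m = (n - m) + 2 * m by omega, pow_add, pow_mul]
      simp
    rw [h2] at h1
    rw [← sub_eq_iff_eq_add.2 h1, contr_ι_mul, map_sub, map_smul, LinearMap.flip_apply, ← add_assoc,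
      pow_succ]
    module

end Star

section Star

variable {R : Type u} [CommRing R] {V W : Type u} [AddCommGroup V] [Module R V] [AddCommGroup W]
  [Module R W] {B : V →ₗ[R] Module.Dual R W} {ν : ExteriorAlgebra R W} {n : ℕ}

/-- The sign by which contraction into an `n`-vector is corrected in degree `q`, so that it carries
contractions to right multiplications. -/
def starSign (n q : ℕ) : ℤˣ := ∏ i ∈ Finset.range q, (-1) ^ (n + i + 1)

theorem starSign_succ_mul (q : ℕ) :
    (((starSign n (q + 1) : ℤˣ) : ℤ) : R) * (-1) ^ (n + (q + 1)) = ((starSign n q : ℤˣ) : ℤ) := by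
  rw [starSign, Finset.prod_range_succ, Units.val_mul, Int.cast_mul, mul_assoc]
  have : (((((-1) ^ (n + q + 1) : ℤˣ) : ℤ)) : R) * (-1) ^ (n + (q + 1)) = 1 := by
    push_cast
    rw [add_assoc, ← mul_pow]
    simp
  rw [this, mul_one]
  rfl

/-- Contraction into an `n`-vector, with the sign of degree `q`. -/
def star (B : V →ₗ[R] Module.Dual R W) (ν : ExteriorAlgebra R W) (n q : ℕ) :
    ExteriorAlgebra R V →ₗ[R] ExteriorAlgebra R W :=
  (((starSign n q : ℤˣ) : ℤ) : R) • contrInto B ν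

theorem star_mem (hν : ν ∈ ⋀[R]^n W) {q : ℕ} {x : ExteriorAlgebra R V}
    (hx : x ∈ ⋀[R]^q V) : star B ν n q x ∈ ⋀[R]^(n - q) W :=
  Submodule.smul_mem _ _ (contrInto_mem hν hx)

/-- The recursion of `starSign` cancels the sign in `contrInto_contr`, so the squares between the
two complexes commute exactly. -/
theorem star_mul_ι (hν : ν ∈ ⋀[R]^n W) (hν' : ∀ w, ν * ExteriorAlgebra.ι R w = 0) (w : W)
    {q : ℕ} (hq : q + 1 ≤ n) {x : ExteriorAlgebra R V} (hx : x ∈ ⋀[R]^(q + 1) V) :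
    star B ν n (q + 1) x * ExteriorAlgebra.ι R w = star B ν n q (contr (B.flip w) x) := by
  rw [star, star, LinearMap.smul_apply, LinearMap.smul_apply, smul_mul_assoc,
    contrInto_contr hν hν' w hq hx, smul_smul, starSign_succ_mul]

theorem exists_star_mul_ιMulti (hν : ν ∈ ⋀[R]^n W) (hν' : ∀ w, ν * ExteriorAlgebra.ι R w = 0)
    (q m : ℕ) (hq : q + m ≤ n) : ∃ ε : ℤˣ, ∀ (w : Fin m → W) (x : ExteriorAlgebra R V),
      x ∈ ⋀[R]^(q + m) V → star B ν n (q + m) x * ExteriorAlgebra.ιMulti R m w =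
        ((ε : ℤ) : R) • star B ν n q
          (contrAlg R V (ExteriorAlgebra.ιMulti R m fun i => B.flip (w i)) x) := by
  induction m with
  | zero => exact ⟨1, fun w x _ => by simp⟩
  | succ m ih =>
    obtain ⟨ε, hε⟩ := ih (by omega)
    refine ⟨(-1) ^ m * ε, fun w x hx => ?_⟩
    rw [contrAlg_ιMulti_succ, ← ιMulti_mul_ι,
      mul_ι_eq _ (ExteriorAlgebra.ιMulti_range R m ⟨_, rfl⟩), mul_smul_comm, ← mul_assoc]
    have h1 := star_mul_ι (B := B) (q := q + m) hν hν' (w (Fin.last m)) hq hx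
    rw [show q + (m + 1) = q + m + 1 from rfl, h1, hε _ _ (contr_mem _ (q + m + 1) hx), smul_smul]
    push_cast
    rfl

/-- The second contraction undoes the first one vector at a time, by `contrInto_contr` with V and W
exchanged. This reduces everything to degree 0, where the value is δ. -/
theorem exists_contrInto_contrInto {μ : ExteriorAlgebra R V} {δ : R} (hμ : μ ∈ ⋀[R]^n V)
    (hμ' : ∀ v, μ * ExteriorAlgebra.ι R v = 0) (hν : ν ∈ ⋀[R]^n W)
    (hδ : contrInto B.flip μ ν = algebraMap R _ δ) (q : ℕ) : ∃ ε : ℤˣ, ∀ x ∈ ⋀[R]^q V,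
      contrInto B.flip μ (contrInto B ν x) = (((ε : ℤ) : R) * δ) • x := by
  let ε : ℕ → ℤˣ := fun q => ∏ i ∈ Finset.range q, (-1) ^ (n + (n - i) + i)
  refine ⟨ε q, fun x hx => ?_⟩
  refine exteriorPower_induction (C := fun q x => contrInto B.flip μ (contrInto B ν x) =
    (((ε q : ℤ) : R) * δ) • x) (fun r => ?_)
      (fun m x y hx hy => ?_) (fun m v x hx h => ?_) hx
  · rw [contrInto_algebraMap, map_smul, hδ, Algebra.smul_def, Algebra.smul_def, ← map_mul,
      ← map_mul, mul_comm]
    simp [ε]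
  · rw [map_add, map_add, hx, hy, smul_add]
  · have h1 := contrInto_contr (B := B.flip) hμ hμ' v (Nat.sub_le n m) (contrInto_mem (B := B) hν hx)
    rw [h, smul_mul_assoc, mul_ι_eq v hx, LinearMap.flip_flip, ← contrInto_ι_mul] at h1
    have h2 : (-1 : R) ^ (n + (n - m)) * (-1) ^ (n + (n - m)) = 1 := by
      rw [← mul_pow]; simp
    have h3 := congrArg ((-1 : R) ^ (n + (n - m)) • ·) h1
    simp only [smul_smul, h2, one_smul] at h3
    rw [← h3]
    congr 1
    simp only [ε, Finset.prod_range_succ, Units.val_mul, Int.cast_mul]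
    push_cast
    ring

theorem star_bijOn {μ : ExteriorAlgebra R V} {δ δ' : R} (hμ : μ ∈ ⋀[R]^n V)
    (hμ' : ∀ v, μ * ExteriorAlgebra.ι R v = 0) (hν : ν ∈ ⋀[R]^n W)
    (hν' : ∀ v, ν * ExteriorAlgebra.ι R v = 0)
    (hδ : contrInto B.flip μ ν = algebraMap R _ δ) (hδ' : contrInto B ν μ = algebraMap R _ δ')
    (hu : IsUnit δ) (hu' : IsUnit δ') {q : ℕ} (hq : q ≤ n) :
    Set.BijOn (star B ν n q) (⋀[R]^q V : Submodule R (ExteriorAlgebra R V))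
      (⋀[R]^(n - q) W : Submodule R (ExteriorAlgebra R W)) := by
  have hsign : ∀ ε : ℤˣ, IsUnit (((ε : ℤ) : R)) := fun ε => ε.isUnit.map (Int.castRingHom R)
  obtain ⟨ε, hε⟩ := exists_contrInto_contrInto (B := B) hμ hμ' hν hδ q
  obtain ⟨ε', hε'⟩ := exists_contrInto_contrInto (B := B.flip) (μ := ν) (ν := μ) hν hν' hμ hδ' (n - q)
  refine ⟨fun x hx => star_mem hν hx, fun x hx y hy hxy => ?_, fun y hy => ?_⟩
  · have h1 : contrInto B ν x = contrInto B ν y := (hsign (starSign n q)).smul_left_cancel.1 hxy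
    have h2 := hε x hx
    rw [h1, hε y hy] at h2
    exact (((hsign ε).mul hu).smul_left_cancel.1 h2).symm
  · have hx := contrInto_mem (B := B.flip) hμ hy
    rw [Nat.sub_sub_self hq] at hx
    have h1 := hε' y hy
    rw [LinearMap.flip_flip] at h1
    obtain ⟨a, ha⟩ := (hsign (starSign n q)).mul ((hsign ε').mul hu')
    refine ⟨(↑a⁻¹ : R) • contrInto B.flip μ y, Submodule.smul_mem _ _ hx, ?_⟩
    rw [map_smul, star, LinearMap.smul_apply, h1, smul_smul (starSign n q : ℤ).cast, ← ha, smul_smul,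
      Units.inv_mul, one_smul]

end Star

section Basis

variable {R : Type u} [CommRing R] {n : ℕ} {V W : Type u} [AddCommGroup V] [Module R V]
  [AddCommGroup W] [Module R W]

/-- The product of the vectors of a basis. -/
def volume (b : Module.Basis (Fin n) R V) : ExteriorAlgebra R V := ExteriorAlgebra.ιMulti R n b

theorem volume_mem (b : Module.Basis (Fin n) R V) : volume b ∈ ⋀[R]^n V :=
  ExteriorAlgebra.ιMulti_range R n ⟨_, rfl⟩

theorem volume_mul_ι (b : Module.Basis (Fin n) R V) (v : V) :
    volume b * ExteriorAlgebra.ι R v = 0 := by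
  have h : volume b * ExteriorAlgebra.ι R v ∈ ⋀[R]^(n + 1) V := by
    change _ ∈ LinearMap.range (ExteriorAlgebra.ι R) ^ (n + 1)
    rw [pow_succ]
    exact Submodule.mul_mem_mul (volume_mem b) (LinearMap.mem_range_self _ _)
  have := exteriorPower_subsingleton b (Nat.lt_succ_self n)
  exact congrArg Subtype.val (Subsingleton.elim (⟨_, h⟩ : ⋀[R]^(n + 1) V) 0)

/-- For dual bases the determinant is that of the identity matrix, so only a sign is left. -/
theorem exists_contrInto_volume {B : V →ₗ[R] Module.Dual R W} {e : Module.Basis (Fin n) R V}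
    {b : Module.Basis (Fin n) R W} (hB : ∀ i j, B (e i) (b j) = if i = j then 1 else 0) :
    ∃ δ, IsUnit δ ∧ contrInto B (volume b) (volume e) = algebraMap R _ δ := by
  obtain ⟨ε, hε⟩ := exists_contrAlg_ιMulti_eq_det (R := R) (V := W) n
  refine ⟨((ε : ℤ) : R), ε.isUnit.map (Int.castRingHom R), ?_⟩
  have h1 : (Matrix.of fun i j => B (e i) (b j)) = 1 := by
    ext i j
    rw [Matrix.of_apply, hB, Matrix.one_apply]
  have h2 := hε (fun i => B (e i)) b
  rw [h1, Matrix.det_one, mul_one] at h2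
  rw [← h2]
  change contrAlg R W (ExteriorAlgebra.map B (ExteriorAlgebra.ιMulti R n e)) _ = _
  rw [ExteriorAlgebra.map_apply_ιMulti]
  rfl

end Basis

section PolyDiff

variable {R : Type u} [CommRing R] {s : ℕ} {A B A' B' : Type u} [AddCommGroup A] [Module R A]
  [AddCommGroup B] [Module R B] [AddCommGroup A'] [Module R A'] [AddCommGroup B'] [Module R B']

theorem polyDiff_map {f : Fin s → A →ₗ[R] B} {g : Fin s → A' →ₗ[R] B'} {φ : A →ₗ[R] A'}
    {ψ : B →ₗ[R] B'} (h : ∀ l x, g l (φ x) = ψ (f l x)) (j : ℕ) (z : A ⊗[R] Sym R s (j + 1)) :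
    polyDiff g j (TensorProduct.map φ LinearMap.id z) =
      TensorProduct.map ψ LinearMap.id (polyDiff f j z) := by
  induction z using TensorProduct.induction_on with
  | zero => simp
  | add z w hz hw => simp only [map_add, hz, hw]
  | tmul a p => simp [polyDiff, h]

theorem augDiff_map {f : A →ₗ[R] B} {g : A' →ₗ[R] B'} {φ : A →ₗ[R] A'} {ψ : B →ₗ[R] B'}
    (h : ∀ x, g (φ x) = ψ (f x)) (z : A ⊗[R] Sym R s 0) :
    augDiff s g (TensorProduct.map φ LinearMap.id z) = ψ (augDiff s f z) := by
  induction z using TensorProduct.induction_on with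
  | zero => simp
  | add z w hz hw => simp only [map_add, hz, hw]
  | tmul a p => simp [augDiff, h]

end PolyDiff

/-! ### The isomorphism of the two complexes. -/

section Iso

variable {R : Type u} [CommRing R] {n : ℕ} {Ω : Type u} [AddCommGroup Ω] [Module R Ω]

/-- The pairing of coordinate vectors with the elements of a free module with basis `b`. -/
def pairing (b : Module.Basis (Fin n) R Ω) : (Fin n → R) →ₗ[R] Module.Dual R Ω :=
  LinearMap.mk₂ R (fun v w => v ⬝ᵥ b.equivFun w) (fun v v' w => add_dotProduct v v' _)
    (fun c v w => smul_dotProduct c v _) (fun v w w' => by rw [map_add, dotProduct_add])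
    (fun c v w => by rw [map_smul, dotProduct_smul])

theorem pairing_basis (b : Module.Basis (Fin n) R Ω) (i j : Fin n) :
    pairing b (Pi.basisFun R (Fin n) i) (b j) = if i = j then 1 else 0 := by
  simp [pairing, Finsupp.single_apply, eq_comm]

/-- The coordinates of a collection of elements of a free module. -/
def coordMatrix {s : ℕ} (b : Module.Basis (Fin n) R Ω) (ω : Fin s → Ω) : Matrix (Fin s) (Fin n) R :=
  Matrix.of fun i t => b.repr (ω i) t

theorem pairing_flip {s : ℕ} (b : Module.Basis (Fin n) R Ω) (ω : Fin s → Ω) (i : Fin s) :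
    (pairing b).flip (ω i) = rowForm (coordMatrix b ω) i := by
  refine LinearMap.ext fun v => ?_
  rw [rowForm_apply, Matrix.mulVec, dotProduct_comm]
  rfl

theorem starBasis_bijOn (b : Module.Basis (Fin n) R Ω) {q : ℕ} (hq : q ≤ n) :
    Set.BijOn (star (pairing b) (volume b) n q)
      (⋀[R]^q (Fin n → R) : Submodule R (ExteriorAlgebra R (Fin n → R)))
      (⋀[R]^(n - q) Ω : Submodule R (ExteriorAlgebra R Ω)) := by
  obtain ⟨δ, hu, hδ⟩ := exists_contrInto_volume (B := (pairing b).flip) (e := b)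
    (b := Pi.basisFun R (Fin n)) (fun i j => by
      rw [LinearMap.flip_apply, pairing_basis]
      simp only [eq_comm])
  obtain ⟨δ', hu', hδ'⟩ := exists_contrInto_volume (B := pairing b) (e := Pi.basisFun R (Fin n))
    (b := b) (pairing_basis b)
  exact star_bijOn (volume_mem _) (volume_mul_ι _) (volume_mem _) (volume_mul_ι _) hδ hδ' hu hu' hq

theorem starBasis_bijOn_forms (b : Module.Basis (Fin n) R Ω) {k : ℕ} (hkn : k ≤ n)
    (t : ℕ) : Set.BijOn (star (pairing b) (volume b) n (n - k + 1 + t))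
      (⋀[R]^(n - k + 1 + t) (Fin n → R) : Submodule R (ExteriorAlgebra R (Fin n → R)))
      (forms R Ω k (t + 1) : Submodule R (ExteriorAlgebra R Ω)) := by
  rw [forms]
  split_ifs with h
  · have := starBasis_bijOn b (q := n - k + 1 + t) (by omega)
    rwa [show n - (n - k + 1 + t) = k - (t + 1) by omega] at this
  -- Past degree k both sides vanish: the exterior degree exceeds n.
  · have := exteriorPower_subsingleton (Pi.basisFun R (Fin n)) (m := n - k + 1 + t) (by omega)
    rw [Submodule.subsingleton_iff_eq_bot] at this
    rw [this]
    simp [Set.bijOn_singleton]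

theorem bijective_restrict_of_bijOn {A B : Type*} [AddCommGroup A] [Module R A] [AddCommGroup B]
    [Module R B] {f : A →ₗ[R] B} {p : Submodule R A} {q : Submodule R B} (h : Set.BijOn f p q) :
    Function.Bijective (f.restrict (p := p) (q := q) h.mapsTo) := by
  refine ⟨fun x y hxy => Subtype.ext (h.injOn x.2 y.2 (congrArg Subtype.val hxy)), fun y => ?_⟩
  obtain ⟨x, hx, hxy⟩ := h.surjOn y.2
  exact ⟨⟨x, hx⟩, Subtype.ext hxy⟩

/-- The identification of the exterior powers of `R^n` with complementary exterior powers. -/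
def starEquiv (b : Module.Basis (Fin n) R Ω) {k : ℕ} (hkn : k ≤ n) (t : ℕ) :
    ⋀[R]^(n - k + 1 + t) (Fin n → R) ≃ₗ[R] forms R Ω k (t + 1) :=
  LinearEquiv.ofBijective _ (bijective_restrict_of_bijOn (starBasis_bijOn_forms b hkn t))

theorem wedge_starEquiv (b : Module.Basis (Fin n) R Ω) {k : ℕ} (hkn : k ≤ n) (t : ℕ)
    (ω : Fin (n - k + 1) → Ω) (l : Fin (n - k + 1)) (x : ⋀[R]^(n - k + 1 + (t + 1)) (Fin n → R)) :
    wedge (R := R) k (t + 1) (ω l) (starEquiv b hkn (t + 1) x) =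
      starEquiv b hkn t (contractRow (coordMatrix b ω) l (n - k + 1 + t) x) := by
  by_cases h : n - k + 1 + t + 1 ≤ n
  · refine Subtype.ext ?_
    have := star_mul_ι (B := pairing b) (volume_mem b) (volume_mul_ι b) (ω l) h x.2
    rw [pairing_flip] at this
    exact this
  · have := exteriorPower_subsingleton (Pi.basisFun R (Fin n)) (m := n - k + 1 + (t + 1)) (by omega)
    rw [Subsingleton.elim x 0]
    simp only [map_zero]

/-- The identification of `R` with the top exterior power. -/
def topEquiv (b : Module.Basis (Fin n) R Ω) (ε : ℤˣ) : R ≃ₗ[R] ⋀[R]^n Ω :=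
  LinearEquiv.ofBijective
    (LinearMap.toSpanSingleton R (⋀[R]^n Ω) (((ε : ℤ) : R) • ⟨volume b, volume_mem b⟩)) (by
    have hε : IsUnit (((ε : ℤ) : R)) := ε.isUnit.map (Int.castRingHom R)
    have h := starBasis_bijOn b (Nat.zero_le n)
    have h1 : ∀ r, star (pairing b) (volume b) n 0 (algebraMap R _ r) = r • volume b := fun r => by
      simp [star, starSign, contrInto_algebraMap]
    have h0 : ∀ r, algebraMap R (ExteriorAlgebra R (Fin n → R)) r ∈ ⋀[R]^0 (Fin n → R) :=
      fun r => Submodule.algebraMap_mem r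
    constructor
    · intro r r' hr
      have h2 : (r * (ε : ℤ)) • volume b = (r' * (ε : ℤ)) • volume b := by
        rw [mul_smul, mul_smul]
        exact congrArg Subtype.val hr
      rw [← h1, ← h1] at h2
      exact hε.mul_left_injective
        ((ExteriorAlgebra.algebraMap_leftInverse (Fin n → R)).injective (h.injOn (h0 _) (h0 _) h2))
    · rintro ⟨y, hy⟩
      obtain ⟨x, hx, rfl⟩ := h.surjOn hy
      obtain ⟨r, rfl⟩ := exists_algebraMap_of_mem_zero hx
      obtain ⟨a, ha⟩ := hε
      refine ⟨r * ↑a⁻¹, Subtype.ext ?_⟩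
      change (r * ↑a⁻¹) • (((ε : ℤ) : R) • volume b) =
        star (pairing b) (volume b) n 0 (algebraMap R _ r)
      rw [h1, smul_smul, ← ha, mul_assoc, Units.inv_mul, mul_one])

theorem topEquiv_coe (b : Module.Basis (Fin n) R Ω) (ε : ℤˣ) (r : R) :
    (topEquiv b ε r : ExteriorAlgebra R Ω) = r • ((ε : ℤ) : R) • volume b := rfl

/-- Multiplication by all ω_l corresponds to contraction by all rows, which is ± the minor form. The
sign does not depend on ω or x, so it can be built into the identification of R with Ω^n. -/
theorem exists_wedgeAll_starEquiv (b : Module.Basis (Fin n) R Ω) {k : ℕ} (hk : 1 ≤ k)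
    (hkn : k ≤ n) : ∃ ε : ℤˣ, ∀ (ω : Fin (n - k + 1) → Ω) (x : ⋀[R]^(n - k + 1) (Fin n → R)),
      wedgeAll (R := R) hk hkn ω (starEquiv b hkn 0 x) =
        topEquiv b ε (minorForm (coordMatrix b ω) x) := by
  obtain ⟨ε, hε⟩ := exists_star_mul_ιMulti (B := pairing b) (volume_mem b) (volume_mul_ι b) 0
    (n - k + 1) (by omega)
  simp only [zero_add] at hε
  obtain ⟨ε', hε'⟩ := exists_contrAlg_rowForm_eq_minorForm (R := R) (s := n - k + 1) (r := n)
  refine ⟨ε * ε', fun ω x => Subtype.ext ?_⟩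
  have h1 := hε ω x x.2
  simp only [pairing_flip] at h1
  rw [hε' (coordMatrix b ω) x] at h1
  rw [topEquiv_coe]
  refine Eq.trans ?_ (h1.trans ?_)
  · rfl
  · rw [star, LinearMap.smul_apply, contrInto_algebraMap]
    simp only [starSign, Finset.range_zero, Finset.prod_empty, smul_smul]
    congr 1
    push_cast
    ring

/-- The components of the isomorphism from the Eagon–Northcott complex to the complex of a
collection of 1-forms. -/
def starComponent (b : Module.Basis (Fin n) R Ω) {k : ℕ} (hkn : k ≤ n) (ε : ℤˣ) :
    ∀ t, eagonNorthcottX R (n - k + 1) n t ≅ formsComplexX R Ω n k t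
  | 0 => (topEquiv b ε).toModuleIso
  | t + 1 => (TensorProduct.congr (starEquiv b hkn t)
      (LinearEquiv.refl R (Sym R (n - k + 1) t))).toModuleIso

theorem nonempty_formsComplex_iso (b : Module.Basis (Fin n) R Ω) {k : ℕ} (hk : 1 ≤ k)
    (hkn : k ≤ n) (ω : Fin (n - k + 1) → Ω) :
    Nonempty (formsComplex (R := R) hk hkn ω ≅ eagonNorthcott (coordMatrix b ω)) := by
  obtain ⟨ε, hε⟩ := exists_wedgeAll_starEquiv b hk hkn
  have key : ∀ t, (starComponent b hkn ε (t + 1)).hom ≫ formsComplexD (R := R) hk hkn ω t =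
      eagonNorthcottD (coordMatrix b ω) t ≫ (starComponent b hkn ε t).hom := by
    intro t
    refine ModuleCat.hom_ext (LinearMap.ext fun z => ?_)
    cases t with
    | zero =>
      exact augDiff_map (φ := (starEquiv b hkn 0).toLinearMap)
        (ψ := (topEquiv b ε).toLinearMap) (hε ω) z
    | succ t =>
      exact polyDiff_map (φ := (starEquiv b hkn (t + 1)).toLinearMap)
        (ψ := (starEquiv b hkn t).toLinearMap) (fun l x => wedge_starEquiv b hkn t ω l x) t z
  refine ⟨(HomologicalComplex.Hom.isoOfComponents (starComponent b hkn ε) ?_).symm⟩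
  rintro i j rfl
  dsimp only [formsComplex, eagonNorthcott]
  rw [ChainComplex.of_d, ChainComplex.of_d]
  exact key j

end Iso

/-! ### The augmentation to the quotient by the maximal minors. -/

section Resolution

variable {R : Type u} [CommRing R] {s r : ℕ}

theorem range_augDiff {A : Type u} [AddCommGroup A] [Module R A] (g : A →ₗ[R] R) :
    LinearMap.range (augDiff s g) = LinearMap.range g := by
  apply le_antisymm
  · rintro _ ⟨z, rfl⟩
    induction z using TensorProduct.induction_on with
    | zero => rw [map_zero]; exact zero_mem _
    | add z w hz hw => rw [map_add]; exact add_mem hz hw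
    | tmul a p => exact ⟨constSym R s p • a, by simp [augDiff]⟩
  · rintro _ ⟨a, rfl⟩
    refine ⟨a ⊗ₜ ⟨1, MvPolynomial.isHomogeneous_one _ _⟩, ?_⟩
    simp [augDiff, constSym]

theorem range_minorForm (M : Matrix (Fin s) (Fin r) R) :
    LinearMap.range (minorForm M) = maximalMinorsIdeal M := by
  apply le_antisymm
  · let b := (Pi.basisFun R (Fin r)).exteriorPower s
    rw [LinearMap.range_eq_map, ← b.span_eq, Submodule.map_span, Submodule.span_le]
    rintro _ ⟨_, ⟨t, rfl⟩, rfl⟩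
    have : b t = exteriorPower.ιMulti R s
        (fun a => Pi.single (Set.powersetCard.ofFinEmbEquiv.symm t a) 1) := by
      rw [exteriorPower.basis_apply]
      simp [exteriorPower.ιMulti_family, Function.comp_def]
    rw [this, minorForm_basis]
    exact Ideal.subset_span ⟨_, rfl⟩
  · refine Submodule.span_le.2 ?_
    rintro _ ⟨i, rfl⟩
    exact ⟨_, minorForm_basis M i⟩

theorem mem_maximalMinorsIdeal_iff {M : Matrix (Fin s) (Fin r) R} {y : R} :
    y ∈ maximalMinorsIdeal M ↔ ∃ z, augDiff s (minorForm M) z = y := by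
  rw [← range_minorForm, ← range_augDiff (s := s)]
  rfl

theorem eagonNorthcott_d (M : Matrix (Fin s) (Fin r) R) (i : ℕ) :
    (eagonNorthcott M).d (i + 1) i = eagonNorthcottD M i :=
  ChainComplex.of_d _ _ _

/-- The augmentation of the Eagon–Northcott complex. -/
def eagonNorthcottAug (M : Matrix (Fin s) (Fin r) R) :
    eagonNorthcott M ⟶ (ChainComplex.single₀ (ModuleCat.{u} R)).obj
      (ModuleCat.of R (R ⧸ maximalMinorsIdeal M)) :=
  (ChainComplex.toSingle₀Equiv _ _).symm
    ⟨ModuleCat.ofHom (Submodule.mkQ (maximalMinorsIdeal M)), by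
      rw [eagonNorthcott_d]
      refine ModuleCat.hom_ext (LinearMap.ext fun z => ?_)
      exact (Submodule.Quotient.mk_eq_zero _).2 (mem_maximalMinorsIdeal_iff.2 ⟨z, rfl⟩)⟩

/-- Positive degrees are the hypothesis; in degree 0 the image of d_1 is the ideal of maximal
minors, the kernel of the augmentation. -/
theorem quasiIso_eagonNorthcottAug {M : Matrix (Fin s) (Fin r) R}
    (h : ∀ (i : ℕ) (z : eagonNorthcottX R s r (i + 1)), (eagonNorthcottD M i).hom z = 0 →
      ∃ w, (eagonNorthcottD M (i + 1)).hom w = z) : QuasiIso (eagonNorthcottAug M) := by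
  rw [quasiIso_iff]
  rintro (_ | i)
  · rw [ChainComplex.quasiIsoAt₀_iff, ShortComplex.quasiIso_iff_of_zeros']
    rotate_left
    · exact (eagonNorthcott M).shape _ _ (by simp)
    · exact HomologicalComplex.single_obj_d (ComplexShape.down ℕ) 0 _ _ _
    · exact HomologicalComplex.single_obj_d (ComplexShape.down ℕ) 0 _ _ _
    have e0 : (eagonNorthcottAug M).f 0 =
        ModuleCat.ofHom (Submodule.mkQ (maximalMinorsIdeal M)) :=
      ChainComplex.toSingle₀Equiv_symm_apply_f_zero _ _
    constructor
    · rw [ShortComplex.moduleCat_exact_iff]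
      intro z hz
      change ((eagonNorthcottAug M).f 0).hom z = 0 at hz
      rw [e0] at hz
      obtain ⟨w, hw⟩ := mem_maximalMinorsIdeal_iff.1 ((Submodule.Quotient.mk_eq_zero _).1 hz)
      refine ⟨w, ?_⟩
      change ((eagonNorthcott M).d 1 0).hom w = z
      rw [eagonNorthcott_d]
      exact hw
    · change Epi ((eagonNorthcottAug M).f 0)
      rw [e0]
      exact (ModuleCat.epi_iff_surjective _).2 (Submodule.mkQ_surjective _)
  · rw [quasiIsoAt_iff_exactAt' _ _ (ChainComplex.exactAt_succ_single_obj _ _),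
      HomologicalComplex.exactAt_iff' _ (i + 2) (i + 1) i (by simp) (by simp),
      ShortComplex.moduleCat_exact_iff]
    intro z hz
    change ((eagonNorthcott M).d (i + 1) i).hom z = 0 at hz
    rw [eagonNorthcott_d] at hz
    obtain ⟨w, hw⟩ := h i z hz
    refine ⟨w, ?_⟩
    change ((eagonNorthcott M).d (i + 2) (i + 1)).hom w = z
    rw [eagonNorthcott_d]
    exact hw

end Resolution

theorem free_of_iso {R : Type*} [Ring R] {X Y : ModuleCat R} (e : X ≅ Y) (h : Module.Free R Y) :
    Module.Free R X :=
  Module.Free.of_equiv e.toLinearEquiv.symm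

/-! ### The basis of holomorphic 1-forms and division by integers. -/

section OneForms

variable {n : ℕ}

/-- A 1-form as the vector of its coefficients. -/
def coefficientLinearMap (n : ℕ) : holoOneForms n →ₗ[holoGerms n] (Fin n → holoGerms n) where
  toFun ω := coefficient ω
  map_add' := by
    rintro ⟨_, f, hf, rfl⟩ ⟨_, g, hg, rfl⟩
    rfl
  map_smul' := by
    rintro ⟨_, f, hf, rfl⟩ ⟨_, g, hg, rfl⟩
    rfl

theorem coefficientLinearMap_injective : Function.Injective (coefficientLinearMap n) := by
  refine (injective_iff_map_eq_zero _).2 ?_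
  rintro ⟨_, f, hf, rfl⟩ h
  have h1 : ∀ t, ∀ᶠ x in 𝓝 (0 : Fin n → ℂ), f x (Pi.single t 1) = 0 := fun t =>
    Filter.Germ.coe_eq.1 (congrArg Subtype.val (congrFun h t))
  refine Subtype.ext (Filter.Germ.coe_eq.2 ?_)
  filter_upwards [Filter.eventually_all.2 h1] with x hx
  refine ContinuousLinearMap.coe_injective (LinearMap.pi_ext' fun t => LinearMap.ext_ring ?_)
  simpa using hx t

theorem coefficientLinearMap_surjective : Function.Surjective (coefficientLinearMap n) := by
  intro m
  choose f hf hfm using fun t => (m t).2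
  have han : AnalyticAt ℂ
      (fun x => ∑ t, f t x • (ContinuousLinearMap.proj t : (Fin n → ℂ) →L[ℂ] ℂ)) 0 :=
    Finset.analyticAt_fun_sum _ fun t _ => (hf t).smul analyticAt_const
  refine ⟨⟨_, _, han, rfl⟩, funext fun t => Subtype.ext ?_⟩
  rw [← hfm]
  refine Filter.Germ.coe_eq.2 (Filter.Eventually.of_forall fun x => ?_)
  simp [Pi.single_apply]

/-- The basis `dx₁, …, dx_n` of the module of 1-forms. -/
def oneFormBasis (n : ℕ) : Module.Basis (Fin n) (holoGerms n) (holoOneForms n) :=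
  Module.Basis.ofEquivFun (LinearEquiv.ofBijective (coefficientLinearMap n)
    ⟨coefficientLinearMap_injective, coefficientLinearMap_surjective⟩)

theorem coordMatrix_oneFormBasis {s : ℕ} (ω : Fin s → holoOneForms n) :
    coordMatrix (oneFormBasis n) ω = coefficientMatrix ω := rfl

/-- Constant germs provide the inverses that the annihilation argument needs. -/
theorem isUnit_natCast_holoGerms {m : ℕ} (hm : m ≠ 0) : IsUnit (m : holoGerms n) := by
  refine IsUnit.of_mul_eq_one
    (⟨_, fun _ => (m : ℂ)⁻¹, analyticAt_const, rfl⟩ : holoGerms n) (Subtype.ext ?_)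
  refine Filter.Germ.coe_eq.2 (Filter.Eventually.of_forall fun x => ?_)
  simp [hm]

end OneForms

end CollectionIndex

end

theorem mainTheorem9 (n k : ℕ) (hk : 1 ≤ k) (hkn : k ≤ n)
    (ω : Fin (n - k + 1) → CollectionIndex.holoOneForms n) :
    Nonempty (CollectionIndex.formsComplex (R := CollectionIndex.holoGerms n) hk hkn ω ≅
      CollectionIndex.eagonNorthcott (CollectionIndex.coefficientMatrix ω)) ∧
    (CollectionIndex.IsCohenMacaulayLocalRing (CollectionIndex.degeneracyLocalRing ω) →
      ringKrullDim (CollectionIndex.degeneracyLocalRing ω) = ((n - k : ℕ) : WithBot ℕ∞) →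
      (∀ t, Module.Free (CollectionIndex.holoGerms n)
        ((CollectionIndex.formsComplex (R := CollectionIndex.holoGerms n) hk hkn ω).X t)) ∧
      ∃ π : CollectionIndex.formsComplex (R := CollectionIndex.holoGerms n) hk hkn ω ⟶
          (ChainComplex.single₀ (ModuleCat (CollectionIndex.holoGerms n))).obj
            (ModuleCat.of (CollectionIndex.holoGerms n)
              (CollectionIndex.degeneracyLocalRing ω)),
        QuasiIso π) := by
  obtain ⟨e⟩ := CollectionIndex.nonempty_formsComplex_iso (CollectionIndex.oneFormBasis n) hk hkn ω
  rw [CollectionIndex.coordMatrix_oneFormBasis] at e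
  refine ⟨⟨e⟩, fun hCM hdim => ⟨fun t => ?_, ?_⟩⟩
  · have : Module.Free (CollectionIndex.holoGerms n)
        ((CollectionIndex.eagonNorthcott (CollectionIndex.coefficientMatrix ω)).X t) :=
      CollectionIndex.free_eagonNorthcottX t
    exact CollectionIndex.free_of_iso ((HomologicalComplex.eval _ _ t).mapIso e) this
  -- Depth at least n for R and dimension n - k for the quotient give grade at least k, which is the
  -- length n - s + 1 of the complex for s = n - k + 1.
  · have hdepth := CollectionIndex.depthGE_of_isCohenMacaulayLocalRing (show n = k + (n - k) by omega)
      CollectionIndex.depthGE_maximalIdeal_holoGerms hCM hdim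
    have := CollectionIndex.quasiIso_eagonNorthcottAug
      (CollectionIndex.eagonNorthcott_exact (M := CollectionIndex.coefficientMatrix ω)
        (fun m hm => CollectionIndex.isUnit_natCast_holoGerms hm) (by omega)
        (by rwa [show n - (n - k + 1) + 1 = k by omega]))
    exact ⟨e.hom ≫ CollectionIndex.eagonNorthcottAug _, inferInstance⟩
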